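/- **Setting.** Let $(\mathcal K,\prec)$ be an abstract elementary class (AEC) in a language $L$: a class of $L$-structures with a partial order $\prec$ refining "substructure", closed under isomorphism, coherent ($M\subseteq N$, $M\prec M^*$, $N\prec M^*$ imply $M\prec N$), closed under unions of $\prec$-increasing chains (the union of such a chain is in $\mathcal K$ and $\prec$-extends its members, and is $\prec N$ if all members are), and with a least cardinal $\mathrm{LS}(\mathcal K)\ge\aleph_0+|L|$ such that every $A\subseteq M\in\mathcal K$ is contained in some $N\prec M$ with $\|N\|\le|A|+\mathrm{LS}(\mathcal K)$. $\mathcal K_\mu$ is the class of models of cardinality $\mu$. A $\mathcal K$-embedding is an embedding whose image is $\prec$ its target. **Systems.** For a nonempty downward closed $I\subseteq\mathcal P(n)$, an $I$-system in $\mathcal K_\mu$ is a family $\mathbf S=\langle M_s\in\mathcal K_\mu: s\in I\rangle$ with $M_s\prec M_t$ for $s\subseteq t$ and $M_{s\cap t}=M_s\cap M_t$. Put $A_I=\bigcup_{s\in I}M_s$, $A_t=\bigcup_{s\subsetneq t}M_s$, $\mathcal P^-(n)=\mathcal P(n)\setminus\{n\}$. For a system inside $N\in\mathcal K$ (all $M_s\prec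 N$) and $\mu\ge\mathrm{LS}(\mathcal K)$, the set $A_I\subseteq N$, with the structure induced from $N$, is a $\mu$-amalgamation base if any two $N_1,N_2\in\mathcal K_\mu$ that contain $A_I$ with this induced structure and satisfy $M_s\prec N_\ell$ for all $s\in I$ can be amalgamated over $A_I$ in $\mathcal K_\mu$. $\mathrm{Ab}$ is the class of all amalgamation bases, over all $\mu$, $I$ and $\mathbf S$. **Weak forking notion.** This is a relation $A\perp_C^N B$ for $N\in\mathcal K$, $A,B,C\subseteq N$, $C\in\mathrm{Ab}$, and a cardinal $\kappa(\mathcal K)$; it is given for $C\subseteq A\cap B$, and in general $A\perp_C^NB$ stands for $A\cup C\perp_C^N B\cup C$. It satisfies, all bases being in $\mathrm{Ab}$: 1. *Invariance*: for a $\mathcal K$-embedding $f:N\to N'$, $A\perp^N_CB$ iff $f(A)\perp^{N'}_{f(C)}f(B)$. 2. *Monotonicity*: if $C\subseteq C'\subseteq B'\subseteq B$ then $A\perp_C^NB$ implies $A\perp_{C'}^NB'$. 3. *Disjointness*: $A\perp_C^NB$ implies $A\cap B\subseteq C$. 4. *Extension*: if $M_0\prec M$ and $M_0\prec N_0$ are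 models, there are $N\succ M$ and a $\mathcal K$-embedding $f:N_0\to N$ over $M_0$ with $M\perp_{M_0}^Nf(N_0)$. 5. *Continuity*: if $\langle B_i:i<\delta\rangle$, $\delta$ a limit ordinal, is an increasing continuous chain and $A\perp_C^NB_i$ for all $i<\delta$, then $A\perp_C^N\bigcup_{i<\delta}B_i$. 6. *Symmetry*: $A\perp_C^NB$ implies $B\perp_C^NA$. 7. *Transitivity*: if $C\subseteq B\subseteq D$, $A\perp_C^NB$ and $A\perp_B^ND$, then $A\perp_C^ND$. 8. *Local character*: if $A,B,A'\in\mathrm{Ab}$ and $A'\subseteq A\cup B$, there is $B'\subseteq B$ in $\mathrm{Ab}$ with $|B'|\le\kappa(\mathcal K)+|A'|$ and $A'\perp^N_{B'}B$. 9. *Definability*: for all $A,B\subseteq N$ there are at most $\kappa(\mathcal K)$ finitary functions on $N$ such that $A'\perp^N_{B\cap A'}B$ for every $A'\subseteq A\cup B$ closed under them with $A',B\cap A'\in\mathrm{Ab}$. **Goodness.** A $\mathcal P(n)$-system $\mathbf S$ in $\mathcal K_\lambda$ is *stable* if for every nonempty $t\subsetneq n$ the set $A_t$ is a $\lambda$-amalgamation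 base (for the system $\langle M_s:s\subsetneq t\rangle$) and $M_t\perp_{A_t}^{M_n}\bigcup\{M_w: w\subsetneq n,\ w\not\supseteq t\}$; likewise for systems indexed by $\mathcal P(s)$, $s$ a finite set. - *$(\lambda,n)$-symmetry*: a $\mathcal P(n)$-system in $\mathcal K_\lambda$ is stable whenever $\mathcal P^-(n)$ has an enumeration $\langle s(i):i<2^n-1\rangle$ without repetitions, with $s(i)\subsetneq s(j)\Rightarrow i<j$, such that for all $j$ with $s(j)\neq\emptyset$, $A_{s(j)}$ is a $\lambda$-amalgamation base and $M_{s(j)}\perp^{M_n}_{A_{s(j)}}\bigcup_{i<j}M_{s(i)}$. - *$(\lambda,n)$-existence*: for every $\mathcal P^-(n)$-system in $\mathcal K_\lambda$ such that $\{M_t:t\subseteq s\}$ is stable for every $s\in\mathcal P^-(n)$, there are $M_n\in\mathcal K_\lambda$ and $\mathcal K$-embeddings $f_s:M_s\to M_n$ ($s\in\mathcal P^-(n)$) with $f_t\restriction M_s=f_s$ for $s\subseteq t$, such that $\{f_s(M_s):s\in\mathcal P^-(n)\}\cup\{M_n\}$ is a stable $\mathcal P(n)$-system. - *weak $(\lambda,n)$-uniqueness*: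 for all stable $\mathcal P(n)$-systems $\langle M_s\rangle$, $\langle M'_s\rangle$ in $\mathcal K_\lambda$ and isomorphisms $f_s:M_s\cong M'_s$ ($s\in\mathcal P^-(n)$) with $f_t\restriction M_s=f_s$ for $s\subseteq t$, there are $M^*\in\mathcal K_\lambda$ and $\mathcal K$-embeddings $g:M_n\to M^*$, $g':M'_n\to M^*$ with $g\restriction M_s=g'\circ f_s$ for all $s\in\mathcal P^-(n)$. $(\lambda,n)$-*goodness* is the conjunction of these three. $(\mathcal K,\perp)$ is *excellent* if it has $(\mathrm{LS}(\mathcal K),n)$-goodness for all $1\le n<\omega$. **Theorem.** Let $(\mathcal K,\perp)$ be a weak forking notion with $\kappa(\mathcal K)\le\mathrm{LS}(\mathcal K)$. If $(\mathcal K,\perp)$ is excellent, then it has the $(\lambda,n)$-goodness property, that is $(\lambda,n)$-symmetry, $(\lambda,n)$-existence and weak $(\lambda,n)$-uniqueness, for every $1\le n<\omega$ and every $\lambda\ge\mathrm{LS}(\mathcal K)$. Consequently $\mathcal K$ is $\mathrm{LS}(\mathcal K)$-tame: it has the amalgamation property in every $\mu\ge\mathrm{LS}(\mathcal K)$, and for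 all $M\in\mathcal K$ with $\|M\|>\mathrm{LS}(\mathcal K)$, two Galois types of elements over $M$ are equal if their restrictions to every $N\prec M$ of cardinality $\le\mathrm{LS}(\mathcal K)$ are equal. (Here $a_1\in N_1$ and $a_2\in N_2$, where $M\prec N_1,N_2$, have the same Galois type over $M$ if there are $N\in\mathcal K$ and $\mathcal K$-embeddings $g_\ell:N_\ell\to N$ that agree on $M$ with $g_1(a_1)=g_2(a_2)$.) -/

import Mathlib

open Cardinal
open scoped FirstOrder

universe u

/-- An abstract elementary class of `L`-structures. `Mem M` says that `M` belongs to the class,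
`Strong S` says that the substructure `S` of `N` satisfies `S ≺ N`. -/
structure AEC (L : FirstOrder.Language.{u, u}) where
  /-- membership in the class -/
  Mem : ∀ (M : Type u) [L.Structure M], Prop
  /-- `Strong S`, for `S` a substructure of `N`, is `S ≺ N` -/
  Strong : ∀ {N : Type u} [L.Structure N], L.Substructure N → Prop
  /-- `≺` is a relation between members of the class -/
  mem_of_strong : ∀ {N : Type u} [L.Structure N] (S : L.Substructure N),
    Strong S → Mem S ∧ Mem N
  /-- `≺` is reflexive -/
  strong_top : ∀ {N : Type u} [L.Structure N], Mem N → Strong (⊤ : L.Substructure N)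
  /-- `≺` is transitive: if `S ≺ T` and `T ≺ N` then `S ≺ N` -/
  strong_trans : ∀ {N : Type u} [L.Structure N] (S T : L.Substructure N), S ≤ T →
    Strong (S.comap T.subtype.toHom) → Strong T → Strong S
  /-- closure under isomorphism, for models -/
  mem_iso : ∀ {M N : Type u} [L.Structure M] [L.Structure N], (M ≃[L] N) → Mem M → Mem N
  /-- closure under isomorphism, for `≺` -/
  strong_iso : ∀ {M N : Type u} [L.Structure M] [L.Structure N] (f : M ≃[L] N)
    (S : L.Substructure M), Strong S → Strong (S.map f.toHom)
  /-- coherence: if `S ⊆ T`, `S ≺ N` and `T ≺ N` then `S ≺ T` -/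
  coherence : ∀ {N : Type u} [L.Structure N] (S T : L.Substructure N), S ≤ T →
    Strong S → Strong T → Strong (S.comap T.subtype.toHom)
  /-- downward Löwenheim–Skolem -/
  exists_LS : ∃ κ : Cardinal.{u}, ℵ₀ + L.card ≤ κ ∧
    ∀ (M : Type u) [L.Structure M], Mem M → ∀ A : Set M,
      ∃ S : L.Substructure M, Strong S ∧ A ⊆ S ∧ #S ≤ #A + κ
  /-- chains below a model of the class -/
  chain_below : ∀ (μ : Cardinal.{u}), μ.IsRegular → ∀ {N : Type u} [L.Structure N], Mem N →
    ∀ S : Set.Iio μ.ord → L.Substructure N, Monotone S → (∀ i, Strong (S i)) →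
      ∀ T : L.Substructure N, (T : Set N) = ⋃ i, (S i : Set N) → Strong T
  /-- chains: `U` is the union of the `≺`-increasing chain of its substructures `S i` -/
  chain_union : ∀ (μ : Cardinal.{u}), μ.IsRegular → ∀ {U : Type u} [L.Structure U],
    ∀ S : Set.Iio μ.ord → L.Substructure U, Monotone S →
      (∀ i j, i < j → Strong ((S i).comap (S j).subtype.toHom)) →
      (⋃ i, (S i : Set U)) = Set.univ → Mem U ∧ ∀ i, Strong (S i)

namespace AEC

variable {L : FirstOrder.Language.{u, u}}

/-- `LS(K)`: the least cardinal as in the Löwenheim–Skolem axiom. -/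
noncomputable def LS (K : AEC L) : Cardinal.{u} :=
  sInf {κ : Cardinal.{u} | ℵ₀ + L.card ≤ κ ∧
    ∀ (M : Type u) [L.Structure M], K.Mem M → ∀ A : Set M,
      ∃ S : L.Substructure M, K.Strong S ∧ A ⊆ S ∧ #S ≤ #A + κ}

/-- The members of the class. -/
structure Model (K : AEC L) where
  /-- universe of the model -/
  carrier : Type u
  /-- its `L`-structure -/
  [str : L.Structure carrier]
  /-- it belongs to the class -/
  mem : K.Mem carrier

instance (K : AEC L) : CoeSort K.Model (Type u) := ⟨Model.carrier⟩

instance (K : AEC L) (M : K.Model) : L.Structure M := M.str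

/-- `K`-embeddings: the image is a strong submodel. -/
def IsKEmb (K : AEC L) {M N : Type u} [L.Structure M] [L.Structure N] (f : M ↪[L] N) : Prop :=
  K.Mem M ∧ K.Strong f.toHom.range

/-- `I`-systems of models of cardinality `μ` inside a model `N`, where `I` is a nonempty
downward closed set of finite sets of natural numbers. (That `S s ≺ S t` for `s ⊆ t` follows
from `S s ≺ N`, `S t ≺ N` and coherence.) -/
structure IsSystem (K : AEC L) (μ : Cardinal.{u}) (N : K.Model)
    (I : Finset (Finset ℕ)) (S : Finset ℕ → L.Substructure N) : Prop where
  nonempty : I.Nonempty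
  down : ∀ t ∈ I, ∀ s, s ⊆ t → s ∈ I
  strong : ∀ s ∈ I, K.Strong (S s)
  mono : ∀ s ∈ I, ∀ t ∈ I, s ⊆ t → S s ≤ S t
  inter : ∀ s ∈ I, ∀ t ∈ I, S (s ∩ t) = S s ⊓ S t
  card : ∀ s ∈ I, #(S s) = μ

/-- The union of a system. -/
def unionOf {N : Type u} [L.Structure N] (I : Finset (Finset ℕ))
    (S : Finset ℕ → L.Substructure N) : Set N :=
  {x | ∃ s ∈ I, x ∈ S s}

/-- `A_t`: the union of the `S s` for `s` a proper subset of `t`. -/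
def bdry {N : Type u} [L.Structure N] (S : Finset ℕ → L.Substructure N) (t : Finset ℕ) : Set N :=
  unionOf t.ssubsets S

/-- `j` puts the set `unionOf I S` (a subset of `N`, with the structure induced from `N`) inside
the model `M`, in such a way that each model of the system becomes a strong submodel of `M`. -/
structure IsPlacement (K : AEC L) {N : K.Model} (I : Finset (Finset ℕ))
    (S : Finset ℕ → L.Substructure N) (M : K.Model) (j : unionOf I S → M) : Prop where
  inj : Function.Injective j
  rel : ∀ {n : ℕ} (R : L.Relations n) (x : Fin n → unionOf I S),
    FirstOrder.Language.Structure.RelMap R (fun i => j (x i)) ↔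
      FirstOrder.Language.Structure.RelMap R (fun i => (x i : N))
  func : ∀ {n : ℕ} (f : L.Functions n) (x : Fin n → unionOf I S) (y : unionOf I S),
    FirstOrder.Language.Structure.funMap f (fun i => j (x i)) = j y ↔
      FirstOrder.Language.Structure.funMap f (fun i => (x i : N)) = (y : N)
  strong : ∀ s (hs : s ∈ I), ∃ e : S s ↪[L] M, K.IsKEmb e ∧
    ∀ x : S s, e x = j ⟨x, s, hs, x.2⟩

/-- The set `unionOf I S ⊆ N` is a `μ`-amalgamation base. -/
def IsAmalgBase (K : AEC L) (μ : Cardinal.{u}) (N : K.Model)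
    (I : Finset (Finset ℕ)) (S : Finset ℕ → L.Substructure N) : Prop :=
  K.LS ≤ μ ∧ K.IsSystem μ N I S ∧
    ∀ (M₁ M₂ : K.Model), #M₁ = μ → #M₂ = μ →
      ∀ (j₁ : unionOf I S → M₁) (j₂ : unionOf I S → M₂),
        K.IsPlacement I S M₁ j₁ → K.IsPlacement I S M₂ j₂ →
        ∃ (M : K.Model) (g₁ : M₁ ↪[L] M) (g₂ : M₂ ↪[L] M), #M = μ ∧
          K.IsKEmb g₁ ∧ K.IsKEmb g₂ ∧ ∀ a, g₁ (j₁ a) = g₂ (j₂ a)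

/-- `A ⊆ N` belongs to `Ab(K)`. -/
def Ab (K : AEC L) (N : K.Model) (A : Set N) : Prop :=
  ∃ (μ : Cardinal.{u}) (I : Finset (Finset ℕ)) (S : Finset ℕ → L.Substructure N),
    K.IsAmalgBase μ N I S ∧ A = unionOf I S

/-- The amalgamation property in `μ`. -/
def AP (K : AEC L) (μ : Cardinal.{u}) : Prop :=
  ∀ (M₀ M₁ M₂ : K.Model), #M₀ = μ → #M₁ = μ → #M₂ = μ →
    ∀ (e₁ : M₀ ↪[L] M₁) (e₂ : M₀ ↪[L] M₂), K.IsKEmb e₁ → K.IsKEmb e₂ →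
      ∃ (N : K.Model) (g₁ : M₁ ↪[L] N) (g₂ : M₂ ↪[L] N), #N = μ ∧
        K.IsKEmb g₁ ∧ K.IsKEmb g₂ ∧ ∀ x, g₁ (e₁ x) = g₂ (e₂ x)

/-- `(a₁, M, N₁) E (a₂, M, N₂)`, where `M` is a strong submodel of `N₁` and `N₂` through `e₁` and
`e₂`: the elements `a₁` and `a₂` have the same Galois type over `M`. -/
def SameGaloisType (K : AEC L) {M : Type u} [L.Structure M] {N₁ N₂ : K.Model}
    (e₁ : M ↪[L] N₁) (e₂ : M ↪[L] N₂) (a₁ : N₁) (a₂ : N₂) : Prop :=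
  ∃ (N : K.Model) (g₁ : N₁ ↪[L] N) (g₂ : N₂ ↪[L] N), K.IsKEmb g₁ ∧ K.IsKEmb g₂ ∧
    (∀ x, g₁ (e₁ x) = g₂ (e₂ x)) ∧ g₁ a₁ = g₂ a₂

/-- `χ`-tameness: the class has the amalgamation property, and Galois types over a model `M` of
cardinality `> χ` are equal as soon as their restrictions to all strong submodels of `M` of
cardinality `≤ χ` are. -/
def Tame (K : AEC L) (χ : Cardinal.{u}) : Prop :=
  (∀ μ, K.LS ≤ μ → K.AP μ) ∧
  ∀ (M N₁ N₂ : K.Model), χ < #M → #N₁ = #M → #N₂ = #M →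
    ∀ (e₁ : M ↪[L] N₁) (e₂ : M ↪[L] N₂), K.IsKEmb e₁ → K.IsKEmb e₂ → ∀ (a₁ : N₁) (a₂ : N₂),
      (∀ S : L.Substructure M, K.Strong S → #S ≤ χ →
        K.SameGaloisType (e₁.comp S.subtype) (e₂.comp S.subtype) a₁ a₂) →
      K.SameGaloisType e₁ e₂ a₁ a₂

end AEC

open AEC

/-- The relation `A ⌣_C^N B` on subsets of `N` that is given by a relation `rel` on triples with
`C ⊆ A ∩ B`; for other triples `A ⌣_C^N B` abbreviates `A ∪ C ⌣_C^N B ∪ C`. -/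
def IndepOf {L : FirstOrder.Language.{u, u}} {K : AEC L}
    (rel : ∀ N : K.Model, Set N → Set N → Set N → Prop)
    (N : K.Model) (A C B : Set N) : Prop :=
  rel N (A ∪ C) C (B ∪ C)

/-- A weak forking notion on the abstract elementary class `K`. `IndepOf rel N A C B` is
`A ⌣_C^N B`; it is meaningful (and the axioms are about it) only over amalgamation bases `C`. -/
structure WeakForking {L : FirstOrder.Language.{u, u}} (K : AEC L) where
  /-- the underlying four-place relation -/
  rel : ∀ N : K.Model, Set N → Set N → Set N → Prop
  /-- the cardinal `κ(K)` -/
  κ : Cardinal.{u}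
  invariance : ∀ {N N' : K.Model} (f : N ↪[L] N'), K.IsKEmb f → ∀ A C B : Set N, K.Ab N C →
    (IndepOf rel N A C B ↔ IndepOf rel N' (f '' A) (f '' C) (f '' B))
  monotonicity : ∀ (N : K.Model) (A C C' B' B : Set N), K.Ab N C → K.Ab N C' →
    C ⊆ C' → C' ⊆ B' → B' ⊆ B → IndepOf rel N A C B → IndepOf rel N A C' B'
  disjointness : ∀ (N : K.Model) (A C B : Set N), K.Ab N C → IndepOf rel N A C B → A ∩ B ⊆ C
  extension : ∀ (M₀ M N₀ : K.Model) (e : M₀ ↪[L] M) (e' : M₀ ↪[L] N₀),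
    K.IsKEmb e → K.IsKEmb e' →
    ∃ (N : K.Model) (g : M ↪[L] N) (f : N₀ ↪[L] N), K.IsKEmb g ∧ K.IsKEmb f ∧
      (∀ x, f (e' x) = g (e x)) ∧
      IndepOf rel N (Set.range g) (Set.range fun x => g (e x)) (Set.range f)
  continuity : ∀ (N : K.Model) (A C : Set N) (δ : Ordinal.{u}) (B : Ordinal.{u} → Set N),
    K.Ab N C → Order.IsSuccLimit δ →
    (∀ i j, i ≤ j → j < δ → B i ⊆ B j) →
    (∀ i, i < δ → Order.IsSuccLimit i → B i = ⋃ j ∈ Set.Iio i, B j) →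
    (∀ i, i < δ → IndepOf rel N A C (B i)) → IndepOf rel N A C (⋃ i ∈ Set.Iio δ, B i)
  symmetry : ∀ (N : K.Model) (A C B : Set N), K.Ab N C →
    IndepOf rel N A C B → IndepOf rel N B C A
  transitivity : ∀ (N : K.Model) (A C B D : Set N), K.Ab N C → K.Ab N B → C ⊆ B → B ⊆ D →
    IndepOf rel N A C B → IndepOf rel N A B D → IndepOf rel N A C D
  local_character : ∀ (N : K.Model) (A B A' : Set N), K.Ab N A → K.Ab N B → K.Ab N A' →
    A' ⊆ A ∪ B → ∃ B' : Set N, B' ⊆ B ∧ K.Ab N B' ∧ #B' ≤ κ + #A' ∧ IndepOf rel N A' B' B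
  /-- there are at most `κ` finitary functions on `N` such that independence holds for the sets
  that are closed under them -/
  definability : ∀ (N : K.Model) (A B : Set N),
    ∃ (ι : Type u) (ar : ι → ℕ) (F : ∀ i, (Fin (ar i) → N) → N), #ι ≤ κ ∧
      ∀ A' : Set N, A' ⊆ A ∪ B → (∀ i x, (∀ k, x k ∈ A') → F i x ∈ A') →
        K.Ab N A' → K.Ab N (B ∩ A') → IndepOf rel N A' (B ∩ A') B

namespace WeakForking

variable {L : FirstOrder.Language.{u, u}} {K : AEC L}

/-- `A ⌣_C^N B`. -/
def Indep (W : WeakForking K) (N : K.Model) (A C B : Set N) : Prop :=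
  IndepOf W.rel N A C B

/-- A `𝒫(s)`-system of models of cardinality `μ` whose last model is `N`. -/
def IsCube (K : AEC L) (μ : Cardinal.{u}) (s : Finset ℕ) (N : K.Model)
    (S : Finset ℕ → L.Substructure N) : Prop :=
  K.IsSystem μ N s.powerset S ∧ S s = ⊤

/-- The `𝒫(s)`-system `S` is stable inside its last model `N`. -/
structure IsStable (W : WeakForking K) (μ : Cardinal.{u}) (s : Finset ℕ) (N : K.Model)
    (S : Finset ℕ → L.Substructure N) : Prop where
  cube : IsCube K μ s N S
  base : ∀ t, t ⊂ s → t.Nonempty → K.IsAmalgBase μ N t.ssubsets S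
  indep : ∀ t, t ⊂ s → t.Nonempty →
    W.Indep N (S t) (bdry S t) {x | ∃ w, w ⊂ s ∧ ¬ t ⊆ w ∧ x ∈ S w}

/-- The `(μ, n)`-symmetry property. -/
def HasSymmetry (W : WeakForking K) (μ : Cardinal.{u}) (n : ℕ) : Prop :=
  ∀ (N : K.Model) (S : Finset ℕ → L.Substructure N), IsCube K μ (Finset.range n) N S →
    (∃ e : Fin (2 ^ n - 1) → Finset ℕ, Function.Injective e ∧
      Set.range e = {t | t ⊂ Finset.range n} ∧ (∀ i j, e i ⊂ e j → i < j) ∧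
      ∀ j, (e j).Nonempty →
        K.IsAmalgBase μ N (e j).ssubsets S ∧
        W.Indep N (S (e j)) (bdry S (e j)) {x | ∃ i, i < j ∧ x ∈ S (e i)}) →
    W.IsStable μ (Finset.range n) N S

/-- A `(μ, 𝒫⁻(n))`-system, not inside a given model: models `M s` for the proper subsets `s` of
`{0, …, n-1}` with coherent `K`-embeddings in the place of the inclusions. -/
structure OpenSystem (K : AEC L) (μ : Cardinal.{u}) (n : ℕ) where
  /-- the models -/
  M : {s : Finset ℕ // s ⊂ Finset.range n} → K.Model
  /-- the inclusions -/
  e : ∀ {s t}, s ≤ t → (M s ↪[L] M t)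
  isKEmb : ∀ {s t} (h : s ≤ t), K.IsKEmb (e h)
  refl : ∀ s (x : M s), e (le_refl s) x = x
  comp : ∀ {r s t} (h : r ≤ s) (h' : s ≤ t) (x : M r), e h' (e h x) = e (h.trans h') x
  inter : ∀ {q r s t} (hq : q ≤ t) (hr : r ≤ t) (hs : s ≤ t),
    q.1 = r.1 ∩ s.1 → Set.range (e hq) = Set.range (e hr) ∩ Set.range (e hs)
  card : ∀ s, #(M s) = μ

open Classical in
/-- The part `{M t | t ⊆ s}` of an open system, as a `𝒫(s)`-system inside `M s`. -/
noncomputable def OpenSystem.face {μ : Cardinal.{u}} {n : ℕ} (R : OpenSystem K μ n)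
    (s : {s : Finset ℕ // s ⊂ Finset.range n}) (t : Finset ℕ) : L.Substructure (R.M s) :=
  if h : t ⊆ s.1 then
    (R.e (s := ⟨t, lt_of_le_of_lt h s.2⟩) (t := s) h).toHom.range
  else ⊤

/-- The `(μ, n)`-existence property. -/
def HasExistence (W : WeakForking K) (μ : Cardinal.{u}) (n : ℕ) : Prop :=
  ∀ R : OpenSystem K μ n, (∀ s, W.IsStable μ s.1 (R.M s) (R.face s)) →
    ∃ (N : K.Model) (S : Finset ℕ → L.Substructure N) (f : ∀ s, R.M s ↪[L] N),
      W.IsStable μ (Finset.range n) N S ∧ (∀ s, K.IsKEmb (f s)) ∧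
      (∀ s, (f s).toHom.range = S s.1) ∧
      ∀ {s t} (h : s ≤ t) (x : R.M s), f t (R.e h x) = f s x

/-- The weak `(μ, n)`-uniqueness property. -/
def HasWeakUniqueness (W : WeakForking K) (μ : Cardinal.{u}) (n : ℕ) : Prop :=
  ∀ (N N' : K.Model) (S : Finset ℕ → L.Substructure N) (S' : Finset ℕ → L.Substructure N'),
    W.IsStable μ (Finset.range n) N S → W.IsStable μ (Finset.range n) N' S' →
    ∀ f : ∀ s, s ⊂ Finset.range n → (S s ≃[L] S' s),
      (∀ s t (hs : s ⊂ Finset.range n) (ht : t ⊂ Finset.range n), s ⊆ t →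
        ∀ (x : S s) (y : S t), (x : N) = y → (f s hs x : N') = f t ht y) →
      ∃ (M : K.Model) (g : N ↪[L] M) (g' : N' ↪[L] M), #M = μ ∧ K.IsKEmb g ∧ K.IsKEmb g' ∧
        ∀ s (hs : s ⊂ Finset.range n) (x : S s), g x = g' (f s hs x)

/-- The `(μ, n)`-goodness property. -/
def IsGood (W : WeakForking K) (μ : Cardinal.{u}) (n : ℕ) : Prop :=
  W.HasSymmetry μ n ∧ W.HasExistence μ n ∧ W.HasWeakUniqueness μ n

/-- Excellence: goodness in `LS(K)` in all dimensions `n ≥ 1`. -/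
def Excellent (W : WeakForking K) : Prop :=
  ∀ n, 1 ≤ n → W.IsGood K.LS n

end WeakForking

/-! The proof is an induction on `λ`: if goodness holds in all dimensions in every cardinal of the
interval `[LS(K), λ)`, then it holds in all dimensions in `λ`. Dimension `n` in `λ` is reduced to
dimensions `n` and `n + 1` in smaller cardinals, by resolving models of size `λ` into continuous
chains of smaller ones.

Definability supplies the chains. Let `S` be a `𝒫(n)`-system with last model `N`. Call `X ⊆ N`
adapted if it meets each `M_t` in a strong submodel of full size `|X|`, and `X ∩ M_t` is independent
from `A_t` over `X ∩ A_t`. The adapted sets contain a club (`exists_setClub_adapted`), so `N` is the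
union of a continuous chain of adapted sets `X_i` of size less than `λ`, with `|X_{i+1}| = |X_i|`
(`SetClub.exists_filtration`). By transitivity the traces of `S` on one `X_i` are independent along
an enumeration of the faces, so symmetry in `|X_i|` makes them a stable system
(`Adapted.stableIn_res`). In the same way the traces on `X_i` and `X_{i+1}` together form a stable
`𝒫(n + 1)`-system (`stableIn_doubleRes`). Conversely, the union of a suitable chain of stable
systems is stable, by transitivity, symmetry and continuity (`stableIn_of_chain`). Symmetry in `λ`
follows at once.

For weak uniqueness, two systems with isomorphic boundaries are resolved simultaneously, and an
amalgam of their parts in `X_i` is extended to one of the parts in `X_{i+1}`. Existence in dimension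
`n + 1` completes the amalgam and the new boundary to a stable cube, and weak uniqueness in
dimension `n + 1` maps each of the two systems into an extension of that cube
(`GoodAt.exists_amalgam_succ`). For existence, stable realizations of the small parts of the given
system are extended step by step. Existence in dimension `n + 1` is applied with the old realization
at one face, and the faces through the new vertex give the new realization
(`StableCocone.exists_succ`). Both constructions are instances of `exists_stage`.

Independence is only meaningful over amalgamation bases, so it must be known throughout that
boundaries of stable systems are bases. Where goodness is known, this follows from existence one
dimension higher (`HasExistence.isAmalgBase_range`). In `λ` it follows from weak uniqueness in `λ`,
because stability of a system does not depend on the model around its boundary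
(`GoodBelow.isStable_of_placement`, `GoodBelow.isAmalgBase`).

The amalgamation property is weak uniqueness in dimension `1`. Tameness is the same step-by-step
amalgamation in dimension `1`, started from an amalgam of size `LS(K)` in which the two elements are
already identified; equality of the Galois types over a small submodel provides it
(`GoodBelow.sameGaloisType`). -/

/-! ### Cofinal sequences of regular length. -/

theorem exists_regular_cofinal (α : Type u) [LinearOrder α] [Nonempty α] [NoMaxOrder α] :
    ∃ μ : Cardinal.{u}, μ.IsRegular ∧
      ∃ f : Set.Iio μ.ord → α, StrictMono f ∧ ∀ a, ∃ i, a ≤ f i := by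
  obtain ⟨r, hr, hr'⟩ := exists_ord_eq α
  have hc := isCofinal_setOfPred_imp_lt r
  -- The elements that exceed all their predecessors in the well-order `r` form a cofinal set, on
  -- which `<` is contained in `r` and hence well-founded. A cofinal subset of least order type is
  -- then indexed by a regular cardinal.
  set s := {a : α | ∀ b, r b a → b < a} with hs
  have hwf : WellFoundedLT s := by
    refine ⟨Subrelation.wf (r := InvImage r Subtype.val) ?_ (InvImage.wf _ hr.wf)⟩
    intro x y hxy
    rcases trichotomous_of r x.1 y.1 with h | h | h
    · exact h
    · exact absurd (Subtype.ext h) hxy.ne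
    · exact absurd (x.2 _ h) (not_lt.2 hxy.le)
  obtain ⟨t, ht, hto⟩ := Ordinal.exists_ord_cof_eq s
  have hns : Nonempty s := (hc (Classical.arbitrary α)).elim fun x hx => ⟨⟨x, hx.1⟩⟩
  have hnm : NoMaxOrder s := ⟨fun a => by
    obtain ⟨b, hb⟩ := exists_gt a.1
    obtain ⟨c, hc', hbc⟩ := hc b
    exact ⟨⟨c, hc'⟩, show a.1 < c from lt_of_lt_of_le hb hbc⟩⟩
  refine ⟨Order.cof s, ⟨Order.aleph0_le_cof, by rw [Order.cof_ord_cof]⟩, ?_⟩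
  rw [← hto]
  let e := (Ordinal.ToType.mk (o := Ordinal.type (α := t) (· < ·)))
  have : Ordinal.type (α := (Ordinal.type (α := t) (· < ·)).ToType) (· < ·) =
      Ordinal.type (α := t) (· < ·) := by simp
  obtain ⟨g⟩ := Ordinal.type_eq.1 this
  refine ⟨fun i => (g (e i)).1.1, ?_, ?_⟩
  · intro i j hij
    exact g.map_rel_iff.2 (e.strictMono hij)
  · intro a
    obtain ⟨b, hb, hab⟩ := hc a
    obtain ⟨c, hc, hbc⟩ := ht ⟨b, hb⟩
    refine ⟨e.symm (g.symm ⟨c, hc⟩), ?_⟩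
    simp only [OrderIso.apply_symm_apply, RelIso.apply_symm_apply]
    exact hab.trans hbc

/-- A nonempty chain of a partial order without a greatest element has a strictly increasing
cofinal sequence whose length is a regular cardinal. -/
theorem IsChain.exists_regular_cofinal {α : Type u} [PartialOrder α] {c : Set α}
    (hc : IsChain (· ≤ ·) c) (hne : c.Nonempty) (hmax : ¬ ∃ m ∈ c, ∀ a ∈ c, a ≤ m) :
    ∃ μ : Cardinal.{u}, μ.IsRegular ∧ ∃ f : Set.Iio μ.ord → α, StrictMono f ∧ (∀ i, f i ∈ c) ∧
      ∀ a ∈ c, ∃ i, a ≤ f i := by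
  classical
  let _ : LinearOrder c :=
    { (inferInstance : PartialOrder c) with
      le_total := fun a b => hc.total a.2 b.2
      toDecidableLE := Classical.decRel _ }
  have : Nonempty c := hne.to_subtype
  have : NoMaxOrder c := ⟨fun a => by
    by_contra! h
    exact hmax ⟨a, a.2, fun b hb => h ⟨b, hb⟩⟩⟩
  obtain ⟨μ, hμ, f, hf, hcof⟩ := _root_.exists_regular_cofinal c
  exact ⟨μ, hμ, fun i => (f i).1, fun i j h => hf h, fun i => (f i).2,
    fun a ha => hcof ⟨a, ha⟩⟩

/-! ### `K`-embeddings, strong submodels and unions of chains. -/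

namespace AEC

variable {L : FirstOrder.Language.{u, u}} {K : AEC L}

open FirstOrder.Language

section Basic

variable {M N P : Type u} [L.Structure M] [L.Structure N] [L.Structure P]

theorem isKEmb_subtype {S : L.Substructure N} (hS : K.Strong S) : K.IsKEmb S.subtype :=
  ⟨(K.mem_of_strong _ hS).1, by rwa [Substructure.range_subtype]⟩

theorem isKEmb_equiv (f : M ≃[L] N) (hM : K.Mem M) : K.IsKEmb f.toEmbedding := by
  refine ⟨hM, ?_⟩
  rw [Equiv.toEmbedding_toHom, Equiv.toHom_range]
  exact K.strong_top (K.mem_iso f hM)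

theorem isKEmb_refl (hM : K.Mem M) : K.IsKEmb (Embedding.refl L M) :=
  isKEmb_equiv (FirstOrder.Language.Equiv.refl L M) hM

/-- Identifies `M` with the range of `f`. In this form closure of `≺` under isomorphism applies to
`K`-embeddings, both for images and for preimages. -/
theorem comap_subtype_map {f : M ↪[L] N} (S : L.Substructure M) :
    (S.map f.toHom).comap (f.toHom.range).subtype.toHom = S.map f.equivRange.toHom := by
  ext ⟨x, hx⟩
  simp only [Substructure.mem_comap, Substructure.mem_map]
  constructor
  · rintro ⟨y, hy, h⟩
    exact ⟨y, hy, Subtype.ext h⟩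
  · rintro ⟨y, hy, h⟩
    exact ⟨y, hy, congrArg Subtype.val h⟩

/-- The image of a strong submodel under a `K`-embedding is a strong submodel. -/
theorem IsKEmb.strong_map {f : M ↪[L] N} (hf : K.IsKEmb f) {S : L.Substructure M}
    (hS : K.Strong S) : K.Strong (S.map f.toHom) := by
  refine K.strong_trans _ f.toHom.range Hom.map_le_range ?_ hf.2
  rw [comap_subtype_map]
  exact K.strong_iso _ _ hS

theorem IsKEmb.strong_of_map {f : M ↪[L] N} (hf : K.IsKEmb f) {S : L.Substructure M}
    (hS : K.Strong (S.map f.toHom)) : K.Strong S := by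
  have h := K.coherence _ _ Hom.map_le_range hS hf.2
  rw [comap_subtype_map] at h
  have h2 := K.strong_iso f.equivRange.symm _ h
  rwa [Substructure.map_map, ← Equiv.comp_toHom, FirstOrder.Language.Equiv.symm_comp_self, Equiv.refl_toHom,
    Substructure.map_id] at h2

theorem IsKEmb.strong_map_iff {f : M ↪[L] N} (hf : K.IsKEmb f) {S : L.Substructure M} :
    K.Strong (S.map f.toHom) ↔ K.Strong S := ⟨hf.strong_of_map, hf.strong_map⟩

theorem IsKEmb.comp {g : N ↪[L] P} {f : M ↪[L] N} (hg : K.IsKEmb g) (hf : K.IsKEmb f) :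
    K.IsKEmb (g.comp f) := by
  refine ⟨hf.1, ?_⟩
  rw [Embedding.comp_toHom, Hom.range_comp]
  exact hg.strong_map hf.2

/-- Coherence, in the language of embeddings. -/
theorem IsKEmb.of_comp {g : N ↪[L] P} {f : M ↪[L] N} (hg : K.IsKEmb g)
    (h : K.IsKEmb (g.comp f)) : K.IsKEmb f := by
  refine ⟨h.1, hg.strong_of_map ?_⟩
  rw [← Hom.range_comp, ← Embedding.comp_toHom]
  exact h.2

theorem isKEmb_inclusion {S T : L.Substructure N} (h : S ≤ T) (hS : K.Strong S)
    (hT : K.Strong T) : K.IsKEmb (Substructure.inclusion h) := by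
  refine (isKEmb_subtype hT).of_comp ?_
  rw [Substructure.subtype_comp_inclusion]
  exact isKEmb_subtype hS

theorem IsKEmb.domRestrict {f : M ↪[L] N} (hf : K.IsKEmb f) {S : L.Substructure M}
    (hS : K.Strong S) : K.IsKEmb (f.comp S.subtype) := hf.comp (isKEmb_subtype hS)

theorem IsKEmb.codRestrict {f : M ↪[L] N} (hf : K.IsKEmb f) {T : L.Substructure N}
    (hT : K.Strong T) (h : ∀ x, f x ∈ T) : K.IsKEmb (f.codRestrict T h) := by
  refine (isKEmb_subtype hT).of_comp ?_
  rwa [Embedding.subtype_comp_codRestrict]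

theorem map_subtype_comap {S T : L.Substructure N} (h : S ≤ T) :
    (S.comap T.subtype.toHom).map T.subtype.toHom = S := by
  ext x
  simp only [Substructure.mem_map, Substructure.mem_comap]
  constructor
  · rintro ⟨y, hy, rfl⟩
    exact hy
  · intro hx
    exact ⟨⟨x, h hx⟩, hx, rfl⟩

end Basic

section Lowenheim

theorem LS_spec (K : AEC L) : ℵ₀ + L.card ≤ K.LS ∧
    ∀ (M : Type u) [L.Structure M], K.Mem M → ∀ A : Set M,
      ∃ S : L.Substructure M, K.Strong S ∧ A ⊆ S ∧ #S ≤ #A + K.LS :=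
  csInf_mem (s := {κ : Cardinal.{u} | ℵ₀ + L.card ≤ κ ∧
    ∀ (M : Type u) [L.Structure M], K.Mem M → ∀ A : Set M,
      ∃ S : L.Substructure M, K.Strong S ∧ A ⊆ S ∧ #S ≤ #A + κ}) K.exists_LS

theorem aleph0_le_LS (K : AEC L) : ℵ₀ ≤ K.LS := le_self_add.trans K.LS_spec.1

theorem exists_strong {N : Type u} [L.Structure N] (hN : K.Mem N) (A : Set N) :
    ∃ S : L.Substructure N, K.Strong S ∧ A ⊆ S ∧ #S ≤ #A + K.LS := K.LS_spec.2 N hN A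

end Lowenheim

section Chains

/-- Closure under unions of chains of strong submodels of a model. -/
theorem strong_of_chain_below {N : Type u} [L.Structure N] (hN : K.Mem N)
    {c : Set (L.Substructure N)} (hc : IsChain (· ≤ ·) c) (hne : c.Nonempty)
    (hs : ∀ S ∈ c, K.Strong S) {T : L.Substructure N} (hT : (T : Set N) = ⋃ S ∈ c, (S : Set N)) :
    K.Strong T := by
  -- The axioms speak of chains indexed by regular cardinals. A chain with a greatest member has
  -- that member as its union; any other chain has a cofinal sequence of regular length.
  by_cases hmax : ∃ m ∈ c, ∀ a ∈ c, a ≤ m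
  · obtain ⟨m, hm, hm'⟩ := hmax
    have : T = m := by
      apply SetLike.coe_injective
      rw [hT]
      refine subset_antisymm (Set.iUnion₂_subset fun S hS => hm' S hS) ?_
      exact Set.subset_biUnion_of_mem (u := fun S : L.Substructure N => (S : Set N)) hm
    exact this ▸ hs m hm
  · obtain ⟨μ, hμ, f, hf, hfc, hcof⟩ := hc.exists_regular_cofinal hne hmax
    refine K.chain_below μ hμ hN f hf.monotone (fun i => hs _ (hfc i)) T ?_
    rw [hT]
    refine subset_antisymm (Set.iUnion₂_subset fun S hS => ?_)
      (Set.iUnion_subset fun i => Set.subset_biUnion_of_mem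
        (u := fun S : L.Substructure N => (S : Set N)) (hfc i))
    obtain ⟨i, hi⟩ := hcof S hS
    exact Set.Subset.trans hi (Set.subset_iUnion (fun i => (f i : Set N)) i)

/-- Closure under unions of chains. -/
theorem mem_of_chain_union {U : Type u} [L.Structure U]
    {c : Set (L.Substructure U)} (hc : IsChain (· ≤ ·) c) (hne : c.Nonempty)
    (hmem : ∀ S ∈ c, K.Mem S)
    (hs : ∀ S ∈ c, ∀ T ∈ c, S ≤ T → K.Strong (S.comap T.subtype.toHom))
    (hU : ⋃ S ∈ c, (S : Set U) = Set.univ) :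
    K.Mem U ∧ ∀ S ∈ c, K.Strong S := by
  by_cases hmax : ∃ m ∈ c, ∀ a ∈ c, a ≤ m
  · obtain ⟨m, hm, hm'⟩ := hmax
    have htop : m = ⊤ := by
      apply SetLike.coe_injective
      rw [Substructure.coe_top, ← hU]
      refine subset_antisymm ?_ (Set.iUnion₂_subset fun S hS => hm' S hS)
      exact Set.subset_biUnion_of_mem (u := fun S : L.Substructure U => (S : Set U)) hm
    subst htop
    have hmU : K.Mem U := K.mem_iso Substructure.topEquiv (hmem _ hm)
    refine ⟨hmU, fun S hS => ?_⟩
    exact K.strong_trans S ⊤ le_top (hs S hS ⊤ hm le_top) (K.strong_top hmU)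
  · obtain ⟨μ, hμ, f, hf, hfc, hcof⟩ := hc.exists_regular_cofinal hne hmax
    have key := K.chain_union μ hμ f hf.monotone
      (fun i j hij => hs _ (hfc i) _ (hfc j) (hf hij).le) ?_
    · refine ⟨key.1, fun S hS => ?_⟩
      obtain ⟨i, hi⟩ := hcof S hS
      exact K.strong_trans S _ hi (hs S hS _ (hfc i) hi) (key.2 i)
    · refine Set.eq_univ_of_univ_subset ?_
      rw [← hU]
      refine Set.iUnion₂_subset fun S hS => ?_
      obtain ⟨i, hi⟩ := hcof S hS
      exact Set.Subset.trans hi (Set.subset_iUnion (fun i => (f i : Set U)) i)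

end Chains

end AEC

/-! ### Rules for independence. -/

namespace WeakForking

open FirstOrder.Language

variable {L : FirstOrder.Language.{u, u}} {K : AEC L} {W : WeakForking K} {N : K.Model}

theorem indep_congr {A A' C B B' : Set N} (hA : A ∪ C = A' ∪ C) (hB : B ∪ C = B' ∪ C) :
    W.Indep N A C B ↔ W.Indep N A' C B' := by
  unfold Indep IndepOf
  rw [hA, hB]

namespace Indep

variable {A A' C C' B B' D : Set N}

theorem symm (hC : K.Ab N C) (h : W.Indep N A C B) : W.Indep N B C A := W.symmetry N A C B hC h

/-- The axiom asks the smaller set to contain the base. Uniting both right-hand sides with `C` does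
not change the relation and removes this condition. -/
theorem mono_right (hC : K.Ab N C) (h : W.Indep N A C B) (hB : B' ⊆ B ∪ C) :
    W.Indep N A C B' := by
  have h1 : W.Indep N A C (B ∪ C) := (indep_congr rfl (by simp [Set.union_assoc])).1 h
  have h2 : W.Indep N A C (B' ∪ C) := W.monotonicity N A C C (B' ∪ C) (B ∪ C) hC hC
    subset_rfl Set.subset_union_right (Set.union_subset hB Set.subset_union_right) h1
  exact (indep_congr rfl (by simp [Set.union_assoc])).1 h2

theorem mono_left (hC : K.Ab N C) (h : W.Indep N A C B) (hA : A' ⊆ A ∪ C) :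
    W.Indep N A' C B := ((h.symm hC).mono_right hC hA).symm hC

theorem mono (hC : K.Ab N C) (h : W.Indep N A C B) (hA : A' ⊆ A ∪ C) (hB : B' ⊆ B ∪ C) :
    W.Indep N A' C B' := (h.mono_right hC hB).mono_left hC hA

theorem base_mono (hC : K.Ab N C) (hC' : K.Ab N C') (h : W.Indep N A C B) (h1 : C ⊆ C')
    (h2 : C' ⊆ B ∪ C) : W.Indep N A C' B := by
  have h3 : W.Indep N A C (B ∪ C) := (indep_congr rfl (by simp [Set.union_assoc])).1 h
  have h4 : W.Indep N A C' (B ∪ C) :=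
    W.monotonicity N A C C' (B ∪ C) (B ∪ C) hC hC' h1 h2 subset_rfl h3
  exact h4.mono_right hC' (Set.subset_union_left.trans Set.subset_union_left)

theorem trans (hC : K.Ab N C) (hB : K.Ab N B) (hCB : C ⊆ B) (h : W.Indep N A C B)
    (h' : W.Indep N A B D) : W.Indep N A C D := by
  have h1 : W.Indep N A B (D ∪ B) := (indep_congr rfl (by simp [Set.union_assoc])).1 h'
  have h2 : W.Indep N A C (D ∪ B) :=
    W.transitivity N A C B (D ∪ B) hC hB hCB Set.subset_union_right h h1
  exact h2.mono_right hC (Set.subset_union_left.trans Set.subset_union_left)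

/-- Continuity for unions of arbitrary nonempty chains. -/
theorem sUnion_right (hC : K.Ab N C) {c : Set (Set N)} (hc : IsChain (· ≤ ·) c)
    (hne : c.Nonempty) (h : ∀ B ∈ c, W.Indep N A C B) : W.Indep N A C (⋃₀ c) := by
  by_cases hmax : ∃ m ∈ c, ∀ a ∈ c, a ≤ m
  · obtain ⟨m, hm, hm'⟩ := hmax
    have : ⋃₀ c = m := subset_antisymm (Set.sUnion_subset hm') (Set.subset_sUnion_of_mem hm)
    exact this ▸ h m hm
  · obtain ⟨μ, hμ, f, hf, hfc, hcof⟩ := hc.exists_regular_cofinal hne hmax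
    have hlim : Order.IsSuccLimit μ.ord := Cardinal.isSuccLimit_ord hμ.aleph0_le
    -- The union of the earlier `f j` is continuous at limits, as the axiom demands, although `f`
    -- need not be.
    let B : Ordinal.{u} → Set N := fun i => ⋃ j : Set.Iio μ.ord, ⋃ _ : j.1 < i, f j
    have key : W.Indep N A C (⋃ i ∈ Set.Iio μ.ord, B i) := by
      refine W.continuity N A C μ.ord B hC hlim ?_ ?_ ?_
      · intro i j hij _ x hx
        simp only [B, Set.mem_iUnion] at hx ⊢
        obtain ⟨k, hk, hx⟩ := hx
        exact ⟨k, hk.trans_le hij, hx⟩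
      · intro i hi hil
        ext x
        simp only [B, Set.mem_iUnion, Set.mem_Iio]
        constructor
        · rintro ⟨k, hk, hx⟩
          exact ⟨Order.succ k.1, hil.succ_lt hk, k, Order.lt_succ _, hx⟩
        · rintro ⟨j, hj, k, hk, hx⟩
          exact ⟨k, hk.trans hj, hx⟩
      · intro i hi
        refine Indep.mono_right hC (h _ (hfc ⟨i, hi⟩)) ?_
        refine (Set.iUnion₂_subset fun j hj => ?_).trans Set.subset_union_left
        exact hf.monotone (show j ≤ ⟨i, hi⟩ from le_of_lt hj)
    refine key.mono_right hC ((Set.sUnion_subset fun a ha => ?_).trans Set.subset_union_left)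
    obtain ⟨i, hi⟩ := hcof a ha
    intro x hx
    simp only [B, Set.mem_iUnion, Set.mem_Iio]
    exact ⟨Order.succ i.1, hlim.succ_lt i.2, i, Order.lt_succ _, hi hx⟩

theorem iUnion_right (hC : K.Ab N C) {ι : Type*} [LinearOrder ι] [Nonempty ι] {B : ι → Set N}
    (hB : Monotone B) (h : ∀ i, W.Indep N A C (B i)) : W.Indep N A C (⋃ i, B i) := by
  rw [← Set.sUnion_range]
  refine sUnion_right hC ?_ (Set.range_nonempty B) (by rintro _ ⟨i, rfl⟩; exact h i)
  exact hB.isChain_range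

theorem iUnion_left (hC : K.Ab N C) {ι : Type*} [LinearOrder ι] [Nonempty ι] {A : ι → Set N}
    (hA : Monotone A) (h : ∀ i, W.Indep N (A i) C B) : W.Indep N (⋃ i, A i) C B :=
  (iUnion_right hC hA fun i => (h i).symm hC).symm hC

end Indep

theorem indep_map_iff {N' : K.Model} {f : N ↪[L] N'} (hf : K.IsKEmb f) {A C B : Set N}
    (hC : K.Ab N C) : W.Indep N' (f '' A) (f '' C) (f '' B) ↔ W.Indep N A C B :=
  (W.invariance f hf A C B hC).symm

/-- Extension with `N₀ = M₀`: the new copy of `M₀` is fixed over `M₀`, so it is `M₀` itself.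
Invariance then brings the independence back into `N`. -/
theorem indep_univ_self {M₀ : K.Model} {e : M₀ ↪[L] N} (he : K.IsKEmb e)
    (hC : K.Ab N (Set.range e)) : W.Indep N Set.univ (Set.range e) (Set.range e) := by
  obtain ⟨P, g, f, hg, hf, hfg, h⟩ :=
    W.extension M₀ N M₀ e (Embedding.refl L M₀) he (isKEmb_refl M₀.mem)
  rw [← indep_map_iff hg hC, Set.image_univ]
  have h1 : g '' Set.range e = Set.range fun x => g (e x) := by
    rw [← Set.range_comp]; rfl
  have h2 : Set.range f = Set.range fun x => g (e x) := by
    congr 1; ext x; exact hfg x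
  rw [h1]
  rw [h2] at h
  exact h

end WeakForking

/-! ### Systems and amalgamation bases under `K`-embeddings. -/

namespace AEC

open FirstOrder.Language

variable {L : FirstOrder.Language.{u, u}} {K : AEC L}

/-- A strong submodel as a model. -/
abbrev Model.sub (N : K.Model) (S : L.Substructure N) (hS : K.Strong S) : K.Model :=
  ⟨S, (K.mem_of_strong S hS).1⟩

variable {N N' : K.Model} {I : Finset (Finset ℕ)} {S : Finset ℕ → L.Substructure N}
  {S' : Finset ℕ → L.Substructure N'} {μ : Cardinal.{u}}

theorem mk_map {M N : Type u} [L.Structure M] [L.Structure N] (f : M ↪[L] N)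
    (T : L.Substructure M) : #(T.map f.toHom) = #T :=
  (Cardinal.mk_congr (f.substructureEquivMap T).toEquiv).symm

theorem map_inf {M N : Type u} [L.Structure M] [L.Structure N] (f : M ↪[L] N)
    (T T' : L.Substructure M) : (T ⊓ T').map f.toHom = T.map f.toHom ⊓ T'.map f.toHom := by
  apply SetLike.coe_injective
  exact Set.image_inter f.injective

theorem mem_unionOf {x : N} : x ∈ unionOf I S ↔ ∃ s ∈ I, x ∈ S s := Iff.rfl

theorem mem_bdry {t : Finset ℕ} {x : N} : x ∈ bdry S t ↔ ∃ s, s ⊂ t ∧ x ∈ S s := by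
  simp [bdry, mem_unionOf]

theorem isSystem_map_iff {f : N ↪[L] N'} (hf : K.IsKEmb f)
    (h : ∀ w ∈ I, S' w = (S w).map f.toHom) : K.IsSystem μ N' I S' ↔ K.IsSystem μ N I S := by
  have hinj : Function.Injective f.toHom := f.injective
  constructor
  · intro H
    refine ⟨H.nonempty, H.down, fun s hs => ?_, fun s hs t ht hst => ?_, fun s hs t ht => ?_,
      fun s hs => ?_⟩
    · rw [← hf.strong_map_iff, ← h s hs]; exact H.strong s hs
    · rw [← Substructure.map_le_map_iff_of_injective hinj, ← h s hs, ← h t ht]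
      exact H.mono s hs t ht hst
    · apply Substructure.map_injective_of_injective hinj
      rw [map_inf, ← h s hs, ← h t ht,
        ← h _ (H.down s hs _ Finset.inter_subset_left)]
      exact H.inter s hs t ht
    · rw [← mk_map f, ← h s hs]; exact H.card s hs
  · intro H
    refine ⟨H.nonempty, H.down, fun s hs => ?_, fun s hs t ht hst => ?_, fun s hs t ht => ?_,
      fun s hs => ?_⟩
    · rw [h s hs, hf.strong_map_iff]; exact H.strong s hs
    · rw [h s hs, h t ht]
      exact Substructure.monotone_map (H.mono s hs t ht hst)
    · rw [h s hs, h t ht, h _ (H.down s hs _ Finset.inter_subset_left), ← map_inf,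
        H.inter s hs t ht]
    · rw [h s hs, mk_map]; exact H.card s hs

theorem unionOf_map {f : N ↪[L] N'} (h : ∀ w ∈ I, S' w = (S w).map f.toHom) :
    unionOf I S' = f '' unionOf I S := by
  ext x
  simp only [mem_unionOf, Set.mem_image]
  constructor
  · rintro ⟨s, hs, hx⟩
    rw [h s hs] at hx
    obtain ⟨y, hy, rfl⟩ := hx
    exact ⟨y, ⟨s, hs, hy⟩, rfl⟩
  · rintro ⟨y, ⟨s, hs, hy⟩, rfl⟩
    exact ⟨s, hs, by rw [h s hs]; exact ⟨y, hy, rfl⟩⟩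

/-- Placements see the union of a system only through its induced structure and its models, and `f`
preserves both. They may therefore be composed with the bijection `φ` of the two unions. -/
theorem isPlacement_map_iff {f : N ↪[L] N'}
    (h : ∀ w ∈ I, S' w = (S w).map f.toHom) (φ : unionOf I S ≃ unionOf I S')
    (hφ : ∀ x, (φ x : N') = f x) {M : K.Model} (j : unionOf I S' → M) (hS : ∀ s ∈ I, K.Strong (S s)) :
    K.IsPlacement I S M (fun x => j (φ x)) ↔ K.IsPlacement I S' M j := by
  have hE : ∀ s ∈ I, ∃ E : S s ≃[L] S' s, ∀ x, (E x : N') = f x := by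
    intro s hs
    rw [h s hs]
    exact ⟨f.substructureEquivMap (S s), fun _ => rfl⟩
  have hrel : ∀ {n : ℕ} (R : L.Relations n) (x : Fin n → unionOf I S),
      Structure.RelMap R (fun i => (φ (x i) : N')) ↔ Structure.RelMap R (fun i => (x i : N)) := by
    intro n R x
    rw [← f.map_rel R (fun i => (x i : N))]
    simp only [hφ]
    rfl
  have hfun : ∀ {n : ℕ} (F : L.Functions n) (x : Fin n → unionOf I S) (y : unionOf I S),
      Structure.funMap F (fun i => (φ (x i) : N')) = φ y ↔
        Structure.funMap F (fun i => (x i : N)) = y := by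
    intro n F x y
    rw [← f.injective.eq_iff, f.map_fun F (fun i => (x i : N)), hφ]
    simp only [hφ]
    rfl
  constructor
  · intro H
    refine ⟨?_, ?_, ?_, ?_⟩
    · intro x y hxy
      have := @H.inj (φ.symm x) (φ.symm y) (by simpa using hxy)
      simpa using this
    · intro n R x
      have h1 := H.rel R (fun i => φ.symm (x i))
      have h2 := hrel R (fun i => φ.symm (x i))
      simp only [Equiv.apply_symm_apply] at h1 h2
      rw [h1, h2]
    · intro n F x y
      have h1 := H.func F (fun i => φ.symm (x i)) (φ.symm y)
      have h2 := hfun F (fun i => φ.symm (x i)) (φ.symm y)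
      simp only [Equiv.apply_symm_apply] at h1 h2
      rw [h1, h2]
    · intro s hs
      obtain ⟨E, hE⟩ := hE s hs
      obtain ⟨e, he, hej⟩ := H.strong s hs
      refine ⟨e.comp E.symm.toEmbedding, he.comp (isKEmb_equiv _ (K.mem_iso E he.1)), ?_⟩
      intro x
      have := hej (E.symm x)
      refine this.trans (congrArg j (Subtype.ext ?_))
      rw [hφ]
      have := hE (E.symm x)
      rw [FirstOrder.Language.Equiv.apply_symm_apply] at this
      exact this.symm
  · intro H
    refine ⟨fun x y hxy => φ.injective (H.inj hxy), ?_, ?_, ?_⟩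
    · intro n R x
      rw [← hrel]
      exact H.rel R fun i => φ (x i)
    · intro n F x y
      rw [← hfun]
      exact H.func F (fun i => φ (x i)) (φ y)
    · intro s hs
      obtain ⟨E, hE⟩ := hE s hs
      obtain ⟨e, he, hej⟩ := H.strong s hs
      refine ⟨e.comp E.toEmbedding,
        he.comp (isKEmb_equiv _ (K.mem_of_strong _ (hS s hs)).1), fun x => ?_⟩
      refine (hej (E x)).trans (congrArg j (Subtype.ext ?_))
      rw [hφ]
      exact hE x

/-- Whether the union of a system is a base does not depend on the model that contains it. Systems
can thus be moved between a model, its strong submodels and its copies. -/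
theorem isAmalgBase_map_iff {f : N ↪[L] N'} (hf : K.IsKEmb f)
    (h : ∀ w ∈ I, S' w = (S w).map f.toHom) :
    K.IsAmalgBase μ N' I S' ↔ K.IsAmalgBase μ N I S := by
  unfold IsAmalgBase
  rw [isSystem_map_iff hf h]
  refine and_congr Iff.rfl (and_congr_right fun hsys => ?_)
  let φ : unionOf I S ≃ unionOf I S' :=
    (Equiv.Set.image f (unionOf I S) f.injective).trans (Equiv.setCongr (unionOf_map h).symm)
  have hφ : ∀ x, (φ x : N') = f x := fun x => rfl
  constructor
  · intro H M₁ M₂ h₁ h₂ j₁ j₂ hj₁ hj₂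
    obtain ⟨M, g₁, g₂, hM, hg₁, hg₂, hg⟩ := H M₁ M₂ h₁ h₂ (fun x => j₁ (φ.symm x))
      (fun x => j₂ (φ.symm x))
      ((isPlacement_map_iff h φ hφ _ hsys.strong).1 (by simpa using hj₁))
      ((isPlacement_map_iff h φ hφ _ hsys.strong).1 (by simpa using hj₂))
    exact ⟨M, g₁, g₂, hM, hg₁, hg₂, fun a => by simpa using hg (φ a)⟩
  · intro H M₁ M₂ h₁ h₂ j₁ j₂ hj₁ hj₂
    obtain ⟨M, g₁, g₂, hM, hg₁, hg₂, hg⟩ := H M₁ M₂ h₁ h₂ (fun x => j₁ (φ x))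
      (fun x => j₂ (φ x)) ((isPlacement_map_iff h φ hφ _ hsys.strong).2 hj₁)
      ((isPlacement_map_iff h φ hφ _ hsys.strong).2 hj₂)
    exact ⟨M, g₁, g₂, hM, hg₁, hg₂, fun a => by simpa using hg (φ.symm a)⟩

theorem map_refl {M : Type u} [L.Structure M] (T : L.Substructure M) :
    T.map (Embedding.refl L M).toHom = T := by
  rw [Embedding.refl_toHom, Substructure.map_id]

theorem isAmalgBase_congr {S S' : Finset ℕ → L.Substructure N} (h : ∀ w ∈ I, S' w = S w) :
    K.IsAmalgBase μ N I S' ↔ K.IsAmalgBase μ N I S :=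
  isAmalgBase_map_iff (isKEmb_refl N.mem) fun w hw => by rw [h w hw]; exact (map_refl _).symm

theorem IsAmalgBase.ab (h : K.IsAmalgBase μ N I S) : K.Ab N (unionOf I S) := ⟨μ, I, S, h, rfl⟩

theorem IsAmalgBase.ab_bdry {t : Finset ℕ} (h : K.IsAmalgBase μ N t.ssubsets S) :
    K.Ab N (bdry S t) := h.ab

/-- A system whose union is one of its models is an amalgamation base. -/
theorem isAmalgBase_of_AP (hμ : K.LS ≤ μ) (hAP : K.AP μ) (hS : K.IsSystem μ N I S)
    {q : Finset ℕ} (hq : q ∈ I) (hle : ∀ w ∈ I, S w ≤ S q) : K.IsAmalgBase μ N I S := by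
  refine ⟨hμ, hS, fun M₁ M₂ h₁ h₂ j₁ j₂ hj₁ hj₂ => ?_⟩
  obtain ⟨e₁, he₁, hej₁⟩ := hj₁.strong q hq
  obtain ⟨e₂, he₂, hej₂⟩ := hj₂.strong q hq
  obtain ⟨M, g₁, g₂, hM, hg₁, hg₂, hg⟩ :=
    hAP (N.sub (S q) (hS.strong q hq)) M₁ M₂ (hS.card q hq) h₁ h₂ e₁ e₂ he₁ he₂
  refine ⟨M, g₁, g₂, hM, hg₁, hg₂, fun a => ?_⟩
  obtain ⟨a, w, hw, ha⟩ := a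
  have h1 := hej₁ ⟨a, hle w hw ha⟩
  have h2 := hej₂ ⟨a, hle w hw ha⟩
  have h3 := hg ⟨a, hle w hw ha⟩
  rw [h1, h2] at h3
  exact h3

/-- A single model is the union of the system with the one index `∅`. -/
theorem ab_of_strong (hμ : K.LS ≤ μ) (hAP : K.AP μ) {T : L.Substructure N} (hT : K.Strong T)
    (hc : #T = μ) : K.Ab N (T : Set N) := by
  refine ⟨μ, {∅}, fun _ => T, isAmalgBase_of_AP hμ hAP ⟨⟨∅, by simp⟩, ?_, fun _ _ => hT,
    fun _ _ _ _ _ => le_rfl, fun _ _ _ _ => by simp, fun _ _ => hc⟩ (q := ∅) (by simp)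
    (fun _ _ => le_rfl), ?_⟩
  · intro t ht s hs
    simp only [Finset.mem_singleton] at ht ⊢
    subst ht
    exact Finset.subset_empty.1 hs
  · ext x
    simp [mem_unionOf]

end AEC

/-! ### Stability with respect to a relation between faces. -/

namespace WeakForking

open FirstOrder.Language

variable {L : FirstOrder.Language.{u, u}} {K : AEC L} {W : WeakForking K} {N N' : K.Model}
  {μ : Cardinal.{u}} {ρ ρ' : Finset ℕ → Finset ℕ → Prop} {s : Finset ℕ}
  {S : Finset ℕ → L.Substructure N} {S' : Finset ℕ → L.Substructure N'}

/-- A `𝒫(s)`-system inside `N` such that each boundary `bdry S t` is an amalgamation base over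
which `S t` is independent from the union of the `S w` with `ρ t w`. -/
structure StableWrt (W : WeakForking K) (ρ : Finset ℕ → Finset ℕ → Prop) (μ : Cardinal.{u})
    (s : Finset ℕ) (N : K.Model) (S : Finset ℕ → L.Substructure N) : Prop where
  sys : K.IsSystem μ N s.powerset S
  base : ∀ t, t ⊂ s → t.Nonempty → K.IsAmalgBase μ N t.ssubsets S
  indep : ∀ t, t ⊂ s → t.Nonempty →
    W.Indep N (S t) (bdry S t) {x | ∃ w, w ⊂ s ∧ ρ t w ∧ x ∈ S w}

/-- A stable system whose last model need not be all of `N`. -/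
abbrev StableIn (W : WeakForking K) (μ : Cardinal.{u}) (s : Finset ℕ) (N : K.Model)
    (S : Finset ℕ → L.Substructure N) : Prop :=
  W.StableWrt (fun t w => ¬ t ⊆ w) μ s N S

theorem isStable_iff : W.IsStable μ s N S ↔ W.StableIn μ s N S ∧ S s = ⊤ :=
  ⟨fun h => ⟨⟨h.cube.1, h.base, h.indep⟩, h.cube.2⟩, fun h => ⟨⟨h.1.sys, h.2⟩, h.1.base, h.1.indep⟩⟩

theorem setOf_map {f : N ↪[L] N'} {p : Finset ℕ → Prop} (hp : ∀ w, p w → S' w = (S w).map f.toHom) :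
    {x | ∃ w, p w ∧ x ∈ S' w} = f '' {x | ∃ w, p w ∧ x ∈ S w} := by
  ext x
  simp only [Set.mem_ofPred_eq, Set.mem_image]
  constructor
  · rintro ⟨w, hw, hx⟩
    rw [hp w hw] at hx
    obtain ⟨y, hy, rfl⟩ := hx
    exact ⟨y, ⟨w, hw, hy⟩, rfl⟩
  · rintro ⟨y, ⟨w, hw, hy⟩, rfl⟩
    exact ⟨w, hw, by rw [hp w hw]; exact ⟨y, hy, rfl⟩⟩

/-- Invariance of independence is available only over bases, so the equivalence for the bases comes
first and feeds the one for independence. -/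
theorem stableWrt_map_iff {f : N ↪[L] N'} (hf : K.IsKEmb f)
    (h : ∀ w, w ⊆ s → S' w = (S w).map f.toHom) :
    W.StableWrt ρ μ s N' S' ↔ W.StableWrt ρ μ s N S := by
  have hb : ∀ t, t ⊂ s → (K.IsAmalgBase μ N' t.ssubsets S' ↔ K.IsAmalgBase μ N t.ssubsets S) :=
    fun t ht => isAmalgBase_map_iff hf fun w hw =>
      h w ((Finset.mem_ssubsets.1 hw).subset.trans ht.subset)
  have hi : ∀ t, t ⊂ s → K.IsAmalgBase μ N t.ssubsets S →
      (W.Indep N' (S' t) (bdry S' t) {x | ∃ w, w ⊂ s ∧ ρ t w ∧ x ∈ S' w} ↔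
        W.Indep N (S t) (bdry S t) {x | ∃ w, w ⊂ s ∧ ρ t w ∧ x ∈ S w}) := by
    intro t ht hbase
    rw [← indep_map_iff hf hbase.ab_bdry]
    have h1 : (S' t : Set N') = f '' (S t : Set N) := by rw [h t ht.subset]; rfl
    have h2 : bdry S' t = f '' bdry S t := unionOf_map fun w hw =>
      h w ((Finset.mem_ssubsets.1 hw).subset.trans ht.subset)
    have h3 : {x | ∃ w, w ⊂ s ∧ ρ t w ∧ x ∈ S' w} = f '' {x | ∃ w, w ⊂ s ∧ ρ t w ∧ x ∈ S w} := by
      simp only [← and_assoc]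
      exact setOf_map fun w hw => h w hw.1.subset
    rw [h1, h2, h3]
  have hs : K.IsSystem μ N' s.powerset S' ↔ K.IsSystem μ N s.powerset S :=
    isSystem_map_iff hf fun w hw => h w (Finset.mem_powerset.1 hw)
  constructor
  · intro H
    have := fun t ht hne => (hb t ht).1 (H.base t ht hne)
    exact ⟨hs.1 H.sys, this, fun t ht hne => (hi t ht (this t ht hne)).1 (H.indep t ht hne)⟩
  · intro H
    exact ⟨hs.2 H.sys, fun t ht hne => (hb t ht).2 (H.base t ht hne),
      fun t ht hne => (hi t ht (H.base t ht hne)).2 (H.indep t ht hne)⟩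

theorem stableWrt_congr {S S' : Finset ℕ → L.Substructure N} (h : ∀ w, w ⊆ s → S' w = S w) :
    W.StableWrt ρ μ s N S' ↔ W.StableWrt ρ μ s N S :=
  stableWrt_map_iff (isKEmb_refl N.mem) fun w hw => by rw [h w hw]; exact (map_refl _).symm

namespace StableWrt

theorem weaken (H : W.StableWrt ρ μ s N S) (h : ∀ t w, t ⊂ s → w ⊂ s → ρ' t w → ρ t w) :
    W.StableWrt ρ' μ s N S :=
  ⟨H.sys, H.base, fun t ht hne => (H.indep t ht hne).mono_right (H.base t ht hne).ab_bdry
    (fun _ ⟨w, hw, hr, hx⟩ => Or.inl ⟨w, hw, h t w ht hw hr, hx⟩)⟩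

theorem sub (H : W.StableWrt ρ μ s N S) {t : Finset ℕ} (ht : t ⊆ s) : W.StableWrt ρ μ t N S := by
  have hsys : K.IsSystem μ N t.powerset S := by
    have hmem : ∀ w ∈ t.powerset, w ∈ s.powerset := fun w hw =>
      Finset.mem_powerset.2 ((Finset.mem_powerset.1 hw).trans ht)
    exact ⟨⟨∅, by simp⟩, fun _ ha _ hb => Finset.mem_powerset.2 (hb.trans (Finset.mem_powerset.1 ha)),
      fun w hw => H.sys.strong w (hmem w hw), fun w hw v hv => H.sys.mono w (hmem w hw) v (hmem v hv),
      fun w hw v hv => H.sys.inter w (hmem w hw) v (hmem v hv), fun w hw => H.sys.card w (hmem w hw)⟩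
  refine ⟨hsys, fun q hq => H.base q (hq.trans_subset ht), fun q hq hne => ?_⟩
  refine (H.indep q (hq.trans_subset ht) hne).mono_right (H.base q (hq.trans_subset ht) hne).ab_bdry ?_
  exact fun _ ⟨w, hw, hr, hx⟩ => Or.inl ⟨w, hw.trans_subset ht, hr, hx⟩

theorem strong (H : W.StableWrt ρ μ s N S) {t : Finset ℕ} (ht : t ⊆ s) : K.Strong (S t) :=
  H.sys.strong t (Finset.mem_powerset.2 ht)

theorem mono (H : W.StableWrt ρ μ s N S) {w t : Finset ℕ} (hw : w ⊆ t) (ht : t ⊆ s) :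
    S w ≤ S t :=
  H.sys.mono w (Finset.mem_powerset.2 (hw.trans ht)) t (Finset.mem_powerset.2 ht) hw

theorem card (H : W.StableWrt ρ μ s N S) {t : Finset ℕ} (ht : t ⊆ s) : #(S t) = μ :=
  H.sys.card t (Finset.mem_powerset.2 ht)

theorem inter (H : W.StableWrt ρ μ s N S) {t w : Finset ℕ} (ht : t ⊆ s) (hw : w ⊆ s) :
    S (t ∩ w) = S t ⊓ S w :=
  H.sys.inter t (Finset.mem_powerset.2 ht) w (Finset.mem_powerset.2 hw)

/-- A system inside `N`, considered inside its last model. -/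
theorem comap (H : W.StableWrt ρ μ s N S) :
    W.StableWrt ρ μ s (N.sub (S s) (H.strong subset_rfl))
      (fun w => (S w).comap (S s).subtype.toHom) :=
  (stableWrt_map_iff (isKEmb_subtype (H.strong subset_rfl)) fun _ hw =>
    (map_subtype_comap (H.mono hw subset_rfl)).symm).1 H

end StableWrt

/-- The goodness properties concern systems whose last model is everything. This is the passage to
them from systems inside a larger model. -/
theorem StableWrt.isStable_comap (H : W.StableIn μ s N S) :
    W.IsStable μ s (N.sub (S s) (H.strong subset_rfl))
      (fun w => (S w).comap (S s).subtype.toHom) :=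
  isStable_iff.2 ⟨H.comap, by ext x; simp⟩

/-! ### Renaming the vertices of a system. -/

section Reindex

variable (σ : ℕ ↪ ℕ)

theorem ssubset_map_iff {t w : Finset ℕ} : t.map σ ⊂ w.map σ ↔ t ⊂ w := by
  simp only [Finset.ssubset_iff_subset_ne, Finset.map_subset_map, ne_eq, Finset.map_inj]

theorem exists_of_subset_map {t s : Finset ℕ} (h : t ⊆ s.map σ) : ∃ t' ⊆ s, t = t'.map σ :=
  Finset.subset_map_iff.1 h

theorem exists_of_ssubset_map {t s : Finset ℕ} (h : t ⊂ s.map σ) : ∃ t' ⊂ s, t = t'.map σ := by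
  obtain ⟨t', -, rfl⟩ := exists_of_subset_map σ h.subset
  exact ⟨t', (ssubset_map_iff σ).1 h, rfl⟩

theorem isSystem_reindex_iff {I J : Finset (Finset ℕ)}
    (hI : ∀ w, w ∈ I ↔ w.map σ ∈ J) (hJ : ∀ w ∈ J, ∃ v : Finset ℕ, w = v.map σ) :
    K.IsSystem μ N I (fun w => S (w.map σ)) ↔ K.IsSystem μ N J S := by
  constructor
  · intro H
    refine ⟨?_, ?_, ?_, ?_, ?_, ?_⟩
    · obtain ⟨w, hw⟩ := H.nonempty
      exact ⟨_, (hI w).1 hw⟩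
    · intro t ht s hs
      obtain ⟨t, rfl⟩ := hJ t ht
      obtain ⟨s, hs', rfl⟩ := exists_of_subset_map σ hs
      exact (hI _).1 (H.down t ((hI _).2 ht) s hs')
    · intro s hs
      obtain ⟨s, rfl⟩ := hJ s hs
      exact H.strong s ((hI _).2 hs)
    · intro s hs t ht hst
      obtain ⟨t, rfl⟩ := hJ t ht
      obtain ⟨s, rfl⟩ := hJ s hs
      exact H.mono s ((hI _).2 hs) t ((hI _).2 ht) (Finset.map_subset_map.1 hst)
    · intro s hs t ht
      obtain ⟨t, rfl⟩ := hJ t ht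
      obtain ⟨s, rfl⟩ := hJ s hs
      rw [← Finset.map_inter]
      exact H.inter s ((hI _).2 hs) t ((hI _).2 ht)
    · intro s hs
      obtain ⟨s, rfl⟩ := hJ s hs
      exact H.card s ((hI _).2 hs)
  · intro H
    refine ⟨?_, ?_, ?_, ?_, ?_, ?_⟩
    · obtain ⟨w, hw⟩ := H.nonempty
      obtain ⟨v, rfl⟩ := hJ w hw
      exact ⟨v, (hI v).2 hw⟩
    · intro t ht s hs
      exact (hI _).2 (H.down _ ((hI _).1 ht) _ (Finset.map_subset_map.2 hs))
    · intro s hs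
      exact H.strong _ ((hI _).1 hs)
    · intro s hs t ht hst
      exact H.mono _ ((hI _).1 hs) _ ((hI _).1 ht) (Finset.map_subset_map.2 hst)
    · intro s hs t ht
      rw [Finset.map_inter]
      exact H.inter _ ((hI _).1 hs) _ ((hI _).1 ht)
    · intro s hs
      exact H.card _ ((hI _).1 hs)

theorem unionOf_reindex {I J : Finset (Finset ℕ)}
    (hI : ∀ w, w ∈ I ↔ w.map σ ∈ J) (hJ : ∀ w ∈ J, ∃ v : Finset ℕ, w = v.map σ) :
    unionOf I (fun w => S (w.map σ)) = unionOf J S := by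
  ext x
  simp only [mem_unionOf]
  constructor
  · rintro ⟨w, hw, hx⟩
    exact ⟨_, (hI w).1 hw, hx⟩
  · rintro ⟨w, hw, hx⟩
    obtain ⟨v, rfl⟩ := hJ w hw
    exact ⟨v, (hI v).2 hw, hx⟩

theorem isPlacement_reindex_iff {I J : Finset (Finset ℕ)}
    (hI : ∀ w, w ∈ I ↔ w.map σ ∈ J) (hJ : ∀ w ∈ J, ∃ v : Finset ℕ, w = v.map σ) {M : K.Model}
    (j : unionOf J S → M) :
    K.IsPlacement I (fun w => S (w.map σ)) M
        (fun x => j ⟨x.1, (unionOf_reindex σ hI hJ).subset x.2⟩) ↔ K.IsPlacement J S M j := by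
  have hmem : ∀ x, x ∈ unionOf J S → x ∈ unionOf I (fun w => S (w.map σ)) :=
    fun x hx => (unionOf_reindex σ hI hJ).symm.subset hx
  constructor
  · intro H
    refine ⟨?_, ?_, ?_, ?_⟩
    · intro x y hxy
      have := @H.inj ⟨x, hmem _ x.2⟩ ⟨y, hmem _ y.2⟩ hxy
      exact Subtype.ext (Subtype.mk.inj this)
    · intro n R x
      exact H.rel R fun i => ⟨x i, hmem _ (x i).2⟩
    · intro n F x y
      exact H.func F (fun i => ⟨x i, hmem _ (x i).2⟩) ⟨y, hmem _ y.2⟩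
    · intro s hs
      obtain ⟨v, rfl⟩ := hJ s hs
      exact H.strong v ((hI v).2 hs)
  · intro H
    refine ⟨?_, ?_, ?_, ?_⟩
    · intro x y hxy
      exact Subtype.ext (Subtype.mk.inj (H.inj hxy))
    · intro n R x
      exact H.rel R fun i => ⟨x i, _⟩
    · intro n F x y
      exact H.func F (fun i => ⟨x i, _⟩) ⟨y, _⟩
    · intro s hs
      exact H.strong _ ((hI s).1 hs)

theorem isAmalgBase_reindex_iff {I J : Finset (Finset ℕ)}
    (hI : ∀ w, w ∈ I ↔ w.map σ ∈ J) (hJ : ∀ w ∈ J, ∃ v : Finset ℕ, w = v.map σ) :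
    K.IsAmalgBase μ N I (fun w => S (w.map σ)) ↔ K.IsAmalgBase μ N J S := by
  have hmem : ∀ x, x ∈ unionOf J S → x ∈ unionOf I (fun w => S (w.map σ)) :=
    fun x hx => (unionOf_reindex σ hI hJ).symm.subset hx
  have hmem' : ∀ x, x ∈ unionOf I (fun w => S (w.map σ)) → x ∈ unionOf J S :=
    fun x hx => (unionOf_reindex σ hI hJ).subset hx
  unfold IsAmalgBase
  rw [isSystem_reindex_iff σ hI hJ]
  refine and_congr Iff.rfl (and_congr_right fun hsys => ?_)
  constructor
  · intro H M₁ M₂ h₁ h₂ j₁ j₂ hj₁ hj₂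
    obtain ⟨M, g₁, g₂, hM, hg₁, hg₂, hg⟩ := H M₁ M₂ h₁ h₂ _ _
      ((isPlacement_reindex_iff σ hI hJ _).2 hj₁) ((isPlacement_reindex_iff σ hI hJ _).2 hj₂)
    exact ⟨M, g₁, g₂, hM, hg₁, hg₂, fun a => hg ⟨a, hmem _ a.2⟩⟩
  · intro H M₁ M₂ h₁ h₂ j₁ j₂ hj₁ hj₂
    obtain ⟨M, g₁, g₂, hM, hg₁, hg₂, hg⟩ := H M₁ M₂ h₁ h₂ (fun x => j₁ ⟨x, hmem _ x.2⟩)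
      (fun x => j₂ ⟨x, hmem _ x.2⟩) ((isPlacement_reindex_iff σ hI hJ _).1 hj₁)
      ((isPlacement_reindex_iff σ hI hJ _).1 hj₂)
    exact ⟨M, g₁, g₂, hM, hg₁, hg₂, fun a => hg ⟨a, hmem' _ a.2⟩⟩

theorem isAmalgBase_ssubsets_reindex_iff {t : Finset ℕ} :
    K.IsAmalgBase μ N t.ssubsets (fun w => S (w.map σ)) ↔
      K.IsAmalgBase μ N (t.map σ).ssubsets S :=
  isAmalgBase_reindex_iff σ (by simp) fun w hw => by
    obtain ⟨v, -, rfl⟩ := exists_of_ssubset_map σ (Finset.mem_ssubsets.1 hw)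
    exact ⟨v, rfl⟩

theorem bdry_reindex {t : Finset ℕ} : bdry (fun w => S (w.map σ)) t = bdry S (t.map σ) :=
  unionOf_reindex σ (by simp) fun w hw => by
    obtain ⟨v, -, rfl⟩ := exists_of_ssubset_map σ (Finset.mem_ssubsets.1 hw)
    exact ⟨v, rfl⟩

theorem stableWrt_reindex_iff :
    W.StableWrt (fun t w => ρ (t.map σ) (w.map σ)) μ s N (fun w => S (w.map σ)) ↔
      W.StableWrt ρ μ (s.map σ) N S := by
  have hset : ∀ t : Finset ℕ, {x | ∃ w, w ⊂ s ∧ ρ (t.map σ) (w.map σ) ∧ x ∈ S (w.map σ)} =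
      {x | ∃ w, w ⊂ s.map σ ∧ ρ (t.map σ) w ∧ x ∈ S w} := by
    intro t
    ext x
    constructor
    · rintro ⟨w, hw, hr, hx⟩
      exact ⟨w.map σ, (ssubset_map_iff σ).2 hw, hr, hx⟩
    · rintro ⟨w, hw, hr, hx⟩
      obtain ⟨v, hv, rfl⟩ := exists_of_ssubset_map σ hw
      exact ⟨v, hv, hr, hx⟩
  have hsys : K.IsSystem μ N s.powerset (fun w => S (w.map σ)) ↔
      K.IsSystem μ N (s.map σ).powerset S :=
    isSystem_reindex_iff σ (by simp) fun w hw => by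
      obtain ⟨v, -, rfl⟩ := exists_of_subset_map σ (Finset.mem_powerset.1 hw)
      exact ⟨v, rfl⟩
  constructor
  · intro H
    refine ⟨hsys.1 H.sys, fun t ht hne => ?_, fun t ht hne => ?_⟩
    · obtain ⟨t, ht', rfl⟩ := exists_of_ssubset_map σ ht
      exact (isAmalgBase_ssubsets_reindex_iff σ).1 (H.base t ht' (by simpa using hne))
    · obtain ⟨t, ht', rfl⟩ := exists_of_ssubset_map σ ht
      have := H.indep t ht' (by simpa using hne)
      rwa [bdry_reindex, hset] at this
  · intro H
    refine ⟨hsys.2 H.sys, fun t ht hne => ?_, fun t ht hne => ?_⟩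
    · exact (isAmalgBase_ssubsets_reindex_iff σ).2
        (H.base _ ((ssubset_map_iff σ).2 ht) (by simpa using hne))
    · have := H.indep _ ((ssubset_map_iff σ).2 ht) (by simpa using hne)
      rwa [bdry_reindex, hset]

theorem stableIn_reindex_iff :
    W.StableIn μ s N (fun w => S (w.map σ)) ↔ W.StableIn μ (s.map σ) N S := by
  have := stableWrt_reindex_iff (W := W) (ρ := fun t w => ¬ t ⊆ w) (μ := μ) (s := s) (S := S) σ
  simpa only [Finset.map_subset_map] using this

/-- Goodness is stated for the index sets `range n`, while faces have arbitrary finite sets of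
vertices; `σ` renames the vertices. -/
theorem exists_embedding_map_range (s : Finset ℕ) :
    ∃ σ : ℕ ↪ ℕ, (Finset.range s.card).map σ = s := by
  classical
  -- Beyond `s.card` the values exceed every element of `s`, which keeps `g` injective.
  let g : ℕ → ℕ := fun i => if h : i < s.card then s.orderEmbOfFin rfl ⟨i, h⟩ else s.sup id + 1 + i
  have hle : ∀ i (h : i < s.card), s.orderEmbOfFin rfl ⟨i, h⟩ ≤ s.sup id := fun i h =>
    Finset.le_sup (f := id) (Finset.orderEmbOfFin_mem s rfl _)
  refine ⟨⟨g, fun i j hij => ?_⟩, ?_⟩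
  · simp only [g] at hij
    split_ifs at hij with h1 h2 h2
    · have := (s.orderEmbOfFin rfl).injective hij
      simpa using this
    · have := hle i h1; omega
    · have := hle j h2; omega
    · omega
  · ext x
    simp only [Finset.mem_map, Finset.mem_range]
    constructor
    · rintro ⟨i, hi, rfl⟩
      change g i ∈ s
      simp only [g, hi, dite_true]
      exact Finset.orderEmbOfFin_mem s rfl _
    · intro hx
      have : x ∈ Set.range (s.orderEmbOfFin rfl) := by
        rw [Finset.range_orderEmbOfFin]; exact hx
      obtain ⟨i, rfl⟩ := this
      exact ⟨i, i.2, by change g i = _; simp [g]⟩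

end Reindex

end WeakForking

/-! ### Clubs of subsets and filtrations. -/

theorem mk_iUnion_le_of_forall_le {α ι : Type u} {f : ι → Set α} {ν : Cardinal.{u}} (hν : ℵ₀ ≤ ν)
    (hι : #ι ≤ ν) (hf : ∀ i, #(f i) ≤ ν) : #(⋃ i, f i) ≤ ν := by
  refine mk_iUnion_le_sum_mk.trans ((Cardinal.sum_le_sum _ (fun _ => ν) hf).trans ?_)
  rw [Cardinal.sum_const']
  exact (mul_le_mul_left hι ν).trans (Cardinal.mul_eq_self hν).le

theorem mk_iUnion_nat_le {α : Type u} {f : ℕ → Set α} {ν : Cardinal.{u}} (hν : ℵ₀ ≤ ν)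
    (hf : ∀ i, #(f i) ≤ ν) : #(⋃ i, f i) ≤ ν := by
  have : ⋃ i, f i = ⋃ i : ULift.{u} ℕ, f i.down := by
    ext x; simp
  rw [this]
  exact mk_iUnion_le_of_forall_le hν (by simpa using hν) fun i => hf _

theorem mk_iUnion_Iio_le {α : Type u} {f : Ordinal.{u} → Set α} {ν : Cardinal.{u}} (hν : ℵ₀ ≤ ν)
    {δ : Ordinal.{u}} (hδ : δ.card ≤ ν) (hf : ∀ i < δ, #(f i) ≤ ν) :
    #(⋃ i ∈ Set.Iio δ, f i) ≤ ν := by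
  have : ⋃ i ∈ Set.Iio δ, f i = ⋃ i : δ.ToType, f (Ordinal.ToType.mk.symm i).1 := by
    ext x
    simp only [Set.mem_iUnion, Set.mem_Iio]
    constructor
    · rintro ⟨i, hi, hx⟩
      exact ⟨Ordinal.ToType.mk ⟨i, hi⟩, by simpa using hx⟩
    · rintro ⟨i, hx⟩
      exact ⟨_, (Ordinal.ToType.mk.symm i).2, hx⟩
  rw [this]
  exact mk_iUnion_le_of_forall_le hν (by simpa using hδ) fun i => hf _ (Ordinal.ToType.mk.symm i).2

/-- A family of subsets of `G` that contains a small superset of each small set and is closed under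
unions of chains. -/
structure SetClub (κ : Cardinal.{u}) {G : Type u} (C : Set (Set G)) : Prop where
  cof : ∀ A, ∃ X ∈ C, A ⊆ X ∧ #X ≤ #A + κ
  chain : ∀ c ⊆ C, c.Nonempty → IsChain (· ≤ ·) c → ⋃₀ c ∈ C

namespace SetClub

variable {κ : Cardinal.{u}} {G H : Type u} {C D : Set (Set G)}

theorem iUnion_nat (hC : SetClub κ C) {f : ℕ → Set G} (hf : Monotone f) (h : ∀ n, f n ∈ C) :
    ⋃ n, f n ∈ C := by
  rw [← Set.sUnion_range]
  exact hC.chain _ (by rintro _ ⟨n, rfl⟩; exact h n) (Set.range_nonempty f) hf.isChain_range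

theorem inter (hκ : ℵ₀ ≤ κ) (hC : SetClub κ C) (hD : SetClub κ D) : SetClub κ (C ∩ D) := by
  refine ⟨fun A => ?_, fun c hc hne hch =>
    ⟨hC.chain c (fun x hx => (hc hx).1) hne hch, hD.chain c (fun x hx => (hc hx).2) hne hch⟩⟩
  choose f hf hAf hcf using hC.cof
  choose g hg hAg hcg using hD.cof
  -- The two closures alternate. The chain `a` interleaves with `f (a n)`, which lies in `C`, and
  -- with `g (f (a n))`, which lies in `D`, so its union is a union of either chain.
  let a : ℕ → Set G := fun n => Nat.rec A (fun _ B => g (f B)) n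
  have ha : Monotone a := monotone_nat_of_le_succ fun n => (hAf _).trans (hAg _)
  have hν : ℵ₀ ≤ #A + κ := hκ.trans le_add_self
  have hνκ : #A + κ + κ = #A + κ := by rw [add_assoc, Cardinal.add_eq_self hκ]
  have hcard : ∀ n, #↥(a n) ≤ #A + κ := by
    intro n
    induction n with
    | zero => exact le_self_add
    | succ n ih =>
      refine (hcg _).trans ?_
      rw [← hνκ]
      gcongr
      refine (hcf _).trans ?_
      rw [← hνκ]
      gcongr
  have h1 : ⋃ n, a n = ⋃ n, f (a n) := by
    refine subset_antisymm (Set.iUnion_mono fun n => hAf _) (Set.iUnion_subset fun n => ?_)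
    exact (hAg (f (a n))).trans (Set.subset_iUnion a (n + 1))
  have h2 : ⋃ n, a n = ⋃ n, g (f (a n)) := by
    refine subset_antisymm (Set.iUnion_mono fun n => (hAf _).trans (hAg _))
      (Set.iUnion_subset fun n => ?_)
    exact Set.subset_iUnion a (n + 1)
  refine ⟨⋃ n, a n, ⟨?_, ?_⟩, Set.subset_iUnion a 0, mk_iUnion_nat_le hν hcard⟩
  · rw [h1]
    refine hC.iUnion_nat (monotone_nat_of_le_succ fun n => ?_) fun n => hf _
    exact (hAg (f (a n))).trans (hAf _)
  · rw [h2]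
    refine hD.iUnion_nat (monotone_nat_of_le_succ fun n => ?_) fun n => hg _
    exact (hAf (g (f (a n)))).trans (hAg _)

theorem univ : SetClub κ (Set.univ : Set (Set G)) :=
  ⟨fun A => ⟨A, trivial, subset_rfl, le_self_add⟩, fun _ _ _ _ => trivial⟩

theorem biInter {ι : Type*} (hκ : ℵ₀ ≤ κ) (s : Finset ι) {C : ι → Set (Set G)}
    (h : ∀ i ∈ s, SetClub κ (C i)) : SetClub κ (⋂ i ∈ s, C i) := by
  classical
  induction s using Finset.induction_on with
  | empty => simpa using univ
  | insert a s ha ih =>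
    rw [Finset.set_biInter_insert]
    exact (h a (by simp)).inter hκ (ih fun i hi => h i (by simp [hi]))

theorem iInter {ι : Type*} [Finite ι] (hκ : ℵ₀ ≤ κ) {C : ι → Set (Set G)}
    (h : ∀ i, SetClub κ (C i)) : SetClub κ (⋂ i, C i) := by
  have := Fintype.ofFinite ι
  simpa using biInter hκ Finset.univ fun i _ => h i

/-- If `Y ∈ D` contains the preimage of `A`, then `A ∪ p '' Y` has preimage exactly `Y`, because `p`
is injective. -/
theorem comap {p : H → G} (hp : Function.Injective p) {D : Set (Set H)} (hκ : ℵ₀ ≤ κ)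
    (hD : SetClub κ D) : SetClub κ {X : Set G | p ⁻¹' X ∈ D} := by
  refine ⟨fun A => ?_, fun c hc hne hch => ?_⟩
  · obtain ⟨Y, hY, hAY, hcard⟩ := hD.cof (p ⁻¹' A)
    refine ⟨A ∪ p '' Y, ?_, Set.subset_union_left, ?_⟩
    · simpa only [Set.mem_ofPred_eq, Set.preimage_union, Set.preimage_image_eq _ hp,
        Set.union_eq_self_of_subset_left hAY]
    · refine (Cardinal.mk_union_le _ _).trans ?_
      have h1 : #(p ⁻¹' A) ≤ #A := Cardinal.mk_preimage_of_injective p A hp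
      have h2 : #(p '' Y) ≤ #A + κ := Cardinal.mk_image_le.trans (hcard.trans (by gcongr))
      calc #A + #(p '' Y) ≤ (#A + κ) + (#A + κ) := by gcongr; exact le_self_add
        _ = #A + κ := Cardinal.add_eq_self (hκ.trans le_add_self)
  · have : p ⁻¹' ⋃₀ c = ⋃₀ ((fun X => p ⁻¹' X) '' c) := by
      ext x; simp
    change p ⁻¹' ⋃₀ c ∈ D
    rw [this]
    refine hD.chain _ ?_ (hne.image _) ?_
    · rintro _ ⟨X, hX, rfl⟩
      exact hc hX
    · rintro _ ⟨X, hX, rfl⟩ _ ⟨Y, hY, rfl⟩ _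
      exact (hch.total hX hY).imp (fun h => Set.preimage_mono h) (fun h => Set.preimage_mono h)

/-- Finitary closure conditions survive unions of chains, since a finite tuple from the union lies
in one member. Definability enters the proof through this club. -/
theorem closed (hκ : ℵ₀ ≤ κ) {ι : Type u} (hι : #ι ≤ κ) (ar : ι → ℕ)
    (F : ∀ i, (Fin (ar i) → G) → G) :
    SetClub κ {X : Set G | ∀ i x, (∀ k, x k ∈ X) → F i x ∈ X} := by
  constructor
  · intro A
    -- With the functions read as symbols of an auxiliary language, the closure of `A` is a
    -- generated substructure, whose cardinality is at most `#A + κ`.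
    let L' : FirstOrder.Language.{u, u} := ⟨fun n => {i : ι // ar i = n}, fun _ => PEmpty⟩
    let _ : L'.Structure G :=
      { funMap := fun {n} f x => F f.1 (fun k => x (Fin.cast f.2 k))
        RelMap := fun {n} r => PEmpty.elim r }
    refine ⟨FirstOrder.Language.Substructure.closure L' A, ?_,
      FirstOrder.Language.Substructure.subset_closure, ?_⟩
    · intro i x hx
      exact (FirstOrder.Language.Substructure.closure L' A).fun_mem
        (show L'.Functions (ar i) from ⟨i, rfl⟩) x hx
    · have h := FirstOrder.Language.Substructure.lift_card_closure_le (L := L') (s := A)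
      simp only [Cardinal.lift_id] at h
      have hF : #(Σ n, L'.Functions n) = #ι := by
        refine Cardinal.mk_congr ⟨fun x => x.2.1, fun i => ⟨ar i, i, rfl⟩, ?_, fun i => rfl⟩
        rintro ⟨n, i, rfl⟩
        rfl
      refine h.trans (max_le (hκ.trans le_add_self) ?_)
      rw [hF]
      gcongr
  · intro c hc hne hch i x hx
    have : ∃ X ∈ c, ∀ k, x k ∈ X := by
      have hdir : DirectedOn (· ≤ ·) c := hch.directedOn
      have hfin : ∀ s : Finset (Fin (ar i)), ∃ X ∈ c, ∀ k ∈ s, x k ∈ X := by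
        intro s
        induction s using Finset.induction_on with
        | empty =>
          obtain ⟨X, hX⟩ := hne
          exact ⟨X, hX, by simp⟩
        | insert a s ha ih =>
          obtain ⟨X, hX, hXs⟩ := ih
          obtain ⟨Y, hY, hYa⟩ := hx a
          obtain ⟨Z, hZ, hXZ, hYZ⟩ := hdir X hX Y hY
          refine ⟨Z, hZ, fun k hk => ?_⟩
          rcases Finset.mem_insert.1 hk with rfl | hk
          · exact hYZ hYa
          · exact hXZ (hXs k hk)
      obtain ⟨X, hX, h⟩ := hfin Finset.univ
      exact ⟨X, hX, fun k => h k (Finset.mem_univ _)⟩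
    obtain ⟨X, hX, hxX⟩ := this
    exact ⟨X, hX, hc hX i x hxX⟩

theorem closed_unary (hκ : ℵ₀ ≤ κ) (f : G → G) : SetClub κ {X : Set G | ∀ x ∈ X, f x ∈ X} := by
  have h := closed (G := G) hκ (ι := PUnit.{u + 1}) (by simpa using Cardinal.one_le_aleph0.trans hκ)
    (fun _ => 1) (fun _ x => f (x 0))
  convert h using 1
  ext X
  constructor
  · intro hX _ x hx
    exact hX _ (hx 0)
  · intro hX x hx
    exact hX PUnit.unit (fun _ => x) (fun _ => hx)

/-- An increasing continuous chain of members of `C` of cardinality less than `lam`, with union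
`G`. -/
structure IsFiltration (κ lam : Cardinal.{u}) (C : Set (Set G)) (X : Ordinal.{u} → Set G) :
    Prop where
  card_zero : #(X 0) = κ
  mono : Monotone X
  mem : ∀ i, X i ∈ C
  le_card : ∀ i, κ ≤ #(X i)
  card_lt : ∀ i < lam.ord, #(X i) < lam
  ord_card_le : ∀ i ≤ lam.ord, i.card ≤ #(X i)
  card_succ : ∀ i, #(X (i + 1)) = #(X i)
  limit : ∀ δ, Order.IsSuccLimit δ → X δ = ⋃ j ∈ Set.Iio δ, X j
  top : X lam.ord = Set.univ

/-- A club contains an increasing continuous chain of length `lam.ord`, of sets of cardinality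
`< lam`, that exhausts a set of cardinality `lam`. -/
theorem exists_filtration (hκ : ℵ₀ ≤ κ) {lam : Cardinal.{u}} (hlam : κ < lam) (hG : #G = lam)
    (hC : SetClub κ C) (A₀ : Set G) (hA₀ : #A₀ ≤ κ) :
    ∃ X : Ordinal.{u} → Set G, A₀ ⊆ X 0 ∧ IsFiltration κ lam C X := by
  classical
  choose cl hcl hAcl hcard using hC.cof
  have hlam0 : ℵ₀ ≤ lam := hκ.trans hlam.le
  obtain ⟨e⟩ : Nonempty (lam.ord.ToType ≃ G) := Cardinal.eq.1 (by simp [hG])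
  have hGne : Nonempty G := by
    rw [← Cardinal.mk_ne_zero_iff, hG]
    exact (Cardinal.aleph0_pos.trans_le hlam0).ne'
  -- An enumeration of `G` along `lam.ord`, of which one element is added at each step. The values
  -- beyond `lam.ord` are irrelevant.
  let g : Ordinal.{u} → G := fun i =>
    if h : i < lam.ord then e (Ordinal.ToType.mk ⟨i, h⟩) else Classical.arbitrary G
  have hg : ∀ x, ∃ i < lam.ord, g i = x := by
    intro x
    refine ⟨(Ordinal.ToType.mk.symm (e.symm x)).1, (Ordinal.ToType.mk.symm (e.symm x)).2, ?_⟩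
    have h : (Ordinal.ToType.mk.symm (e.symm x)).1 < lam.ord :=
      (Ordinal.ToType.mk.symm (e.symm x)).2
    simp only [g, h, dite_true]
    exact (congrArg e (Ordinal.ToType.mk.apply_symm_apply (e.symm x))).trans
      (e.apply_symm_apply x)
  -- `B` serves only to give `X 0` the exact cardinality `κ`.
  obtain ⟨B, hBκ⟩ : ∃ B : Set G, #B = κ := by
    have := Cardinal.le_mk_iff_exists_set.1 (show κ ≤ #G from hG ▸ hlam.le)
    exact this
  let X : Ordinal.{u} → Set G := fun i => Ordinal.limitRecOn i (cl (A₀ ∪ B))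
    (fun j Y => cl (Y ∪ {g j})) (fun δ _ Y => ⋃ j, ⋃ h : j < δ, Y j h)
  have h0 : X 0 = cl (A₀ ∪ B) := Ordinal.limitRecOn_zero _ _ _
  have hs : ∀ i, X (i + 1) = cl (X i ∪ {g i}) := fun i => Ordinal.limitRecOn_add_one _ _ _ _
  have hl : ∀ δ, Order.IsSuccLimit δ → X δ = ⋃ j ∈ Set.Iio δ, X j := fun δ hδ =>
    Ordinal.limitRecOn_limit _ _ _ _ hδ
  have hmono : Monotone X := by
    intro i j hij
    induction j using Ordinal.limitRecOn with
    | zero => rw [le_zero_iff.1 hij]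
    | add_one j ih =>
      rcases hij.lt_or_eq with h | rfl
      · rw [hs]
        exact (ih (Order.lt_add_one_iff.1 h)).trans (Set.subset_union_left.trans (hAcl _))
      · exact le_rfl
    | limit δ hδ ih =>
      rcases hij.lt_or_eq with h | rfl
      · rw [hl δ hδ]
        exact Set.subset_biUnion_of_mem (u := X) (show i ∈ Set.Iio δ from h)
      · exact le_rfl
  have hmem : ∀ i, X i ∈ C := by
    intro i
    induction i using Ordinal.limitRecOn with
    | zero => rw [h0]; exact hcl _
    | add_one j ih => rw [hs]; exact hcl _
    | limit δ hδ ih =>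
      rw [hl δ hδ, ← Set.sUnion_image]
      refine hC.chain _ ?_ ?_ ?_
      · rintro _ ⟨j, hj, rfl⟩
        exact ih j hj
      · exact ⟨X 0, 0, hδ.bot_lt, rfl⟩
      · rintro _ ⟨a, _, rfl⟩ _ ⟨b, _, rfl⟩ _
        exact (le_total a b).imp (fun h => hmono h) (fun h => hmono h)
  have h0κ : #(X 0) = κ := by
    rw [h0]
    refine le_antisymm ?_ ?_
    · refine (hcard _).trans ?_
      calc #(A₀ ∪ B : Set G) + κ ≤ (κ + κ) + κ := by
            gcongr
            refine (Cardinal.mk_union_le _ _).trans ?_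
            rw [hBκ]
            gcongr
        _ = κ := by rw [Cardinal.add_eq_self hκ, Cardinal.add_eq_self hκ]
    · rw [← hBκ]
      exact Cardinal.mk_le_mk_of_subset (Set.subset_union_right.trans (hAcl _))
  have hge : ∀ i, κ ≤ #(X i) := fun i =>
    h0κ.symm.le.trans (Cardinal.mk_le_mk_of_subset (hmono (zero_le (a := i))))
  have hsucc : ∀ i, #(X (i + 1)) = #(X i) := by
    intro i
    refine le_antisymm ?_ (Cardinal.mk_le_mk_of_subset (hmono (le_self_add (a := i))))
    rw [hs]
    refine (hcard _).trans ?_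
    have h1 : #(X i ∪ {g i} : Set G) ≤ #(X i) + #(X i) := by
      refine (Cardinal.mk_union_le _ _).trans ?_
      gcongr
      rw [Cardinal.mk_singleton]
      exact Cardinal.one_le_aleph0.trans (hκ.trans (hge i))
    calc #(X i ∪ {g i} : Set G) + κ ≤ (#(X i) + #(X i)) + #(X i) := by gcongr; exact hge i
      _ = #(X i) := by
        rw [Cardinal.add_eq_self (hκ.trans (hge i)), Cardinal.add_eq_self (hκ.trans (hge i))]
  have hle : ∀ i, #(X i) ≤ κ + i.card := by
    intro i
    induction i using Ordinal.limitRecOn with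
    | zero => rw [h0κ]; exact le_self_add
    | add_one j ih =>
      rw [hsucc]
      refine ih.trans ?_
      gcongr
      exact le_self_add
    | limit δ hδ ih =>
      rw [hl δ hδ]
      refine mk_iUnion_Iio_le (hκ.trans le_self_add) le_add_self fun i hi => (ih i hi).trans ?_
      gcongr
  refine ⟨X, ?_, h0κ, hmono, hmem, hge, ?_, ?_, hsucc, hl, ?_⟩
  · rw [h0]; exact Set.subset_union_left.trans (hAcl _)
  · intro i hi
    exact (hle i).trans_lt (Cardinal.add_lt_of_lt hlam0 hlam (Cardinal.lt_ord.1 hi))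
  · intro i hi
    -- `X i` contains the distinct elements `g j` for `j < i`. The bound on `i.card` obtained here
    -- later limits the number of models united at a limit stage.
    have hlt : ∀ j : i.ToType, (Ordinal.ToType.mk.symm j).1 < i := fun j =>
      (Ordinal.ToType.mk.symm j).2
    have hmemX : ∀ j < i, g j ∈ X i := by
      intro j hj
      have : g j ∈ X (j + 1) := by rw [hs]; exact hAcl _ (Or.inr rfl)
      exact hmono (Order.add_one_le_of_lt hj) this
    rw [← Cardinal.mk_toType]
    refine Cardinal.mk_le_of_injective
      (f := fun j : i.ToType => (⟨g (Ordinal.ToType.mk.symm j).1, hmemX _ (hlt j)⟩ : X i)) ?_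
    intro a b hab
    have hab' : g (Ordinal.ToType.mk.symm a).1 = g (Ordinal.ToType.mk.symm b).1 :=
      congrArg Subtype.val hab
    simp only [g, (hlt a).trans_le hi, (hlt b).trans_le hi, dite_true] at hab'
    have h1 := Ordinal.ToType.mk.injective (e.injective hab')
    exact Ordinal.ToType.mk.symm.injective (Subtype.ext (Subtype.mk.inj h1))
  · rw [hl _ (Cardinal.isSuccLimit_ord hlam0)]
    refine Set.eq_univ_of_forall fun x => ?_
    obtain ⟨i, hi, rfl⟩ := hg x
    simp only [Set.mem_iUnion, Set.mem_Iio]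
    refine ⟨i + 1, (Cardinal.isSuccLimit_ord hlam0).add_one_lt hi, ?_⟩
    rw [hs]
    exact hAcl _ (Or.inr rfl)

end SetClub

/-! ### Clubs from Löwenheim–Skolem and from definability. -/

namespace AEC

open FirstOrder.Language

variable {L : FirstOrder.Language.{u, u}} {K : AEC L}

/-- The strong submodels of a model form a club. -/
theorem setClub_strong {N : Type u} [L.Structure N] (hN : K.Mem N) :
    SetClub K.LS {X : Set N | ∃ T : L.Substructure N, K.Strong T ∧ (T : Set N) = X} := by
  constructor
  · intro A
    obtain ⟨S, hS, hAS, hc⟩ := K.exists_strong hN A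
    exact ⟨S, ⟨S, hS, rfl⟩, hAS, hc⟩
  · intro c hc hne hch
    have hD : DirectedOn (· ≤ ·) {T : L.Substructure N | K.Strong T ∧ (T : Set N) ∈ c} := by
      rintro S ⟨hS, hSc⟩ T ⟨hT, hTc⟩
      rcases hch.total hSc hTc with h | h
      · exact ⟨T, ⟨hT, hTc⟩, h, le_rfl⟩
      · exact ⟨S, ⟨hS, hSc⟩, le_rfl, h⟩
    have hne' : {T : L.Substructure N | K.Strong T ∧ (T : Set N) ∈ c}.Nonempty := by
      obtain ⟨X, hX⟩ := hne
      obtain ⟨T, hT, rfl⟩ := hc hX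
      exact ⟨T, hT, hX⟩
    have hcoe : ((sSup {T : L.Substructure N | K.Strong T ∧ (T : Set N) ∈ c} :
        L.Substructure N) : Set N) = ⋃₀ c := by
      ext x
      rw [SetLike.mem_coe, Substructure.mem_sSup_of_directedOn hne' hD]
      constructor
      · rintro ⟨T, ⟨_, hTc⟩, hx⟩
        exact ⟨T, hTc, hx⟩
      · rintro ⟨X, hX, hx⟩
        obtain ⟨T, hT, rfl⟩ := hc hX
        exact ⟨T, ⟨hT, hX⟩, hx⟩
    refine ⟨_, strong_of_chain_below hN (c := {T : L.Substructure N | K.Strong T ∧ (T : Set N) ∈ c})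
      ?_ hne' (fun S hS => hS.1) ?_, hcoe⟩
    · rintro S ⟨hS, hSc⟩ T ⟨hT, hTc⟩ _
      exact hch.total hSc hTc
    · ext x
      rw [SetLike.mem_coe, Substructure.mem_sSup_of_directedOn hne' hD]
      simp only [Set.mem_iUnion, SetLike.mem_coe, exists_prop]

end AEC

namespace WeakForking

variable {L : FirstOrder.Language.{u, u}} {K : AEC L} {W : WeakForking K}

/-- Definability with `A = Set.univ`, so that every subset of `N` is admitted. The sets closed under
the given functions form a club; whether `X` and `B ∩ X` are bases is left to be checked for each
`X`. -/
theorem exists_setClub_indep (hκ : W.κ ≤ K.LS) (N : K.Model) (B : Set N) :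
    ∃ C : Set (Set N), SetClub K.LS C ∧ ∀ X ∈ C, K.Ab N X → K.Ab N (B ∩ X) →
      W.Indep N X (B ∩ X) B := by
  obtain ⟨ι, ar, F, hι, h⟩ := W.definability N Set.univ B
  refine ⟨_, SetClub.closed K.aleph0_le_LS (hι.trans hκ) ar F, fun X hX hA hB => ?_⟩
  exact h X (by simp) hX hA hB

end WeakForking

/-! ### Consequences of goodness: amalgamation, symmetry along a rank, boundaries as bases. -/

namespace WeakForking

open FirstOrder.Language

variable {L : FirstOrder.Language.{u, u}} {K : AEC L} {W : WeakForking K} {N N' : K.Model}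
  {μ : Cardinal.{u}} {ρ : Finset ℕ → Finset ℕ → Prop} {s : Finset ℕ}
  {S : Finset ℕ → L.Substructure N}

theorem indep_univ_of_strong {T : L.Substructure N} (hT : K.Strong T) (hab : K.Ab N (T : Set N)) :
    W.Indep N Set.univ (T : Set N) (T : Set N) := by
  have hr : Set.range T.subtype = (T : Set N) := by simp
  have := indep_univ_self (W := W) (N := N) (M₀ := N.sub T hT) (isKEmb_subtype hT)
    (by rw [hr]; exact hab)
  rwa [hr] at this

theorem indep_self {T : L.Substructure N} (hT : K.Strong T) (hab : K.Ab N (T : Set N))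
    (B : Set N) : W.Indep N (T : Set N) (T : Set N) B :=
  ((indep_univ_of_strong hT hab).symm hab).mono_right hab
    (fun _ _ => Or.inl trivial)

theorem _root_.AEC.IsSystem.ssubsets (h : K.IsSystem μ N s.powerset S) {t : Finset ℕ} (ht : t ⊆ s)
    (hne : t.Nonempty) : K.IsSystem μ N t.ssubsets S := by
  have hmem : ∀ w ∈ t.ssubsets, w ∈ s.powerset := fun w hw =>
    Finset.mem_powerset.2 ((Finset.mem_ssubsets.1 hw).subset.trans ht)
  exact ⟨⟨∅, Finset.mem_ssubsets.2 (Finset.empty_ssubset.2 hne)⟩,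
    fun a ha b hb => Finset.mem_ssubsets.2 (lt_of_le_of_lt hb (Finset.mem_ssubsets.1 ha)),
    fun w hw => h.strong w (hmem w hw), fun w hw v hv => h.mono w (hmem w hw) v (hmem v hv),
    fun w hw v hv => h.inter w (hmem w hw) v (hmem v hv), fun w hw => h.card w (hmem w hw)⟩

-- The stability of a pair `T ≺ N` is vacuous, because `1` has no nonempty proper subset. Dimension
-- `1` therefore speaks of arbitrary pairs of models.
open Classical in
theorem isStable_range_one {T : L.Substructure N} (hT : K.Strong T) (hc : #T = μ) (hN : #N = μ) :
    W.IsStable μ (Finset.range 1) N (fun w => if w = ∅ then T else ⊤) := by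
  have hw : ∀ w ∈ (Finset.range 1).powerset, w = ∅ ∨ w = {0} := by
    intro w hw
    exact Finset.subset_singleton_iff.1 (Finset.mem_powerset.1 hw)
  have hno : ∀ t, t ⊂ Finset.range 1 → ¬ t.Nonempty := by
    intro t ht hne
    rcases hw t (Finset.mem_powerset.2 ht.subset) with rfl | rfl
    · simp at hne
    · exact ht.ne rfl
  refine isStable_iff.2 ⟨⟨⟨⟨∅, by simp⟩, ?_, ?_, ?_, ?_, ?_⟩, fun t ht hne => (hno t ht hne).elim,
    fun t ht hne => (hno t ht hne).elim⟩, by simp⟩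
  · intro t ht v hv
    exact Finset.mem_powerset.2 (hv.trans (Finset.mem_powerset.1 ht))
  · intro v hv
    split_ifs
    · exact hT
    · exact K.strong_top N.mem
  · intro v hv t ht hvt
    rcases hw v hv with rfl | rfl
    · rw [if_pos rfl]
      split_ifs <;> simp
    · rcases hw t ht with rfl | rfl
      · simp at hvt
      · simp
  · intro v hv t ht
    rcases hw v hv with rfl | rfl <;> rcases hw t ht with rfl | rfl <;> simp
  · intro v hv
    split_ifs
    · exact hc
    · rw [← hN]
      exact Cardinal.mk_congr (Substructure.topEquiv (L := L) (M := N)).toEquiv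

/-- In dimension `1` the boundary is one model. Weak uniqueness is applied to the isomorphism
between the two images of `M₀`. -/
theorem HasWeakUniqueness.AP (h : W.HasWeakUniqueness μ 1) : K.AP μ := by
  classical
  intro M₀ M₁ M₂ h₀ h₁ h₂ e₁ e₂ he₁ he₂
  have hc₁ : #(e₁.toHom.range) = μ := (Cardinal.mk_congr e₁.equivRange.toEquiv).symm.trans h₀
  have hc₂ : #(e₂.toHom.range) = μ := (Cardinal.mk_congr e₂.equivRange.toEquiv).symm.trans h₀
  have hw : ∀ w, w ⊂ Finset.range 1 → w = ∅ := fun w hw =>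
    Finset.ssubset_singleton_iff.1 hw
  have hF₀ : ∀ (A : L.Substructure M₁) (B : L.Substructure M₂), A = e₁.toHom.range →
      B = e₂.toHom.range → ∃ F : A ≃[L] B, ∀ (x : M₀) (y : A), e₁ x = (y : M₁) →
        (F y : M₂) = e₂ x := by
    rintro _ _ rfl rfl
    refine ⟨e₂.equivRange.comp e₁.equivRange.symm, fun x y hxy => ?_⟩
    have : y = e₁.equivRange x := Subtype.ext hxy.symm
    subst this
    simp
  have hf : ∀ w, w ⊂ Finset.range 1 → ∃ F : (if w = ∅ then e₁.toHom.range else ⊤ :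
      L.Substructure M₁) ≃[L] (if w = ∅ then e₂.toHom.range else ⊤ : L.Substructure M₂),
      ∀ (x : M₀) (y : (if w = ∅ then e₁.toHom.range else ⊤ : L.Substructure M₁)),
        e₁ x = (y : M₁) → (F y : M₂) = e₂ x := by
    intro w hw'
    obtain rfl := hw w hw'
    exact hF₀ _ _ (if_pos rfl) (if_pos rfl)
  choose F hF using hf
  obtain ⟨M, g, g', hM, hg, hg', hgg⟩ := h M₁ M₂ _ _ (isStable_range_one he₁.2 hc₁ h₁)
    (isStable_range_one he₂.2 hc₂ h₂) F (by
      intro v t hv ht hvt x y hxy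
      obtain rfl := hw v hv
      obtain rfl := hw t ht
      have : x = y := Subtype.ext hxy
      rw [this])
  refine ⟨M, g, g', hM, hg, hg', fun x => ?_⟩
  have hx : e₁ x ∈ (if (∅ : Finset ℕ) = ∅ then e₁.toHom.range else ⊤ : L.Substructure M₁) := by
    simp
  have := hgg ∅ (by simp) ⟨e₁ x, hx⟩
  rw [hF ∅ (by simp) x ⟨e₁ x, hx⟩ rfl] at this
  exact this

/-- An injective rank function on finite sets that is increasing for `⊂`. -/
structure IsRank (r : Finset ℕ → ℕ) : Prop where
  inj : Function.Injective r
  lt : ∀ {t w}, t ⊂ w → r t < r w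

theorem IsRank.not_subset {r : Finset ℕ → ℕ} (hr : IsRank r) {t w : Finset ℕ} (h : r w < r t) :
    ¬ t ⊆ w := by
  intro htw
  rcases eq_or_ssubset_of_subset htw with rfl | h'
  · exact h.ne rfl
  · exact (hr.lt h').not_gt h

/-- Finite sets are read as binary numbers. -/
theorem exists_isRank : ∃ r, IsRank r :=
  ⟨fun t => ∑ i ∈ t, 2 ^ i, Finset.geomSum_injective le_rfl, fun {t w} h => by
    obtain ⟨i, hi, hit⟩ := Finset.exists_of_ssubset h
    exact Finset.sum_lt_sum_of_subset h.subset hi hit (by positivity) (by simp)⟩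

/-- Sorting the proper subsets of `range n` by `r` gives an enumeration as in the symmetry property.
Ranks are more convenient than enumerations because one rank serves all faces of a system. -/
theorem HasSymmetry.stable_of_rank {n : ℕ} (h : W.HasSymmetry μ n) {r : Finset ℕ → ℕ}
    (hr : IsRank r) (H : W.StableWrt (fun t w => r w < r t) μ (Finset.range n) N S)
    (htop : S (Finset.range n) = ⊤) : W.IsStable μ (Finset.range n) N S := by
  classical
  refine h N S ⟨H.sys, htop⟩ ?_
  have hcard : ((Finset.range n).ssubsets.image r).card = 2 ^ n - 1 := by
    rw [Finset.card_image_of_injective _ hr.inj]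
    simp [Finset.ssubsets, Finset.card_erase_of_mem, Finset.card_powerset]
  let o := ((Finset.range n).ssubsets.image r).orderEmbOfFin hcard
  have ho : ∀ j, ∃ t, t ⊂ Finset.range n ∧ r t = o j := by
    intro j
    have h1 : o j ∈ (Finset.range n).ssubsets.image r := Finset.orderEmbOfFin_mem _ hcard j
    obtain ⟨t, ht, hrt⟩ := Finset.mem_image.1 h1
    exact ⟨t, Finset.mem_ssubsets.1 ht, hrt⟩
  choose e he hre using ho
  have hlt : ∀ i j, r (e i) < r (e j) ↔ i < j := by
    intro i j
    rw [hre, hre]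
    exact o.lt_iff_lt
  have hrange : Set.range e = {t | t ⊂ Finset.range n} := by
    ext t
    constructor
    · rintro ⟨i, rfl⟩
      exact he i
    · intro ht
      have : r t ∈ Set.range o := by
        rw [Finset.range_orderEmbOfFin]
        simp only [Finset.coe_image, Set.mem_image, Finset.mem_coe, Finset.mem_ssubsets]
        exact ⟨t, ht, rfl⟩
      obtain ⟨i, hi⟩ := this
      exact ⟨i, hr.inj ((hre i).trans hi)⟩
  refine ⟨e, fun i j hij => ?_, hrange, fun i j hij => (hlt i j).1 (hr.lt hij), fun j hj => ?_⟩
  · apply o.injective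
    rw [← hre, ← hre, hij]
  · refine ⟨H.base _ (he j) hj, ?_⟩
    refine (H.indep _ (he j) hj).mono_right (H.base _ (he j) hj).ab_bdry ?_
    rintro x ⟨i, hi, hx⟩
    exact Or.inl ⟨e i, he i, (hlt i j).2 hi, hx⟩

theorem HasSymmetry.stableIn_of_rank (h : ∀ n, 1 ≤ n → W.HasSymmetry μ n) {r : Finset ℕ → ℕ}
    (hr : IsRank r) (H : W.StableWrt (fun t w => r w < r t) μ s N S) : W.StableIn μ s N S := by
  rcases s.eq_empty_or_nonempty with rfl | hne
  · exact ⟨H.sys, fun t ht => (Finset.not_ssubset_empty t ht).elim,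
      fun t ht => (Finset.not_ssubset_empty t ht).elim⟩
  · obtain ⟨σ, hσ⟩ := exists_embedding_map_range s
    generalize s.card = n at hσ
    subst hσ
    have hn : 1 ≤ n := by
      rcases Nat.eq_zero_or_pos n with rfl | hn
      · simp at hne
      · exact hn
    have hr' : IsRank fun t => r (t.map σ) :=
      ⟨fun a b hab => Finset.map_injective σ (hr.inj hab), fun h => hr.lt ((ssubset_map_iff σ).2 h)⟩
    have H1 := (stableWrt_reindex_iff σ).2 H
    have H2 := isStable_iff.1 ((h n hn).stable_of_rank hr' H1.comap (by ext x; simp))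
    refine (stableIn_reindex_iff σ).1 ?_
    exact (stableWrt_map_iff (isKEmb_subtype (H1.strong subset_rfl)) fun w hw =>
      (map_subtype_comap (H1.mono hw subset_rfl)).symm).2 H2.1

section Family

variable {n : ℕ} {Q : K.Model} {T : Finset ℕ → L.Substructure Q}

/-- The open system formed by submodels of a model `Q`. -/
noncomputable def OpenSystem.ofFamily (hT : ∀ s, s ⊂ Finset.range n → W.StableIn μ s Q T) :
    OpenSystem K μ n where
  M s := Q.sub (T s.1) ((hT s.1 s.2).strong subset_rfl)
  e {s t} h := Substructure.inclusion ((hT t.1 t.2).mono h subset_rfl)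
  isKEmb {s t} h := isKEmb_inclusion _ ((hT s.1 s.2).strong subset_rfl)
    ((hT t.1 t.2).strong subset_rfl)
  refl _ _ := rfl
  comp _ _ _ := rfl
  inter {q r s t} hq hr hs hqrs := by
    have := (hT t.1 t.2).inter (t := r.1) (w := s.1) hr hs
    rw [← hqrs] at this
    have hx : ∀ (v : Finset ℕ) (hv : T v ≤ T t.1) (x : T t.1),
        x ∈ Set.range (Substructure.inclusion hv) ↔ x.1 ∈ T v := by
      intro v hv x
      constructor
      · rintro ⟨y, rfl⟩
        exact y.2
      · intro hx
        exact ⟨⟨x, hx⟩, rfl⟩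
    ext x
    exact (hx _ _ x).trans ((by rw [this]; rfl : x.1 ∈ T q.1 ↔ x.1 ∈ T r.1 ∧ x.1 ∈ T s.1).trans
      (and_congr (hx _ _ x) (hx _ _ x)).symm)
  card s := (hT s.1 s.2).card subset_rfl

theorem OpenSystem.isStable_face_ofFamily
    (hT : ∀ s, s ⊂ Finset.range n → W.StableIn μ s Q T) (s : {s : Finset ℕ // s ⊂ Finset.range n}) :
    W.IsStable μ s.1 ((OpenSystem.ofFamily hT).M s) ((OpenSystem.ofFamily hT).face s) := by
  have hface : ∀ t, t ⊆ s.1 → (OpenSystem.ofFamily hT).face s t =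
      (T t).comap (T s.1).subtype.toHom := by
    intro t ht
    rw [OpenSystem.face, dif_pos ht]
    ext x
    constructor
    · rintro ⟨y, rfl⟩
      exact y.2
    · intro hx
      exact ⟨⟨x.1, hx⟩, rfl⟩
  have h := (hT s.1 s.2).isStable_comap
  rw [isStable_iff] at h ⊢
  exact ⟨(stableWrt_congr hface).2 h.1, (hface _ subset_rfl).trans h.2⟩

/-- Existence for a family of submodels of one model. -/
theorem HasExistence.exists_of_family (h : W.HasExistence μ n)
    (hT : ∀ s, s ⊂ Finset.range n → W.StableIn μ s Q T) :
    ∃ (P : K.Model) (S : Finset ℕ → L.Substructure P)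
      (f : ∀ s, s ⊂ Finset.range n → (T s ↪[L] P)),
      W.IsStable μ (Finset.range n) P S ∧ (∀ s hs, K.IsKEmb (f s hs)) ∧
      (∀ s hs, (f s hs).toHom.range = S s) ∧
      ∀ s t hs ht, s ⊆ t → ∀ (x : T s) (y : T t), (x : Q) = y → f s hs x = f t ht y := by
  obtain ⟨P, S, f, hS, hf, hr, hc⟩ := h (OpenSystem.ofFamily hT)
    (OpenSystem.isStable_face_ofFamily hT)
  refine ⟨P, S, fun s hs => f ⟨s, hs⟩, hS, fun s hs => hf ⟨s, hs⟩, fun s hs => hr ⟨s, hs⟩, ?_⟩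
  intro s t hs ht hst x y hxy
  have := hc (s := ⟨s, hs⟩) (t := ⟨t, ht⟩) hst x
  exact this.symm.trans (congrArg (f ⟨t, ht⟩) (Subtype.ext hxy))

/-- A stable `𝒫(n)`-system, prolonged by `S (w ∪ {n}) = S w`. -/
theorem stableIn_erase (hμ : K.LS ≤ μ) (hAP : K.AP μ) (H : W.StableIn μ (Finset.range n) N S)
    {s : Finset ℕ} (hs : s ⊂ Finset.range (n + 1)) : W.StableIn μ s N (fun w => S (w.erase n)) := by
  have hsub : ∀ w, w ⊆ s → w.erase n ⊆ Finset.range n := by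
    intro w hw i hi
    have h1 := Finset.mem_erase.1 hi
    have := Finset.mem_range.1 (hs.subset (hw h1.2))
    exact Finset.mem_range.2 (by omega)
  have hsys : K.IsSystem μ N s.powerset (fun w => S (w.erase n)) := by
    refine ⟨⟨∅, by simp⟩, fun t ht v hv => Finset.mem_powerset.2 (hv.trans (Finset.mem_powerset.1 ht)),
      fun w hw => ?_, fun w hw v hv hwv => ?_, fun w hw v hv => ?_, fun w hw => ?_⟩
    · exact H.strong (hsub w (Finset.mem_powerset.1 hw))
    · exact H.mono (Finset.erase_subset_erase _ hwv) (hsub v (Finset.mem_powerset.1 hv))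
    · have : (w ∩ v).erase n = w.erase n ∩ v.erase n := by
        ext i; simp only [Finset.mem_erase, Finset.mem_inter]; tauto
      rw [this]
      exact H.inter (hsub w (Finset.mem_powerset.1 hw)) (hsub v (Finset.mem_powerset.1 hv))
    · exact H.card (hsub w (Finset.mem_powerset.1 hw))
  have hlt : ∀ t, t ⊂ s → n ∉ t → t ⊂ Finset.range n := by
    intro t ht hnt
    have h1 : t ⊆ Finset.range n := by
      have := hsub t ht.subset
      rwa [Finset.erase_eq_of_notMem hnt] at this
    refine Finset.ssubset_iff_subset_ne.2 ⟨h1, ?_⟩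
    rintro rfl
    have h2 := Finset.card_lt_card ht
    have h3 := Finset.card_lt_card hs
    simp only [Finset.card_range] at h2 h3
    omega
  have herase : ∀ t, n ∉ t → ∀ w, w ⊆ t → S (w.erase n) = S w := by
    intro t ht w hw
    rw [Finset.erase_eq_of_notMem fun h => ht (hw h)]
  have hbase : ∀ t, t ⊂ s → t.Nonempty →
      K.IsAmalgBase μ N t.ssubsets (fun w => S (w.erase n)) := by
    intro t ht hne
    -- If `n ∈ t`, the boundary of `t` is the single model `S (t.erase n)`, which is a base by
    -- amalgamation. This is also the model at `t`, so the independence over it will be trivial.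
    by_cases hnt : n ∈ t
    · refine isAmalgBase_of_AP hμ hAP (hsys.ssubsets ht.subset hne) (q := t.erase n)
        (Finset.mem_ssubsets.2 (Finset.erase_ssubset hnt)) fun w hw => ?_
      have hwt := (Finset.mem_ssubsets.1 hw).subset
      exact H.mono (by rw [Finset.erase_idem]; exact Finset.erase_subset_erase _ hwt)
        (hsub _ ((Finset.erase_subset _ _).trans ht.subset))
    · exact (isAmalgBase_congr fun w hw => herase t hnt w (Finset.mem_ssubsets.1 hw).subset).2
        (H.base t (hlt t ht hnt) hne)
  refine ⟨hsys, hbase, fun t ht hne => ?_⟩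
  by_cases hnt : n ∈ t
  · have hb : bdry (fun w => S (w.erase n)) t = (S (t.erase n) : Set N) := by
      ext x
      rw [mem_bdry]
      constructor
      · rintro ⟨w, hw, hx⟩
        exact H.mono (Finset.erase_subset_erase _ hw.subset) (hsub _ ht.subset) hx
      · intro hx
        exact ⟨t.erase n, Finset.erase_ssubset hnt, by
          rw [Finset.erase_idem]; exact hx⟩
    rw [hb]
    have hstr : K.Strong (S (t.erase n)) := H.strong (hsub _ ht.subset)
    exact indep_self hstr (ab_of_strong hμ hAP hstr (H.card (hsub _ ht.subset))) _
  · have hb : bdry (fun w => S (w.erase n)) t = bdry S t := by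
      ext x
      simp only [mem_bdry]
      refine exists_congr fun w => and_congr_right fun hw => ?_
      rw [herase t hnt w hw.subset]
    rw [hb, herase t hnt t subset_rfl]
    refine (H.indep t (hlt t ht hnt) hne).mono_right (H.base t (hlt t ht hnt) hne).ab_bdry ?_
    rintro x ⟨w, hw, htw, hx⟩
    have h1 : ¬ t ⊆ w.erase n := fun h => htw (h.trans (Finset.erase_subset _ _))
    refine Or.inl ⟨w.erase n, Finset.ssubset_iff_subset_ne.2 ⟨hsub w hw.subset, ?_⟩, h1, hx⟩
    intro h
    exact h1 (h ▸ (hlt t ht hnt).subset)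

/-- Existence in dimension `n + 1` is applied to the system prolonged trivially in the direction
`n`. In the resulting stable system `range n` is a proper face, so its boundary is a base by the
definition of stability; and this boundary is a copy of the boundary of `S`. -/
theorem HasExistence.isAmalgBase_range (h : W.HasExistence μ (n + 1)) (hn : 1 ≤ n) (hμ : K.LS ≤ μ)
    (hAP : K.AP μ) (H : W.StableIn μ (Finset.range n) N S) :
    K.IsAmalgBase μ N (Finset.range n).ssubsets S := by
  obtain ⟨P, S', f, hS', hf, hr, hc⟩ := h.exists_of_family (Q := N)
    (T := fun w => S (w.erase n)) fun s hs => stableIn_erase hμ hAP H hs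
  have hn' : Finset.range n ⊂ Finset.range (n + 1) := by
    rw [Finset.range_add_one]
    exact Finset.ssubset_insert Finset.notMem_range_self
  have hb := hS'.base (Finset.range n) hn' (Finset.nonempty_range_iff.2 (by omega))
  have hstr : K.Strong (S ((Finset.range n).erase n)) :=
    (stableIn_erase hμ hAP H hn').strong subset_rfl
  have hle : ∀ w, w ⊂ Finset.range n → S (w.erase n) ≤ S ((Finset.range n).erase n) := fun w hw =>
    (stableIn_erase hμ hAP H hn').mono hw.subset subset_rfl
  have h1 : K.IsAmalgBase μ (N.sub _ hstr) (Finset.range n).ssubsets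
      (fun w => (S (w.erase n)).comap (S ((Finset.range n).erase n)).subtype.toHom) := by
    refine (isAmalgBase_map_iff (hf _ hn') fun w hw => ?_).1 hb
    have hw' := Finset.mem_ssubsets.1 hw
    rw [← hr w (hw'.trans hn')]
    ext x
    constructor
    · rintro ⟨y, rfl⟩
      refine ⟨⟨y, hle w hw' y.2⟩, y.2, ?_⟩
      exact (hc w _ (hw'.trans hn') hn' hw'.subset y _ rfl).symm
    · rintro ⟨y, hy, rfl⟩
      exact ⟨⟨y.1, hy⟩, hc w _ (hw'.trans hn') hn' hw'.subset ⟨y.1, hy⟩ y rfl⟩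
  have h2 := (isAmalgBase_map_iff (isKEmb_subtype hstr) fun w hw =>
    (map_subtype_comap (hle w (Finset.mem_ssubsets.1 hw))).symm).2 h1
  refine (isAmalgBase_congr fun w hw => ?_).1 h2
  rw [Finset.erase_eq_of_notMem]
  intro hw'
  exact Finset.notMem_range_self ((Finset.mem_ssubsets.1 hw).subset hw')

end Family

/-- The boundary of each stable system in cardinality `μ` is an amalgamation base. -/
def BoundariesAmalgamate (W : WeakForking K) (μ : Cardinal.{u}) : Prop :=
  ∀ (N : K.Model) (s : Finset ℕ) (S : Finset ℕ → L.Substructure N), s.Nonempty →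
    W.StableIn μ s N S → K.IsAmalgBase μ N s.ssubsets S

theorem boundariesAmalgamate_of_range
    (h : ∀ (n : ℕ) (N : K.Model) (S : Finset ℕ → L.Substructure N), 1 ≤ n →
      W.StableIn μ (Finset.range n) N S → K.IsAmalgBase μ N (Finset.range n).ssubsets S) :
    W.BoundariesAmalgamate μ := by
  intro N s S hne H
  obtain ⟨σ, hσ⟩ := exists_embedding_map_range s
  generalize s.card = n at hσ
  subst hσ
  have hn : 1 ≤ n := by
    rcases Nat.eq_zero_or_pos n with rfl | hn
    · simp at hne
    · exact hn
  exact (isAmalgBase_ssubsets_reindex_iff σ).1 (h n N _ hn ((stableIn_reindex_iff σ).2 H))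

/-- The consequences of goodness in `μ` that are used below `μ⁺`. -/
structure GoodAt (W : WeakForking K) (μ : Cardinal.{u}) : Prop where
  le : K.LS ≤ μ
  good : ∀ n, 1 ≤ n → W.IsGood μ n

namespace GoodAt

theorem AP (h : W.GoodAt μ) : K.AP μ := (h.good 1 le_rfl).2.2.AP

theorem stableIn (h : W.GoodAt μ) {r : Finset ℕ → ℕ}
    (hr : IsRank r) (H : W.StableWrt (fun t w => r w < r t) μ s N S) : W.StableIn μ s N S :=
  HasSymmetry.stableIn_of_rank (fun n hn => (h.good n hn).1) hr H

theorem boundaries (h : W.GoodAt μ) : W.BoundariesAmalgamate μ :=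
  boundariesAmalgamate_of_range fun n _ _ hn H =>
    (h.good (n + 1) (by omega)).2.1.isAmalgBase_range hn h.le h.AP H

theorem existence (h : W.GoodAt μ) {n : ℕ} (hn : 1 ≤ n) : W.HasExistence μ n := (h.good n hn).2.1

theorem weakUniqueness (h : W.GoodAt μ) {n : ℕ} (hn : 1 ≤ n) : W.HasWeakUniqueness μ n :=
  (h.good n hn).2.2

theorem ab_of_strong (h : W.GoodAt μ) {T : L.Substructure N} (hT : K.Strong T) (hc : #T = μ) :
    K.Ab N (T : Set N) := AEC.ab_of_strong h.le h.AP hT hc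

end GoodAt

end WeakForking

/-! ### Adapted sets and the systems of their traces. -/

namespace WeakForking

open FirstOrder.Language

variable {L : FirstOrder.Language.{u, u}} {K : AEC L} {W : WeakForking K} {N N' : K.Model}
  {μ lam : Cardinal.{u}} {s : Finset ℕ} {S : Finset ℕ → L.Substructure N} {X Y : Set N}

/-- The trace of a system on the substructure generated by `X`. -/
def res (S : Finset ℕ → L.Substructure N) (X : Set N) (t : Finset ℕ) : L.Substructure N :=
  Substructure.closure L X ⊓ S t

/-- `X` is the universe of a strong submodel, meets each model of the system `S` in a strong
submodel of the same cardinality, and is independent from the boundaries of the system. -/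
structure Adapted (W : WeakForking K) (s : Finset ℕ) (N : K.Model)
    (S : Finset ℕ → L.Substructure N) (X : Set N) : Prop where
  coe : (Substructure.closure L X : Set N) = X
  strong : ∀ t, t ⊆ s → K.Strong (res S X t)
  card : ∀ t, t ⊆ s → #(res S X t) = #X
  indep_bdry : ∀ q, q ⊆ s → W.GoodAt #X → K.IsAmalgBase #X N q.ssubsets (res S X) →
    W.Indep N (res S X q) (bdry (res S X) q) (bdry S q)

theorem res_le (t : Finset ℕ) : res S X t ≤ S t := inf_le_right

theorem Adapted.mem_res (h : W.Adapted s N S X) {t : Finset ℕ} {x : N} :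
    x ∈ res S X t ↔ x ∈ X ∧ x ∈ S t := by
  rw [res, Substructure.mem_inf, ← SetLike.mem_coe, h.coe]

theorem mem_closure_image_subtype {T : L.Substructure N} {T' : L.Substructure T} {X : Set N}
    (h : (T' : Set T) = Subtype.val ⁻¹' X) (x : N) :
    x ∈ T'.map T.subtype.toHom ↔ x ∈ X ∧ x ∈ T := by
  constructor
  · rintro ⟨y, hy, rfl⟩
    rw [h] at hy
    exact ⟨hy, y.2⟩
  · rintro ⟨hx, hxT⟩
    refine ⟨⟨x, hxT⟩, ?_, rfl⟩
    rw [h]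
    exact hx

/-- The sets adapted to a system contain a club. -/
theorem exists_setClub_adapted (hκ : W.κ ≤ K.LS) (hS : K.IsSystem lam N s.powerset S)
    (htop : S s = ⊤) :
    ∃ C : Set (Set N), SetClub K.LS C ∧ ∀ X ∈ C, W.Adapted s N S X := by
  classical
  have hLS := K.aleph0_le_LS
  have hN : #N = lam := by
    rw [← hS.card s (by simp), htop]
    exact (Cardinal.mk_congr (Substructure.topEquiv (L := L) (M := N)).toEquiv).symm
  have hstr : ∀ t : {t // t ∈ s.powerset}, K.Strong (S t.1) := fun t => hS.strong t.1 t.2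
  -- All models of the system have the size of `N`. A set closed under an injection of `N` into `S
  -- t` meets `S t` in as many points as it has itself.
  have hemb : ∀ t : {t // t ∈ s.powerset}, ∃ h : N → N, Function.Injective h ∧ ∀ x, h x ∈ S t.1 := by
    intro t
    obtain ⟨e⟩ := Cardinal.eq.1 (hN.trans (hS.card t.1 t.2).symm)
    exact ⟨fun x => (e x).1, fun x y hxy => e.injective (Subtype.ext hxy), fun x => (e x).2⟩
  choose h hinj hmem using hemb
  -- Definability is used inside each model `S t`, for its boundary.
  choose D hD hDind using fun t : {t // t ∈ s.powerset} =>
    exists_setClub_indep hκ (N.sub (S t.1) (hstr t)) (Subtype.val ⁻¹' bdry S t.1)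
  let C₁ : {t // t ∈ s.powerset} → Set (Set N) := fun t =>
    {X | (Subtype.val : S t.1 → N) ⁻¹' X ∈
      {X | ∃ T : L.Substructure (S t.1), K.Strong T ∧ (T : Set (S t.1)) = X} ∩ D t}
  let C₂ : {t // t ∈ s.powerset} → Set (Set N) := fun t => {X | ∀ x ∈ X, h t x ∈ X}
  have hC₁ : ∀ t, SetClub K.LS (C₁ t) := fun t =>
    ((setClub_strong (K.mem_of_strong _ (hstr t)).1).inter hLS (hD t)).comap
      Subtype.val_injective hLS
  have hC₂ : ∀ t, SetClub K.LS (C₂ t) := fun t => SetClub.closed_unary hLS (h t)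
  refine ⟨(⋂ t, C₁ t) ∩ ⋂ t, C₂ t, (SetClub.iInter hLS hC₁).inter hLS (SetClub.iInter hLS hC₂),
    fun X hX => ?_⟩
  have hX₁ : ∀ t, X ∈ C₁ t := fun t => Set.mem_iInter.1 hX.1 t
  have hX₂ : ∀ t, X ∈ C₂ t := fun t => Set.mem_iInter.1 hX.2 t
  choose T hT hTX using fun t => (hX₁ t).1
  have hcoe : (Substructure.closure L X : Set N) = X := by
    have : ((T ⟨s, by simp⟩).map (S s).subtype.toHom : Set N) = X := by
      ext x
      refine (mem_closure_image_subtype (hTX ⟨s, by simp⟩) x).trans ?_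
      rw [htop]
      simp
    rw [← this, Substructure.closure_eq]
  have hres : ∀ t : {t // t ∈ s.powerset}, res S X t.1 = (T t).map (S t.1).subtype.toHom := by
    intro t
    ext x
    rw [mem_closure_image_subtype (hTX t) x, res, Substructure.mem_inf, ← SetLike.mem_coe, hcoe]
  have hresmem : ∀ t x, x ∈ res S X t ↔ x ∈ X ∧ x ∈ S t := by
    intro t x
    rw [res, Substructure.mem_inf, ← SetLike.mem_coe, hcoe]
  have hcard : ∀ t, t ⊆ s → #(res S X t) = #X := by
    intro t ht
    refine le_antisymm ?_ ?_
    · exact Cardinal.mk_le_mk_of_subset fun x hx => ((hresmem t x).1 hx).1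
    · refine Cardinal.mk_le_of_injective
        (f := fun x : X => (⟨h ⟨t, Finset.mem_powerset.2 ht⟩ x, (hresmem t _).2
          ⟨hX₂ ⟨t, Finset.mem_powerset.2 ht⟩ x x.2, hmem ⟨t, Finset.mem_powerset.2 ht⟩ x⟩⟩ :
          res S X t)) ?_
      intro x y hxy
      exact Subtype.ext (hinj _ (congrArg Subtype.val hxy))
  refine ⟨hcoe, fun t ht => ?_, hcard, fun q hq hgood hbase => ?_⟩
  · rw [hres ⟨t, Finset.mem_powerset.2 ht⟩]
    exact (isKEmb_subtype (hstr _)).strong_map (hT _)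
  · have hq' := Finset.mem_powerset.2 hq
    have hk := isKEmb_subtype (hstr ⟨q, hq'⟩)
    have hTcard : #(T ⟨q, hq'⟩) = #X := by
      rw [← mk_map (S q).subtype, ← hres ⟨q, hq'⟩, hcard q hq]
    have hab := hgood.ab_of_strong (N := N.sub (S q) (hstr ⟨q, hq'⟩)) (hT ⟨q, hq'⟩) hTcard
    have hle : ∀ w ∈ q.ssubsets, res S X w ≤ S q := fun w hw =>
      (res_le w).trans (hS.mono w (Finset.mem_powerset.2
        ((Finset.mem_ssubsets.1 hw).subset.trans hq)) q hq' (Finset.mem_ssubsets.1 hw).subset)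
    have hbase' : K.IsAmalgBase #X (N.sub (S q) (hstr ⟨q, hq'⟩)) q.ssubsets
        (fun w => (res S X w).comap (S q).subtype.toHom) :=
      (isAmalgBase_map_iff hk fun w hw => (map_subtype_comap (hle w hw)).symm).1 hbase
    have hB : bdry (fun w => (res S X w).comap (S q).subtype.toHom) q =
        (Subtype.val ⁻¹' bdry S q) ∩ (Subtype.val ⁻¹' X : Set (S q)) := by
      ext x
      constructor
      · rintro ⟨w, hw, hx⟩
        exact ⟨⟨w, hw, ((hresmem w _).1 hx).2⟩, ((hresmem w _).1 hx).1⟩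
      · rintro ⟨⟨w, hw, hx⟩, hxX⟩
        exact ⟨w, hw, (hresmem w _).2 ⟨hxX, hx⟩⟩
    have hab' := hbase'.ab_bdry
    rw [hB] at hab'
    rw [hTX] at hab
    have hind := hDind ⟨q, hq'⟩ _ (hX₁ ⟨q, hq'⟩).2 hab hab'
    rw [← indep_map_iff hk hab'] at hind
    have e1 : (S q).subtype '' (Subtype.val ⁻¹' X) = (res S X q : Set N) := by
      ext x
      rw [SetLike.mem_coe, hresmem]
      constructor
      · rintro ⟨y, hy, rfl⟩
        exact ⟨hy, y.2⟩
      · rintro ⟨hx, hxq⟩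
        exact ⟨⟨x, hxq⟩, hx, rfl⟩
    have hbq : ∀ x ∈ bdry S q, x ∈ S q := by
      intro x hx
      obtain ⟨w, hw, hx⟩ := mem_bdry.1 hx
      exact hS.mono w (Finset.mem_powerset.2 (hw.subset.trans hq)) q hq' hw.subset hx
    have e2 : (S q).subtype '' (Subtype.val ⁻¹' bdry S q) = bdry S q := by
      ext x
      constructor
      · rintro ⟨y, hy, rfl⟩
        exact hy
      · intro hx
        exact ⟨⟨x, hbq x hx⟩, hx, rfl⟩
    have e3 : (S q).subtype '' ((Subtype.val ⁻¹' bdry S q) ∩ (Subtype.val ⁻¹' X)) =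
        bdry (res S X) q := by
      rw [← hB]
      exact (unionOf_map (N := N.sub (S q) (hstr ⟨q, hq'⟩)) (N' := N) (I := q.ssubsets)
        (S := fun w => (res S X w).comap (S q).subtype.toHom) (S' := res S X)
        (f := (S q).subtype) fun w hw => (map_subtype_comap (hle w hw)).symm).symm
    rwa [e1, e2, e3] at hind

namespace Adapted

variable {r : Finset ℕ → ℕ}

theorem isSystem (hX : W.Adapted s N S X) (hS : K.IsSystem lam N s.powerset S) :
    K.IsSystem #X N s.powerset (res S X) := by
  refine ⟨hS.nonempty, hS.down, fun t ht => hX.strong t (Finset.mem_powerset.1 ht),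
    fun w hw t ht hwt => inf_le_inf_left _ (hS.mono w hw t ht hwt), fun w hw t ht => ?_,
    fun t ht => hX.card t (Finset.mem_powerset.1 ht)⟩
  rw [res, hS.inter w hw t ht, res, res, inf_inf_distrib_left]

theorem bdry_res_subset (q : Finset ℕ) : bdry (res S X) q ⊆ bdry S q := by
  intro x hx
  obtain ⟨w, hw, hx⟩ := mem_bdry.1 hx
  exact mem_bdry.2 ⟨w, hw, res_le w hx⟩

/-- The trace of a model of the system is independent from the earlier models. -/
theorem indep_earlier (hX : W.Adapted s N S X) (hgood : W.GoodAt #X)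
    (H : W.StableWrt (fun t w => r w < r t) lam s N S) {q : Finset ℕ} (hq : q ⊆ s)
    (hne : q.Nonempty) (hbase : K.IsAmalgBase #X N q.ssubsets (res S X)) :
    W.Indep N (res S X q) (bdry (res S X) q) {x | ∃ w, w ⊂ s ∧ r w < r q ∧ x ∈ S w} := by
  have h1 := hX.indep_bdry q hq hgood hbase
  rcases eq_or_ssubset_of_subset hq with rfl | hqs
  · refine h1.mono_right hbase.ab_bdry ?_
    rintro x ⟨w, hw, -, hx⟩
    exact Or.inl (mem_bdry.2 ⟨w, hw, hx⟩)
  · have hb := (H.base q hqs hne).ab_bdry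
    -- Transitivity through `bdry S q`: adaptedness gives independence from `bdry S q`, and the
    -- hypothesis on `S` gives independence from the earlier models over it.
    refine h1.trans hbase.ab_bdry hb (bdry_res_subset q) ?_
    exact (H.indep q hqs hne).mono_left hb
      (Set.Subset.trans (res_le (S := S) (X := X) q) Set.subset_union_left)

/-- The trace of a system on an adapted set is stable. -/
theorem stableIn_res (hX : W.Adapted s N S X) (hgood : W.GoodAt #X) (hr : IsRank r)
    (H : W.StableWrt (fun t w => r w < r t) lam s N S) {t : Finset ℕ} (ht : t ⊆ s) :
    W.StableIn #X t N (res S X) := by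
  induction t using Finset.strongInduction with
  | H t ih =>
    -- The smaller faces are stable by the induction hypothesis, so their boundaries are bases; only
    -- then is the independence of the traces available.
    have hbase : ∀ q, q ⊂ t → q.Nonempty → K.IsAmalgBase #X N q.ssubsets (res S X) :=
      fun q hq hne => hgood.boundaries N q _ hne (ih q hq (hq.subset.trans ht))
    refine hgood.stableIn hr ⟨?_, hbase, fun q hq hne => ?_⟩
    · have := hX.isSystem H.sys
      have hmem : ∀ w ∈ t.powerset, w ∈ s.powerset := fun w hw =>
        Finset.mem_powerset.2 ((Finset.mem_powerset.1 hw).trans ht)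
      exact ⟨⟨∅, by simp⟩,
        fun _ ha _ hb => Finset.mem_powerset.2 (hb.trans (Finset.mem_powerset.1 ha)),
        fun w hw => this.strong w (hmem w hw),
        fun w hw v hv => this.mono w (hmem w hw) v (hmem v hv),
        fun w hw v hv => this.inter w (hmem w hw) v (hmem v hv),
        fun w hw => this.card w (hmem w hw)⟩
    · refine (hX.indep_earlier hgood H (hq.subset.trans ht) hne (hbase q hq hne)).mono_right
        (hbase q hq hne).ab_bdry ?_
      rintro x ⟨w, hw, hrw, hx⟩
      exact Or.inl ⟨w, hw.trans_subset ht, hrw, res_le w hx⟩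

theorem isAmalgBase_res (hX : W.Adapted s N S X) (hgood : W.GoodAt #X) (hr : IsRank r)
    (H : W.StableWrt (fun t w => r w < r t) lam s N S) {t : Finset ℕ} (ht : t ⊆ s)
    (hne : t.Nonempty) : K.IsAmalgBase #X N t.ssubsets (res S X) :=
  hgood.boundaries N t _ hne (hX.stableIn_res hgood hr H ht)

end Adapted

/-- The `𝒫(s ∪ {a})`-system formed by the traces of `S` on `X` and on `Y`. -/
def doubleRes (S : Finset ℕ → L.Substructure N) (X Y : Set N) (a : ℕ) (w : Finset ℕ) :
    L.Substructure N :=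
  if a ∈ w then res S Y (w.erase a) else res S X w

theorem doubleRes_of_mem {a : ℕ} {w : Finset ℕ} (h : a ∈ w) :
    doubleRes S X Y a w = res S Y (w.erase a) := if_pos h

theorem doubleRes_of_notMem {a : ℕ} {w : Finset ℕ} (h : a ∉ w) :
    doubleRes S X Y a w = res S X w := if_neg h

theorem res_mono (hXY : X ⊆ Y) (t : Finset ℕ) : res S X t ≤ res S Y t :=
  inf_le_inf_right _ (Substructure.closure_mono hXY)

/-- The rank function that puts `w ∪ {a}` directly after `w`. -/
def doubleRank (r : Finset ℕ → ℕ) (a : ℕ) (w : Finset ℕ) : ℕ :=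
  if a ∈ w then 2 * r (w.erase a) + 1 else 2 * r w

theorem isRank_doubleRank {r : Finset ℕ → ℕ} (hr : IsRank r) (a : ℕ) :
    IsRank (doubleRank r a) := by
  have hle : ∀ {t w : Finset ℕ}, t ⊆ w → r t ≤ r w := by
    intro t w h
    rcases eq_or_ssubset_of_subset h with rfl | h
    · exact le_rfl
    · exact (hr.lt h).le
  constructor
  · intro t w htw
    unfold doubleRank at htw
    split_ifs at htw with h1 h2 h2
    · have h3 : t.erase a = w.erase a := hr.inj (by omega)
      rw [← Finset.insert_erase h1, ← Finset.insert_erase h2, h3]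
    · omega
    · omega
    · exact hr.inj (by omega)
  · intro t w htw
    unfold doubleRank
    split_ifs with h1 h2 h2
    · have : t.erase a ⊂ w.erase a := by
        refine Finset.ssubset_iff_subset_ne.2 ⟨Finset.erase_subset_erase _ htw.subset, fun h => ?_⟩
        apply htw.ne
        rw [← Finset.insert_erase h1, ← Finset.insert_erase h2, h]
      have := hr.lt this
      omega
    · exact (h2 (htw.subset h1)).elim
    · have : t ⊆ w.erase a := Finset.subset_erase.2 ⟨htw.subset, h1⟩
      have := hle this
      omega
    · have := hr.lt htw
      omega

theorem isSystem_doubleRes (hX : W.Adapted s N S X) (hY : W.Adapted s N S Y) (hXY : X ⊆ Y)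
    (hcard : #X = μ) (hcard' : #Y = μ) (hS : K.IsSystem lam N s.powerset S) {a : ℕ}
    {t : Finset ℕ} (ht : t ⊆ s) : K.IsSystem μ N (insert a t).powerset (doubleRes S X Y a) := by
  have hXs := hX.isSystem hS
  have hYs := hY.isSystem hS
  have her : ∀ w ∈ (insert a t).powerset, a ∈ w → w.erase a ∈ s.powerset := fun w hw _ =>
    Finset.mem_powerset.2 ((Finset.subset_insert_iff.1 (Finset.mem_powerset.1 hw)).trans ht)
  have hno : ∀ w ∈ (insert a t).powerset, a ∉ w → w ∈ s.powerset := fun w hw ha =>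
    Finset.mem_powerset.2
      (((Finset.subset_insert_iff_of_notMem ha).1 (Finset.mem_powerset.1 hw)).trans ht)
  refine ⟨⟨∅, by simp⟩,
    fun _ ha _ hb => Finset.mem_powerset.2 (hb.trans (Finset.mem_powerset.1 ha)),
    fun w hw => ?_, fun w hw v hv hwv => ?_, fun w hw v hv => ?_, fun w hw => ?_⟩
  · by_cases ha : a ∈ w
    · rw [doubleRes_of_mem ha]
      exact hYs.strong _ (her w hw ha)
    · rw [doubleRes_of_notMem ha]
      exact hXs.strong _ (hno w hw ha)
  · by_cases ha : a ∈ w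
    · rw [doubleRes_of_mem ha, doubleRes_of_mem (hwv ha)]
      exact hYs.mono _ (her w hw ha) _ (her v hv (hwv ha)) (Finset.erase_subset_erase _ hwv)
    · rw [doubleRes_of_notMem ha]
      by_cases hav : a ∈ v
      · rw [doubleRes_of_mem hav]
        refine le_trans ?_ (res_mono hXY _)
        exact hXs.mono _ (hno w hw ha) _ (her v hv hav) (Finset.subset_erase.2 ⟨hwv, ha⟩)
      · rw [doubleRes_of_notMem hav]
        exact hXs.mono _ (hno w hw ha) _ (hno v hv hav) hwv
  -- A face on the side of `Y` meets a face on the side of `X` within `X`, so the intersection is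
  -- again a trace on `X`.
  · have hmix : ∀ w ∈ (insert a t).powerset, ∀ v ∈ (insert a t).powerset, a ∈ w → a ∉ v →
        res S X (w ∩ v) = res S Y (w.erase a) ⊓ res S X v := by
      intro w hw v hv ha hav
      have h1 : w ∩ v = w.erase a ∩ v := by
        ext i
        simp only [Finset.mem_inter, Finset.mem_erase]
        constructor
        · rintro ⟨h1, h2⟩
          exact ⟨⟨fun h => hav (h ▸ h2), h1⟩, h2⟩
        · rintro ⟨⟨_, h1⟩, h2⟩
          exact ⟨h1, h2⟩
      rw [h1, hXs.inter _ (her w hw ha) _ (hno v hv hav)]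
      refine le_antisymm (inf_le_inf_right _ (res_mono hXY _)) (le_inf ?_ inf_le_right)
      exact le_inf (inf_le_right.trans inf_le_left) (inf_le_left.trans inf_le_right)
    by_cases ha : a ∈ w <;> by_cases hav : a ∈ v
    · rw [doubleRes_of_mem ha, doubleRes_of_mem hav,
        doubleRes_of_mem (Finset.mem_inter.2 ⟨ha, hav⟩)]
      have h1 : (w ∩ v).erase a = w.erase a ∩ v.erase a := by
        ext i; simp only [Finset.mem_erase, Finset.mem_inter]; tauto
      rw [h1]
      exact hYs.inter _ (her w hw ha) _ (her v hv hav)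
    · rw [doubleRes_of_mem ha, doubleRes_of_notMem hav,
        doubleRes_of_notMem fun h => hav (Finset.mem_inter.1 h).2]
      exact hmix w hw v hv ha hav
    · rw [doubleRes_of_notMem ha, doubleRes_of_mem hav,
        doubleRes_of_notMem fun h => ha (Finset.mem_inter.1 h).1, Finset.inter_comm,
        hmix v hv w hw hav ha, inf_comm]
    · rw [doubleRes_of_notMem ha, doubleRes_of_notMem hav,
        doubleRes_of_notMem fun h => ha (Finset.mem_inter.1 h).1]
      exact hXs.inter _ (hno w hw ha) _ (hno v hv hav)
  · by_cases ha : a ∈ w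
    · rw [doubleRes_of_mem ha, ← hcard']
      exact hYs.card _ (her w hw ha)
    · rw [doubleRes_of_notMem ha, ← hcard]
      exact hXs.card _ (hno w hw ha)

/-- The traces of a system on two adapted sets of the same cardinality form a stable system of the
next dimension. -/
theorem stableIn_doubleRes (hX : W.Adapted s N S X) (hY : W.Adapted s N S Y) (hXY : X ⊆ Y)
    (hcard : #X = μ) (hcard' : #Y = μ) (hgood : W.GoodAt μ) {r : Finset ℕ → ℕ} (hr : IsRank r)
    (H : W.StableWrt (fun t w => r w < r t) lam s N S) {a : ℕ} (ha : a ∉ s)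
    {t : Finset ℕ} (ht : t ⊆ s) : W.StableIn μ (insert a t) N (doubleRes S X Y a) := by
  have hgX : W.GoodAt #X := hcard ▸ hgood
  have hgY : W.GoodAt #Y := hcard' ▸ hgood
  have hle : ∀ {t w : Finset ℕ}, t ⊆ w → r t ≤ r w := by
    intro t w h
    rcases eq_or_ssubset_of_subset h with rfl | h
    · exact le_rfl
    · exact (hr.lt h).le
  have hss : ∀ {w q : Finset ℕ}, w ⊆ s → q ⊆ s → r w < r q → w ⊂ s := by
    intro w q hw hq hwq
    refine Finset.ssubset_iff_subset_ne.2 ⟨hw, ?_⟩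
    rintro rfl
    exact (hle hq).not_gt hwq
  induction t using Finset.strongInduction with
  | H t ih =>
    have her : ∀ {w}, w ⊆ insert a t → w.erase a ⊆ t := fun h => Finset.subset_insert_iff.1 h
    have hno : ∀ {w}, w ⊆ insert a t → a ∉ w → w ⊆ t := fun h ha =>
      (Finset.subset_insert_iff_of_notMem ha).1 h
    have hat : a ∉ t := fun h => ha (ht h)
    have hbdryX : ∀ q : Finset ℕ, a ∉ q → ∀ w ∈ q.ssubsets, doubleRes S X Y a w = res S X w :=
      fun q hq w hw => doubleRes_of_notMem fun h => hq ((Finset.mem_ssubsets.1 hw).subset h)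
    have hbase : ∀ q, q ⊂ insert a t → q.Nonempty →
        K.IsAmalgBase μ N q.ssubsets (doubleRes S X Y a) := by
      intro q hq hne
      by_cases haq : a ∈ q
      · have hp : q.erase a ⊂ t := by
          refine Finset.ssubset_iff_subset_ne.2 ⟨her hq.subset, fun h => hq.ne ?_⟩
          rw [← h, Finset.insert_erase haq]
        have := ih _ hp (hp.subset.trans ht)
        rw [Finset.insert_erase haq] at this
        exact hgood.boundaries N q _ hne this
      · have := hX.isAmalgBase_res hgX hr H ((hno hq.subset haq).trans ht) hne
        rw [hcard] at this
        exact (isAmalgBase_congr (hbdryX q haq)).2 this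
    refine hgood.stableIn (isRank_doubleRank hr a)
      ⟨isSystem_doubleRes hX hY hXY hcard hcard' H.sys ht, hbase, fun q hq hne => ?_⟩
    have hab := (hbase q hq hne).ab_bdry
    by_cases haq : a ∈ q
    · have hps : q.erase a ⊆ s := (her hq.subset).trans ht
      have hbdry : bdry (doubleRes S X Y a) q =
          bdry (res S Y) (q.erase a) ∪ (res S X (q.erase a) : Set N) := by
        ext x
        rw [Set.mem_union, mem_bdry, mem_bdry]
        constructor
        · rintro ⟨w, hw, hx⟩
          by_cases haw : a ∈ w
          · rw [doubleRes_of_mem haw] at hx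
            refine Or.inl ⟨w.erase a, Finset.ssubset_iff_subset_ne.2
              ⟨Finset.erase_subset_erase _ hw.subset, fun h => hw.ne ?_⟩, hx⟩
            rw [← Finset.insert_erase haw, h, Finset.insert_erase haq]
          · rw [doubleRes_of_notMem haw] at hx
            right
            have h1 : w ⊆ q.erase a := Finset.subset_erase.2 ⟨hw.subset, haw⟩
            exact (hX.isSystem H.sys).mono w (Finset.mem_powerset.2 (h1.trans hps)) _
              (Finset.mem_powerset.2 hps) h1 hx
        · rintro (⟨w, hw, hx⟩ | hx)
          · have haw : a ∉ w := fun h => Finset.notMem_erase a q (hw.subset h)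
            refine ⟨insert a w, Finset.ssubset_iff_subset_ne.2 ⟨?_, ?_⟩, ?_⟩
            · exact Finset.insert_subset haq (hw.subset.trans (Finset.erase_subset _ _))
            · rintro rfl
              rw [Finset.erase_insert haw] at hw
              exact hw.ne rfl
            · rw [doubleRes_of_mem (Finset.mem_insert_self _ _), Finset.erase_insert haw]
              exact hx
          · refine ⟨q.erase a, Finset.erase_ssubset haq, ?_⟩
            rw [doubleRes_of_notMem (Finset.notMem_erase _ _)]
            exact hx
      rw [doubleRes_of_mem haq]
      -- For `q = {a}` the boundary is the model `res S X ∅`. Only `∅` has smaller rank, so the set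
      -- on the right is contained in the base.
      rcases (q.erase a).eq_empty_or_nonempty with hp | hp
      · have hb0 : bdry (doubleRes S X Y a) q = (res S X ∅ : Set N) := by
          rw [hbdry, hp]
          refine Set.union_eq_self_of_subset_left ?_
          intro x hx
          obtain ⟨w, hw, -⟩ := mem_bdry.1 hx
          exact (Finset.not_ssubset_empty w hw).elim
        rw [hb0] at hab ⊢
        rw [hp]
        refine (indep_univ_of_strong (hX.strong ∅ (by simp)) hab).mono hab
          (fun _ _ => Or.inl trivial) ?_
        rintro x ⟨w, hw, hrw, hx⟩
        left
        unfold doubleRank at hrw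
        rw [if_pos haq, hp] at hrw
        split_ifs at hrw with haw
        · have := hle (Finset.empty_subset (w.erase a))
          omega
        · have h1 := hle (Finset.empty_subset w)
          have h2 : w = ∅ := hr.inj (by omega)
          subst h2
          rwa [doubleRes_of_notMem haw] at hx
      · have hbp := hY.isAmalgBase_res hgY hr H hps hp
        have h1 := hY.indep_earlier hgY H hps hp hbp
        -- The boundary of `q` exceeds `bdry (res S Y) (q.erase a)` by `res S X (q.erase a)`. This
        -- set lies in `res S Y (q.erase a)`, so once the two sides are exchanged it may be added to
        -- the base.
        have h2 := ((h1.symm hbp.ab_bdry).base_mono hbp.ab_bdry hab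
          (by rw [hbdry]; exact Set.subset_union_left)
          (by
            rw [hbdry]
            refine Set.union_subset Set.subset_union_right
              (Set.Subset.trans (res_mono hXY _) Set.subset_union_left))).symm hab
        refine h2.mono_right hab ?_
        rintro x ⟨w, hw, hrw, hx⟩
        unfold doubleRank at hrw
        rw [if_pos haq] at hrw
        split_ifs at hrw with haw
        · rw [doubleRes_of_mem haw] at hx
          exact Or.inl ⟨w.erase a, hss ((her hw.subset).trans ht) hps (by omega), by omega,
            res_le _ hx⟩
        · rw [doubleRes_of_notMem haw] at hx
          rcases (show r w ≤ r (q.erase a) by omega).lt_or_eq with h | h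
          · exact Or.inl ⟨w, hss ((hno hw.subset haw).trans ht) hps h, h, res_le _ hx⟩
          · rw [hr.inj h] at hx
            right
            rw [hbdry]
            exact Or.inr hx
    · have hqs : q ⊆ s := (hno hq.subset haq).trans ht
      have hb : bdry (doubleRes S X Y a) q = bdry (res S X) q := by
        ext x
        simp only [mem_bdry]
        refine exists_congr fun w => and_congr_right fun hw => ?_
        rw [hbdryX q haq w (Finset.mem_ssubsets.2 hw)]
      rw [doubleRes_of_notMem haq, hb]
      have hbX := hX.isAmalgBase_res hgX hr H hqs hne
      refine (hX.indep_earlier hgX H hqs hne hbX).mono_right hbX.ab_bdry ?_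
      rintro x ⟨w, hw, hrw, hx⟩
      left
      unfold doubleRank at hrw
      rw [if_neg haq] at hrw
      split_ifs at hrw with haw
      · rw [doubleRes_of_mem haw] at hx
        exact ⟨w.erase a, hss ((her hw.subset).trans ht) hqs (by omega), by omega, res_le _ hx⟩
      · rw [doubleRes_of_notMem haw] at hx
        exact ⟨w, hss ((hno hw.subset haw).trans ht) hqs (by omega), by omega, res_le _ hx⟩

end WeakForking

/-! ### Unions of chains of stable systems; symmetry in `lam`. -/

namespace WeakForking

open FirstOrder.Language

variable {L : FirstOrder.Language.{u, u}} {K : AEC L} {W : WeakForking K} {N N' : K.Model}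
  {μ lam : Cardinal.{u}} {s : Finset ℕ} {S : Finset ℕ → L.Substructure N}

/-- A union of a chain of stable systems is stable. -/
theorem stableIn_of_chain {ι : Type*} [LinearOrder ι] [Nonempty ι] {ν : ι → Cardinal.{u}}
    {T : ι → Finset ℕ → L.Substructure N} (hsys : K.IsSystem lam N s.powerset S)
    (hbase : ∀ t, t ⊂ s → t.Nonempty → K.IsAmalgBase lam N t.ssubsets S)
    (hT : ∀ i, W.StableIn (ν i) s N (T i)) (hmono : ∀ w, w ⊂ s → Monotone fun i => T i w)
    (hle : ∀ i w, w ⊂ s → T i w ≤ S w) (hex : ∀ w, w ⊂ s → ∀ x ∈ S w, ∃ i, x ∈ T i w)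
    (hind : ∀ t, t ⊂ s → t.Nonempty → ∀ i j, i ≤ j →
      W.Indep N (T i t) (bdry (T i) t) (bdry (T j) t)) : W.StableIn lam s N S := by
  refine ⟨hsys, hbase, fun t ht hne => ?_⟩
  set B : ι → Set N := fun j => {x | ∃ w, w ⊂ s ∧ ¬ t ⊆ w ∧ x ∈ T j w}
  have hBmono : Monotone B := by
    rintro i j hij x ⟨w, hw, htw, hx⟩
    exact ⟨w, hw, htw, hmono w hw hij hx⟩
  have hbmono : ∀ i j, i ≤ j → bdry (T i) t ⊆ bdry (T j) t := by
    intro i j hij x hx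
    obtain ⟨w, hw, hx⟩ := mem_bdry.1 hx
    exact mem_bdry.2 ⟨w, hw, hmono w (hw.trans ht) hij hx⟩
  have hab : ∀ i, K.Ab N (bdry (T i) t) := fun i => ((hT i).base t ht hne).ab_bdry
  -- Transitivity through `bdry (T j) t`, from independence along the chain and the stability of `T
  -- j`.
  have h1 : ∀ i j, i ≤ j → W.Indep N (T i t) (bdry (T i) t) (B j) := fun i j hij =>
    (hind t ht hne i j hij).trans (hab i) (hab j) (hbmono i j hij)
      (((hT j).indep t ht hne).mono_left (hab j) fun x hx => Or.inl (hmono t ht hij hx))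
  have h2 : ∀ i, W.Indep N (T i t) (bdry (T i) t) (⋃ j, B j) := fun i =>
    Indep.iUnion_right (hab i) hBmono fun j =>
      (h1 i (max i j) (le_max_left _ _)).mono_right (hab i)
        fun x hx => Or.inl (hBmono (le_max_right _ _) hx)
  have hab' := (hbase t ht hne).ab_bdry
  -- The union of the `B j` contains `bdry S t`, since no proper subset of `t` contains `t`. It may
  -- therefore become the base, which no longer depends on `i`, and continuity can be applied on the
  -- left.
  have h3 : ∀ i, W.Indep N (T i t) (bdry S t) (⋃ j, B j) := by
    refine fun i => (h2 i).base_mono (hab i) hab' ?_ ?_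
    · intro x hx
      obtain ⟨w, hw, hx⟩ := mem_bdry.1 hx
      exact mem_bdry.2 ⟨w, hw, hle i w (hw.trans ht) hx⟩
    · intro x hx
      obtain ⟨w, hw, hx⟩ := mem_bdry.1 hx
      obtain ⟨j, hj⟩ := hex w (hw.trans ht) x hx
      exact Or.inl (Set.mem_iUnion.2 ⟨j, w, hw.trans ht, hw.not_subset, hj⟩)
  have h4 := Indep.iUnion_left hab' (A := fun i => (T i t : Set N))
    (fun i j hij => hmono t ht hij) h3
  refine h4.mono hab' ?_ ?_
  · intro x hx
    exact Or.inl (Set.mem_iUnion.2 (hex t ht x hx))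
  · rintro x ⟨w, hw, htw, hx⟩
    obtain ⟨j, hj⟩ := hex w hw x hx
    exact Or.inl (Set.mem_iUnion.2 ⟨j, w, hw, htw, hj⟩)

/-- Goodness in all cardinals below `lam`. -/
def GoodBelow (W : WeakForking K) (lam : Cardinal.{u}) : Prop :=
  ∀ μ, K.LS ≤ μ → μ < lam → W.GoodAt μ

/-- A rank for which a system is stable, for an enumeration as in the symmetry property. -/
theorem exists_rank_of_enumeration {n : ℕ} (hS : IsCube K lam (Finset.range n) N S)
    (h : ∃ e : Fin (2 ^ n - 1) → Finset ℕ, Function.Injective e ∧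
      Set.range e = {t | t ⊂ Finset.range n} ∧ (∀ i j, e i ⊂ e j → i < j) ∧
      ∀ j, (e j).Nonempty →
        K.IsAmalgBase lam N (e j).ssubsets S ∧
        W.Indep N (S (e j)) (bdry S (e j)) {x | ∃ i, i < j ∧ x ∈ S (e i)}) :
    ∃ r, IsRank r ∧ W.StableWrt (fun t w => r w < r t) lam (Finset.range n) N S := by
  classical
  obtain ⟨e, he, hrange, hlt, hstab⟩ := h
  obtain ⟨r₀, hr₀⟩ := exists_isRank
  have hpre : ∀ t : Finset ℕ, ∃ i : ℕ, t ⊂ Finset.range n → ∃ h : i < 2 ^ n - 1, e ⟨i, h⟩ = t := by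
    intro t
    by_cases ht : t ⊂ Finset.range n
    · have : t ∈ Set.range e := by rw [hrange]; exact ht
      obtain ⟨i, hi⟩ := this
      exact ⟨i, fun _ => ⟨i.2, hi⟩⟩
    · exact ⟨0, fun h => (ht h).elim⟩
  choose p hp using hpre
  -- The sets that are not enumerated come after all enumerated ones, in the order of `r₀`, so that
  -- `r` is a rank on all finite sets.
  let r : Finset ℕ → ℕ := fun t => if t ⊂ Finset.range n then p t else 2 ^ n + r₀ t
  have hrpos : ∀ t, t ⊂ Finset.range n → r t = p t := fun t ht => if_pos ht
  have hrneg : ∀ t, ¬ t ⊂ Finset.range n → r t = 2 ^ n + r₀ t := fun t ht => if_neg ht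
  have hrlt : ∀ t, t ⊂ Finset.range n → r t < 2 ^ n := fun t ht => by
    obtain ⟨h, -⟩ := hp t ht
    rw [hrpos t ht]
    omega
  refine ⟨r, ⟨fun a b hab => ?_, fun {t w} htw => ?_⟩, hS.1, fun t ht hne => ?_,
    fun t ht hne => ?_⟩
  · by_cases ha : a ⊂ Finset.range n <;> by_cases hb : b ⊂ Finset.range n
    · obtain ⟨h1, h1'⟩ := hp a ha
      obtain ⟨h2, h2'⟩ := hp b hb
      rw [hrpos a ha, hrpos b hb] at hab
      rw [← h1', ← h2']
      congr 2
    · have := hrlt a ha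
      rw [hrneg b hb] at hab
      omega
    · have := hrlt b hb
      rw [hrneg a ha] at hab
      omega
    · rw [hrneg a ha, hrneg b hb] at hab
      exact hr₀.inj (by omega)
  · by_cases hw : w ⊂ Finset.range n
    · have ht := htw.trans hw
      obtain ⟨h1, h1'⟩ := hp t ht
      obtain ⟨h2, h2'⟩ := hp w hw
      rw [hrpos t ht, hrpos w hw]
      exact hlt ⟨p t, h1⟩ ⟨p w, h2⟩ (by rw [h1', h2']; exact htw)
    · rw [hrneg w hw]
      by_cases ht : t ⊂ Finset.range n
      · have := hrlt t ht
        omega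
      · rw [hrneg t ht]
        have := hr₀.lt htw
        omega
  · obtain ⟨h1, h1'⟩ := hp t ht
    have := (hstab ⟨p t, h1⟩ (by rw [h1']; exact hne)).1
    rwa [h1'] at this
  · obtain ⟨h1, h1'⟩ := hp t ht
    have := hstab ⟨p t, h1⟩ (by rw [h1']; exact hne)
    rw [h1'] at this
    refine this.2.mono_right this.1.ab_bdry ?_
    rintro x ⟨w, hw, hrw, hx⟩
    obtain ⟨h2, h2'⟩ := hp w hw
    rw [hrpos w hw, hrpos t ht] at hrw
    exact Or.inl ⟨⟨p w, h2⟩, hrw, by rw [h2']; exact hx⟩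

theorem mk_eq_of_top (hS : K.IsSystem lam N s.powerset S) (htop : S s = ⊤) : #N = lam := by
  rw [← hS.card s (by simp), htop]
  exact (Cardinal.mk_congr (Substructure.topEquiv (L := L) (M := N)).toEquiv).symm

/-- The traces on the members of a filtration by adapted sets are stable, by symmetry in smaller
cardinals. Adaptedness also gives the independence between members of the chain that makes the union
stable. -/
theorem GoodBelow.hasSymmetry (hgood : W.GoodBelow lam) (hlam : K.LS < lam) (hκ : W.κ ≤ K.LS)
    (n : ℕ) : W.HasSymmetry lam n := by
  intro N S hS he
  obtain ⟨r, hr, H⟩ := exists_rank_of_enumeration hS he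
  obtain ⟨C, hC, hCad⟩ := exists_setClub_adapted hκ hS.1 hS.2
  obtain ⟨X, -, -, hXmono, hXC, hXle, hXlt, -, -, hXlim, hXtop⟩ :=
    hC.exists_filtration K.aleph0_le_LS hlam (mk_eq_of_top hS.1 hS.2) ∅ (by simp)
  have hlim : Order.IsSuccLimit lam.ord :=
    Cardinal.isSuccLimit_ord (K.aleph0_le_LS.trans hlam.le)
  have hne : Nonempty (Set.Iio lam.ord) := ⟨⟨0, hlim.bot_lt⟩⟩
  refine isStable_iff.2 ⟨stableIn_of_chain (ι := Set.Iio lam.ord)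
    (T := fun i => res S (X i)) (ν := fun i => #(X i)) hS.1 H.base
    (fun i => (hCad _ (hXC _)).stableIn_res (hgood _ (hXle _) (hXlt _ i.2)) hr H subset_rfl)
    (fun w _ i j hij => res_mono (hXmono hij) w) (fun i w _ => res_le w) ?_ ?_, hS.2⟩
  · intro w _ x hx
    have hx' : x ∈ X lam.ord := by rw [hXtop]; trivial
    rw [hXlim _ hlim] at hx'
    obtain ⟨j, hj, hxj⟩ := Set.mem_iUnion₂.1 hx'
    exact ⟨⟨j, hj⟩, (hCad _ (hXC _)).mem_res.2 ⟨hxj, hx⟩⟩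
  · intro t ht hne i j hij
    have hg := hgood _ (hXle _) (hXlt _ i.2)
    have hb := (hCad _ (hXC _)).isAmalgBase_res hg hr H ht.subset hne
    exact ((hCad _ (hXC _)).indep_bdry t ht.subset hg hb).mono_right hb.ab_bdry
      ((Adapted.bdry_res_subset t).trans Set.subset_union_left)

end WeakForking

/-! ### Partial `K`-embeddings, represented by total maps. -/

/-- Partial maps are replaced by total functions with arbitrary values elsewhere, so that maps with
different domains can be compared and composed directly. -/
theorem exists_glue {α β ι : Type*} [Nonempty β] (D : ι → Set α) (e : ∀ i, D i → β)
    (h : ∀ i j x (hi : x ∈ D i) (hj : x ∈ D j), e i ⟨x, hi⟩ = e j ⟨x, hj⟩) :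
    ∃ φ : α → β, ∀ i x (hx : x ∈ D i), φ x = e i ⟨x, hx⟩ := by
  classical
  refine ⟨fun x => if hx : ∃ i, x ∈ D i then e hx.choose ⟨x, hx.choose_spec⟩ else
    Classical.arbitrary β, fun i x hx => ?_⟩
  have hx' : ∃ i, x ∈ D i := ⟨i, hx⟩
  simp only [hx', dite_true]
  exact h _ _ _ _ _

namespace AEC

open FirstOrder.Language

variable {L : FirstOrder.Language.{u, u}} {K : AEC L} {N P Q : K.Model} {S T : L.Substructure N}
  {φ ψ : N → P} {μ : Cardinal.{u}}

/-- `φ` restricts to a `K`-embedding of the submodel `T`. -/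
def KEmbOn (K : AEC L) {N P : K.Model} (T : L.Substructure N) (φ : N → P) : Prop :=
  ∃ e : T ↪[L] P, K.IsKEmb e ∧ ∀ x : T, e x = φ x

/-- The substructure generated by the image of `T` under `φ`. -/
def img (φ : N → P) (T : L.Substructure N) : L.Substructure P := Substructure.closure L (φ '' T)

theorem img_eq_map {e : T ↪[L] P} (he : ∀ x : T, e x = φ x) (hST : S ≤ T) :
    img φ S = (S.comap T.subtype.toHom).map e.toHom := by
  have : (((S.comap T.subtype.toHom).map e.toHom : L.Substructure P) : Set P) = φ '' S := by
    ext y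
    constructor
    · rintro ⟨x, hx, rfl⟩
      exact ⟨x, hx, (he x).symm⟩
    · rintro ⟨x, hx, rfl⟩
      exact ⟨⟨x, hST hx⟩, hx, he _⟩
  rw [img, ← this, Substructure.closure_eq]

theorem img_congr (h : ∀ x ∈ T, φ x = ψ x) : img φ T = img ψ T := by
  rw [img, img, Set.image_congr h]

theorem KEmbOn.img_eq_range {e : T ↪[L] P} (he : ∀ x : T, e x = φ x) : img φ T = e.toHom.range := by
  rw [img_eq_map he le_rfl]
  ext y
  constructor
  · rintro ⟨x, -, rfl⟩
    exact ⟨x, rfl⟩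
  · rintro ⟨x, rfl⟩
    exact ⟨x, x.2, rfl⟩

namespace KEmbOn

theorem coe_img_of_le (h : K.KEmbOn T φ) (hST : S ≤ T) : (img φ S : Set P) = φ '' S := by
  obtain ⟨e, -, he⟩ := h
  rw [img_eq_map he hST]
  ext y
  constructor
  · rintro ⟨x, hx, rfl⟩
    exact ⟨x, hx, (he x).symm⟩
  · rintro ⟨x, hx, rfl⟩
    exact ⟨⟨x, hST hx⟩, hx, he _⟩

theorem coe_img (h : K.KEmbOn T φ) : (img φ T : Set P) = φ '' T := h.coe_img_of_le le_rfl

theorem mem_img (h : K.KEmbOn T φ) {y : P} : y ∈ img φ T ↔ ∃ x ∈ T, φ x = y := by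
  rw [← SetLike.mem_coe, h.coe_img]
  rfl

theorem strong_img (h : K.KEmbOn T φ) : K.Strong (img φ T) := by
  obtain ⟨e, he, he'⟩ := h
  rw [img_eq_range he']
  exact he.2

theorem injOn (h : K.KEmbOn T φ) : Set.InjOn φ (T : Set N) := by
  obtain ⟨e, -, he⟩ := h
  intro x hx y hy hxy
  have : e ⟨x, hx⟩ = e ⟨y, hy⟩ := by rw [he, he]; exact hxy
  exact congrArg Subtype.val (e.injective this)

theorem mk_img_of_le (h : K.KEmbOn T φ) (hST : S ≤ T) : #(img φ S) = #S := by
  have : #(img φ S : Set P) = #(S : Set N) := by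
    rw [h.coe_img_of_le hST]
    exact Cardinal.mk_image_eq_of_injOn _ _ (h.injOn.mono hST)
  exact this

theorem mk_img (h : K.KEmbOn T φ) : #(img φ T) = #T := h.mk_img_of_le le_rfl

theorem mono (h : K.KEmbOn T φ) (hT : K.Strong T) (hS : K.Strong S) (hST : S ≤ T) :
    K.KEmbOn S φ := by
  obtain ⟨e, he, he'⟩ := h
  exact ⟨e.comp (Substructure.inclusion hST), he.comp (isKEmb_inclusion hST hS hT),
    fun x => he' _⟩

theorem congr (h : K.KEmbOn T φ) (hφ : ∀ x ∈ T, ψ x = φ x) : K.KEmbOn T ψ := by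
  obtain ⟨e, he, he'⟩ := h
  exact ⟨e, he, fun x => (he' x).trans (hφ x x.2).symm⟩

theorem comp_emb (h : K.KEmbOn T φ) {g : P ↪[L] Q} (hg : K.IsKEmb g) :
    K.KEmbOn T (fun x => g (φ x)) := by
  obtain ⟨e, he, he'⟩ := h
  exact ⟨g.comp e, hg.comp he, fun x => congrArg g (he' x)⟩

theorem comp {U : L.Substructure P} {χ : P → Q} (hχ : K.KEmbOn U χ) (hU : K.Strong U)
    (h : K.KEmbOn T φ) (hTU : ∀ x ∈ T, φ x ∈ U) : K.KEmbOn T (fun x => χ (φ x)) := by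
  obtain ⟨e, he, he'⟩ := h
  obtain ⟨e₂, he₂, he₂'⟩ := hχ
  have hmem : ∀ x, e x ∈ U := fun x => by rw [he']; exact hTU x x.2
  refine ⟨e₂.comp (e.codRestrict U hmem), he₂.comp (he.codRestrict hU hmem), fun x => ?_⟩
  have : e₂.comp (e.codRestrict U hmem) x = e₂ (e.codRestrict U hmem x) := rfl
  rw [this, he₂']
  exact congrArg χ (he' x)

theorem exists_embedding (h : K.KEmbOn (⊤ : L.Substructure N) φ) :
    ∃ g : N ↪[L] P, K.IsKEmb g ∧ ∀ x, g x = φ x := by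
  obtain ⟨e, he, he'⟩ := h
  refine ⟨e.comp Substructure.topEquiv.symm.toEmbedding,
    he.comp (isKEmb_equiv _ N.mem), fun x => ?_⟩
  exact he' _

theorem exists_inverse (h : K.KEmbOn T φ) (hT : K.Strong T) [Nonempty N] :
    ∃ χ : P → N, K.KEmbOn (img φ T) χ ∧ ∀ x ∈ T, χ (φ x) = x := by
  obtain ⟨e, he, he'⟩ := h
  have hinv : ∀ x ∈ T, Function.invFunOn φ T (φ x) = x := fun x hx =>
    (injOn ⟨e, he, he'⟩).leftInvOn_invFunOn hx
  refine ⟨Function.invFunOn φ T, ?_, hinv⟩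
  have hk : K.IsKEmb (T.subtype.comp e.equivRange.symm.toEmbedding) :=
    (isKEmb_subtype hT).comp (isKEmb_equiv _ (K.mem_of_strong _ he.2).1)
  rw [img_eq_range he']
  refine ⟨_, hk, fun y => ?_⟩
  obtain ⟨x, rfl⟩ := e.equivRange.surjective y
  have h1 : (T.subtype.comp e.equivRange.symm.toEmbedding) (e.equivRange x) = x := by
    change ((e.equivRange.symm (e.equivRange x) : T) : N) = x
    rw [FirstOrder.Language.Equiv.symm_apply_apply]
  rw [h1]
  refine (hinv x x.2).symm.trans (congrArg _ ?_)
  exact (he' x).symm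

end KEmbOn

theorem kEmbOn_of_isKEmb {g : N ↪[L] P} (hg : K.IsKEmb g) (hT : K.Strong T) : K.KEmbOn T g :=
  ⟨g.comp T.subtype, hg.domRestrict hT, fun _ => rfl⟩

theorem img_emb {g : N ↪[L] P} : img g T = T.map g.toHom := by
  have : (T.map g.toHom : Set P) = g '' T := rfl
  rw [img, ← this, Substructure.closure_eq]

theorem img_img {U : L.Substructure N} {χ : P → Q} (hφ : K.KEmbOn T φ) (hUT : U ≤ T) :
    img χ (img φ U) = img (fun x => χ (φ x)) U := by
  rw [img, hφ.coe_img_of_le hUT, img, Set.image_image]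

variable {I : Finset (Finset ℕ)} {F : Finset ℕ → L.Substructure N}
  {F' : Finset ℕ → L.Substructure P}

/-- Both sides are compared with the system inside the model `T`, which embeds in `N` by inclusion
and in `P` by `φ`. -/
theorem isAmalgBase_img_iff (hT : K.Strong T) (hφ : K.KEmbOn T φ) (hle : ∀ w ∈ I, F w ≤ T)
    (hF' : ∀ w ∈ I, F' w = img φ (F w)) :
    K.IsAmalgBase μ P I F' ↔ K.IsAmalgBase μ N I F := by
  obtain ⟨e, he, he'⟩ := hφ
  have h1 : K.IsAmalgBase μ P I F' ↔
      K.IsAmalgBase μ (N.sub T hT) I (fun w => (F w).comap T.subtype.toHom) :=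
    isAmalgBase_map_iff he fun w hw => (hF' w hw).trans (img_eq_map he' (hle w hw))
  have h2 : K.IsAmalgBase μ N I F ↔
      K.IsAmalgBase μ (N.sub T hT) I (fun w => (F w).comap T.subtype.toHom) :=
    isAmalgBase_map_iff (isKEmb_subtype hT) fun w hw => (map_subtype_comap (hle w hw)).symm
  exact h1.trans h2.symm

theorem unionOf_img (hφ : K.KEmbOn T φ) (hle : ∀ w ∈ I, F w ≤ T)
    (hF' : ∀ w ∈ I, F' w = img φ (F w)) : unionOf I F' = φ '' unionOf I F := by
  ext y
  constructor
  · rintro ⟨w, hw, hy⟩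
    rw [hF' w hw, ← SetLike.mem_coe, hφ.coe_img_of_le (hle w hw)] at hy
    obtain ⟨x, hx, rfl⟩ := hy
    exact ⟨x, ⟨w, hw, hx⟩, rfl⟩
  · rintro ⟨x, ⟨w, hw, hx⟩, rfl⟩
    refine ⟨w, hw, ?_⟩
    rw [hF' w hw, ← SetLike.mem_coe, hφ.coe_img_of_le (hle w hw)]
    exact ⟨x, hx, rfl⟩

end AEC

namespace WeakForking

open FirstOrder.Language

variable {L : FirstOrder.Language.{u, u}} {K : AEC L} {W : WeakForking K} {N P Q : K.Model}
  {T : L.Substructure N} {φ : N → P} {μ : Cardinal.{u}} {ρ : Finset ℕ → Finset ℕ → Prop}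
  {s : Finset ℕ} {F : Finset ℕ → L.Substructure N} {F' : Finset ℕ → L.Substructure P}

theorem stableWrt_img_iff (hT : K.Strong T) (hφ : K.KEmbOn T φ) (hle : ∀ w, w ⊆ s → F w ≤ T)
    (hF' : ∀ w, w ⊆ s → F' w = img φ (F w)) :
    W.StableWrt ρ μ s P F' ↔ W.StableWrt ρ μ s N F := by
  obtain ⟨e, he, he'⟩ := hφ
  have h1 : W.StableWrt ρ μ s P F' ↔
      W.StableWrt ρ μ s (N.sub T hT) (fun w => (F w).comap T.subtype.toHom) :=
    stableWrt_map_iff he fun w hw => (hF' w hw).trans (img_eq_map he' (hle w hw))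
  have h2 : W.StableWrt ρ μ s N F ↔
      W.StableWrt ρ μ s (N.sub T hT) (fun w => (F w).comap T.subtype.toHom) :=
    stableWrt_map_iff (isKEmb_subtype hT) fun w hw => (map_subtype_comap (hle w hw)).symm
  exact h1.trans h2.symm

/-- Invariance through the model `T`. A map that is a `K`-embedding only on `T` still transports the
independence of subsets of `T`. -/
theorem indep_img_iff (hT : K.Strong T) (hφ : K.KEmbOn T φ) {I : Finset (Finset ℕ)}
    (hbase : K.IsAmalgBase μ N I F) (hle : ∀ w ∈ I, F w ≤ T) {A B : Set N}
    (hA : A ⊆ T) (hB : B ⊆ T) :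
    W.Indep P (φ '' A) (φ '' unionOf I F) (φ '' B) ↔ W.Indep N A (unionOf I F) B := by
  obtain ⟨e, he, he'⟩ := hφ
  have hb : K.IsAmalgBase μ (N.sub T hT) I (fun w => (F w).comap T.subtype.toHom) :=
    (isAmalgBase_map_iff (isKEmb_subtype hT) fun w hw => (map_subtype_comap (hle w hw)).symm).1
      hbase
  have hU : unionOf I F ⊆ T := fun x ⟨w, hw, hx⟩ => hle w hw hx
  have hU' : unionOf I (fun w => (F w).comap T.subtype.toHom) =
      (Subtype.val ⁻¹' unionOf I F : Set T) := rfl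
  have him : ∀ A : Set N, A ⊆ T → e '' (Subtype.val ⁻¹' A) = φ '' A := by
    intro A hA
    ext y
    constructor
    · rintro ⟨x, hx, rfl⟩
      exact ⟨x, hx, (he' x).symm⟩
    · rintro ⟨x, hx, rfl⟩
      exact ⟨⟨x, hA hx⟩, hx, he' _⟩
  have him' : ∀ A : Set N, A ⊆ T → T.subtype '' (Subtype.val ⁻¹' A) = A := by
    intro A hA
    ext y
    constructor
    · rintro ⟨x, hx, rfl⟩
      exact hx
    · intro hy
      exact ⟨⟨y, hA hy⟩, hy, rfl⟩
  have h1 := indep_map_iff (W := W) (N := N.sub T hT) he (A := (Subtype.val ⁻¹' A : Set T))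
    (B := (Subtype.val ⁻¹' B : Set T)) hb.ab
  have h2 := indep_map_iff (W := W) (N := N.sub T hT) (isKEmb_subtype hT)
    (A := (Subtype.val ⁻¹' A : Set T)) (B := (Subtype.val ⁻¹' B : Set T)) hb.ab
  rw [hU', him A hA, him B hB, him _ hU] at h1
  rw [hU', him' A hA, him' B hB, him' _ hU] at h2
  exact h1.trans h2.symm

end WeakForking

/-! ### Unions of chains of models and the transfinite construction. -/

namespace AEC

open FirstOrder.Language

variable {L : FirstOrder.Language.{u, u}} {K : AEC L}

/-- A chain of models, given by injections into one set `Ω`, has a union. -/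
theorem exists_union_model {ι : Type*} [Preorder ι] [IsDirectedOrder ι] [Nonempty ι] {Ω : Type u}
    (P : ι → K.Model) (emb : ∀ i, P i → Ω) (hinj : ∀ i, Function.Injective (emb i))
    (htot : ∀ i j : ι, i ≤ j ∨ j ≤ i)
    (hle : ∀ i j, i ≤ j → ∃ g : P i ↪[L] P j, K.IsKEmb g ∧ ∀ x, emb j (g x) = emb i x) :
    ∃ (U : K.Model) (e : U → Ω) (G : ∀ i, P i ↪[L] U), Function.Injective e ∧
      (∀ i, K.IsKEmb (G i)) ∧ (∀ i x, e (G i x) = emb i x) ∧ ∀ y, ∃ i x, G i x = y := by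
  classical
  let U : Set Ω := ⋃ i, Set.range (emb i)
  -- A finite tuple of the union comes from one `P i`, where functions and relations can be
  -- evaluated.
  have htuple : ∀ {n : ℕ} (x : Fin n → U), ∃ (i : ι) (y : Fin n → P i),
      ∀ k, emb i (y k) = (x k : Ω) := by
    intro n x
    have h1 : ∀ k, ∃ i, ∃ y, emb i y = (x k : Ω) := fun k => Set.mem_iUnion.1 (x k).2
    choose i y hy using h1
    obtain ⟨j, hj⟩ := Finite.exists_le i
    choose g hg hg' using fun k => hle (i k) j (hj k)
    exact ⟨j, fun k => g k (y k), fun k => (hg' k (y k)).trans (hy k)⟩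
  choose st rep hrep using @htuple
  have hUmem : ∀ i (x : P i), emb i x ∈ U := fun i x => Set.mem_iUnion.2 ⟨i, x, rfl⟩
  have hfun : ∀ {n : ℕ} (f : L.Functions n) i j (x : Fin n → P i) (y : Fin n → P j),
      (∀ k, emb i (x k) = emb j (y k)) → emb i (Structure.funMap f x) = emb j (Structure.funMap f y) := by
    have aux : ∀ {n : ℕ} (f : L.Functions n) i j (x : Fin n → P i) (y : Fin n → P j), i ≤ j →
        (∀ k, emb i (x k) = emb j (y k)) →
        emb i (Structure.funMap f x) = emb j (Structure.funMap f y) := by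
      intro n f i j x y hij hxy
      obtain ⟨g, -, hg⟩ := hle i j hij
      rw [← hg, g.map_fun]
      congr 2
      funext k
      exact hinj j ((hg _).trans (hxy k))
    intro n f i j x y hxy
    rcases htot i j with h | h
    · exact aux f i j x y h hxy
    · exact (aux f j i y x h fun k => (hxy k).symm).symm
  have hrel : ∀ {n : ℕ} (R : L.Relations n) i j (x : Fin n → P i) (y : Fin n → P j),
      (∀ k, emb i (x k) = emb j (y k)) → (Structure.RelMap R x ↔ Structure.RelMap R y) := by
    have aux : ∀ {n : ℕ} (R : L.Relations n) i j (x : Fin n → P i) (y : Fin n → P j), i ≤ j →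
        (∀ k, emb i (x k) = emb j (y k)) → (Structure.RelMap R x ↔ Structure.RelMap R y) := by
      intro n R i j x y hij hxy
      obtain ⟨g, -, hg⟩ := hle i j hij
      rw [← g.map_rel]
      have : g ∘ x = y := by
        funext k
        exact hinj j ((hg _).trans (hxy k))
      rw [this]
    intro n R i j x y hxy
    rcases htot i j with h | h
    · exact aux R i j x y h hxy
    · exact (aux R j i y x h fun k => (hxy k).symm).symm
  -- By `hfun` and `hrel` the choice of the stage and of the representatives does not matter.
  let _ : L.Structure U :=
    { funMap := fun {n} f x => ⟨emb (st x) (Structure.funMap f (rep x)), hUmem _ _⟩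
      RelMap := fun {n} R x => Structure.RelMap R (rep x) }
  let G : ∀ i, P i ↪[L] U := fun i =>
    { toFun := fun x => ⟨emb i x, hUmem i x⟩
      inj' := fun x y hxy => hinj i (congrArg Subtype.val hxy)
      map_fun' := fun {n} f x => Subtype.ext
        (hfun f _ _ _ _ fun k => (hrep (fun k => (⟨emb i (x k), hUmem i _⟩ : U)) k).symm)
      map_rel' := fun {n} R x =>
        hrel R _ _ _ _ fun k => hrep (fun k => (⟨emb i (x k), hUmem i _⟩ : U)) k }
  have hGle : ∀ i j, i ≤ j → ∃ g : P i ↪[L] P j, K.IsKEmb g ∧ ∀ x, G j (g x) = G i x := by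
    intro i j hij
    obtain ⟨g, hg, hg'⟩ := hle i j hij
    exact ⟨g, hg, fun x => Subtype.ext (hg' x)⟩
  have hrangele : ∀ i j, i ≤ j → (G i).toHom.range ≤ (G j).toHom.range := by
    rintro i j hij _ ⟨x, rfl⟩
    obtain ⟨g, -, hg⟩ := hGle i j hij
    exact ⟨g x, hg x⟩
  have hstr : ∀ i j, i ≤ j →
      K.Strong ((G i).toHom.range.comap ((G j).toHom.range).subtype.toHom) := by
    intro i j hij
    obtain ⟨g, hg, hg'⟩ := hGle i j hij
    have h1 : (G i).toHom.range = (g.toHom.range).map (G j).toHom := by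
      ext y
      constructor
      · rintro ⟨x, rfl⟩
        exact ⟨g x, ⟨x, rfl⟩, hg' x⟩
      · rintro ⟨_, ⟨x, rfl⟩, rfl⟩
        exact ⟨x, (hg' x).symm⟩
    rw [h1, comap_subtype_map]
    exact K.strong_iso _ _ hg.2
  have hmem : ∀ i, K.Mem (G i).toHom.range := fun i => K.mem_iso (G i).equivRange (P i).mem
  have key := mem_of_chain_union (K := K) (U := U) (c := Set.range fun i => (G i).toHom.range)
    ?_ (Set.range_nonempty _) ?_ ?_ ?_
  · refine ⟨⟨U, key.1⟩, Subtype.val, G, Subtype.val_injective,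
      fun i => ⟨(P i).mem, key.2 _ ⟨i, rfl⟩⟩, fun i x => rfl, fun y => ?_⟩
    obtain ⟨i, x, hx⟩ := Set.mem_iUnion.1 y.2
    exact ⟨i, x, Subtype.ext hx⟩
  · rintro _ ⟨i, rfl⟩ _ ⟨j, rfl⟩ -
    exact (htot i j).imp (hrangele i j) (hrangele j i)
  · rintro _ ⟨i, rfl⟩
    exact hmem i
  · rintro _ ⟨i, rfl⟩ _ ⟨j, rfl⟩ hij
    rcases htot i j with h | h
    · exact hstr i j h
    · have heq : (G j).toHom.range = (G i).toHom.range := le_antisymm (hrangele j i h) hij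
      have := hstr i i le_rfl
      have e : ∀ A B : L.Substructure U, A = B → K.Strong (B.comap B.subtype.toHom) →
          K.Strong (B.comap A.subtype.toHom) := by
        rintro A _ rfl h
        exact h
      exact e _ _ heq this
  · refine Set.eq_univ_of_forall fun y => ?_
    obtain ⟨i, x, hx⟩ := Set.mem_iUnion.1 y.2
    exact Set.mem_iUnion₂.2 ⟨_, ⟨i, rfl⟩, x, Subtype.ext hx⟩

end AEC

/-- The complement of the range of `e` has the cardinality of `Ω`, so it has room for the points of
`β` outside the range of `g`. Successor stages are placed in the common set `Ω` in this way. -/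
theorem exists_extension_injective {α β Ω : Type u} {g : α → β} (hg : Function.Injective g)
    {e : α → Ω} (he : Function.Injective e) (hΩ : ℵ₀ ≤ #Ω) (hα : #α < #Ω) (hβ : #β ≤ #Ω) :
    ∃ e' : β → Ω, Function.Injective e' ∧ ∀ x, e' (g x) = e x := by
  classical
  have : Infinite Ω := Cardinal.infinite_iff.2 hΩ
  have hc : #β ≤ #((Set.range e)ᶜ : Set Ω) := by
    rw [Cardinal.mk_compl_of_infinite _ (by rwa [Cardinal.mk_range_eq _ he])]
    exact hβ
  obtain ⟨j⟩ := hc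
  have hx : ∀ {y} (h : ∃ x, g x = y), g h.choose = y := fun h => h.choose_spec
  refine ⟨fun y => if h : ∃ x, g x = y then e h.choose else j y, ?_, fun x => ?_⟩
  · intro y z hyz
    by_cases hy : ∃ x, g x = y <;> by_cases hz : ∃ x, g x = z
    · simp only [hy, hz, dite_true] at hyz
      rw [← hx hy, ← hx hz, he hyz]
    · simp only [hy, hz, dite_true, dite_false] at hyz
      exact ((j z).2 ⟨_, hyz⟩).elim
    · simp only [hy, hz, dite_true, dite_false] at hyz
      exact ((j y).2 ⟨_, hyz.symm⟩).elim
    · simp only [hy, hz, dite_false] at hyz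
      exact j.injective (Subtype.ext hyz)
  · have h : ∃ x', g x' = g x := ⟨x, rfl⟩
    simp only [h, dite_true]
    rw [hg (hx h)]

namespace AEC

open FirstOrder.Language

variable {L : FirstOrder.Language.{u, u}} {K : AEC L}

/-- Functions and relations concern finite tuples, which lie in one `C i`. The image of `T` is the
union of the chain of the images of the `C i`, hence strong. -/
theorem kEmbOn_of_chain {N P : K.Model} {T : L.Substructure N} (hT : K.Strong T) {φ : N → P}
    {ι : Type*} [LinearOrder ι] [Nonempty ι] {C : ι → L.Substructure N} (hmono : Monotone C)
    (hU : ∀ x ∈ T, ∃ i, x ∈ C i) (hle : ∀ i, C i ≤ T) (h : ∀ i, K.KEmbOn (C i) φ) :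
    K.KEmbOn T φ := by
  have htup : ∀ {n : ℕ} (x : Fin n → T), ∃ i, ∀ k, (x k : N) ∈ C i := by
    intro n x
    choose i hi using fun k => hU (x k) (x k).2
    obtain ⟨j, hj⟩ := Finite.exists_le i
    exact ⟨j, fun k => hmono (hj k) (hi k)⟩
  have hinj : Function.Injective fun x : T => φ x := by
    intro x y hxy
    obtain ⟨i, hi⟩ := hU x x.2
    obtain ⟨j, hj⟩ := hU y y.2
    exact Subtype.ext ((h (max i j)).injOn (hmono (le_max_left i j) hi)
      (hmono (le_max_right i j) hj) hxy)
  let e : T ↪[L] P :=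
    { toFun := fun x => φ x
      inj' := hinj
      map_fun' := by
        intro n f x
        obtain ⟨i, hi⟩ := htup x
        obtain ⟨d, -, hd⟩ := h i
        have h1 := d.map_fun f (fun k => (⟨x k, hi k⟩ : C i))
        rw [hd] at h1
        refine h1.trans (congrArg _ ?_)
        funext k
        exact hd _
      map_rel' := by
        intro n R x
        obtain ⟨i, hi⟩ := htup x
        obtain ⟨d, -, hd⟩ := h i
        have h1 := d.map_rel R (fun k => (⟨x k, hi k⟩ : C i))
        have h2 : (d ∘ fun k => (⟨x k, hi k⟩ : C i)) = fun k => φ (x k) := by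
          funext k
          exact hd _
        rw [h2] at h1
        exact h1 }
  refine ⟨e, ⟨(K.mem_of_strong _ hT).1, ?_⟩, fun x => rfl⟩
  refine strong_of_chain_below P.mem (c := Set.range fun i => img φ (C i)) ?_
    (Set.range_nonempty _) ?_ ?_
  · rintro _ ⟨i, rfl⟩ _ ⟨j, rfl⟩ -
    exact (le_total i j).imp
      (fun hij => Substructure.closure_mono (Set.image_mono (hmono hij)))
      (fun hij => Substructure.closure_mono (Set.image_mono (hmono hij)))
  · rintro _ ⟨i, rfl⟩
    exact (h i).strong_img
  · ext y
    simp only [Set.mem_iUnion, Set.mem_range, exists_prop, exists_exists_eq_and]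
    constructor
    · rintro ⟨x, rfl⟩
      obtain ⟨i, hi⟩ := hU x x.2
      exact ⟨i, (h i).mem_img.2 ⟨x, hi, rfl⟩⟩
    · rintro ⟨i, hi⟩
      obtain ⟨x, hx, rfl⟩ := (h i).mem_img.1 hi
      exact ⟨⟨x, hle i hx⟩, rfl⟩

section Construction

variable {J : Type*} {A : J → K.Model}

/-- `h` maps the `i`-th members of the chains `C k` into the model `P` of cardinality `ν i`. -/
structure IsStage (C : ∀ k, Ordinal.{u} → L.Substructure (A k)) (ν : Ordinal.{u} → Cardinal.{u})
    (Φ : ∀ (_ : Ordinal.{u}) (P : K.Model), (∀ k, A k → P) → Prop) (i : Ordinal.{u}) (P : K.Model)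
    (h : ∀ k, A k → P) : Prop where
  card : #P = ν i
  emb : ∀ k, K.KEmbOn (C k i) (h k)
  prop : Φ i P h

/-- `g` maps `P` into `P'`, in agreement with the maps of the `i`-th members of the chains. -/
def StageLE (C : ∀ k, Ordinal.{u} → L.Substructure (A k)) (i : Ordinal.{u}) {P P' : K.Model}
    (h : ∀ k, A k → P) (h' : ∀ k, A k → P') (g : P ↪[L] P') : Prop :=
  K.IsKEmb g ∧ ∀ k, ∀ x ∈ C k i, g (h k x) = h' k x

/-- The chains `C k` are increasing and continuous chains of strong submodels of cardinalities
`ν i < lam`. -/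
structure IsTower (C : ∀ k, Ordinal.{u} → L.Substructure (A k)) (ν : Ordinal.{u} → Cardinal.{u})
    (lam : Cardinal.{u}) : Prop where
  mono : ∀ k, Monotone (C k)
  strong : ∀ k i, K.Strong (C k i)
  limit : ∀ k δ, Order.IsSuccLimit δ → ∀ x ∈ C k δ, ∃ j < δ, x ∈ C k j
  card : ∀ k i, #(C k i) = ν i
  card_lt : ∀ i < lam.ord, ν i < lam
  ord_card_le : ∀ i ≤ lam.ord, i.card ≤ ν i
  aleph0_le : ∀ i, ℵ₀ ≤ ν i

variable {C : ∀ k, Ordinal.{u} → L.Substructure (A k)} {ν : Ordinal.{u} → Cardinal.{u}}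
  {Φ : ∀ (_ : Ordinal.{u}) (P : K.Model), (∀ k, A k → P) → Prop} {lam : Cardinal.{u}}

/-- A stage whose model is embedded in the set `Ω`. -/
structure StageIn (C : ∀ k, Ordinal.{u} → L.Substructure (A k)) (ν : Ordinal.{u} → Cardinal.{u})
    (Φ : ∀ (_ : Ordinal.{u}) (P : K.Model), (∀ k, A k → P) → Prop) (lam : Cardinal.{u})
    (Ω : Type u) where
  /-- the length -/
  i : Ordinal.{u}
  le : i ≤ lam.ord
  /-- the model -/
  P : K.Model
  /-- the maps -/
  h : ∀ k, A k → P
  stage : IsStage C ν Φ i P h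
  /-- the embedding in `Ω` -/
  e : P → Ω
  inj : Function.Injective e

variable {Ω : Type u}

/-- A later stage. -/
def StageIn.Lt (p q : StageIn C ν Φ lam Ω) : Prop :=
  p.i < q.i ∧ ∃ g : p.P ↪[L] q.P, StageLE C p.i p.h q.h g ∧ ∀ x, q.e (g x) = p.e x

theorem StageIn.Lt.trans (hC : IsTower C ν lam) {p q r : StageIn C ν Φ lam Ω} (hpq : p.Lt q)
    (hqr : q.Lt r) : p.Lt r := by
  obtain ⟨hi, g, ⟨hg, hg'⟩, hge⟩ := hpq
  obtain ⟨hj, f, ⟨hf, hf'⟩, hfe⟩ := hqr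
  refine ⟨hi.trans hj, f.comp g, ⟨hf.comp hg, fun k x hx => ?_⟩, fun x => (hfe _).trans (hge x)⟩
  rw [Embedding.comp_apply, hg' k x hx, hf' k x (hC.mono k hi.le hx)]

/-- Chains of stages are bounded. -/
theorem StageIn.exists_bound [Nonempty J] (hC : IsTower C ν lam)
    (hlimit : ∀ δ ≤ lam.ord, Order.IsSuccLimit δ → ∀ (U : K.Model) (h : ∀ k, A k → U), #U = ν δ →
      (∀ k, K.KEmbOn (C k δ) (h k)) →
      (∀ i < δ, ∃ j, i ≤ j ∧ j < δ ∧ ∃ (P : K.Model) (h' : ∀ k, A k → P) (g : P ↪[L] U),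
        IsStage C ν Φ j P h' ∧ StageLE C j h' h g) → Φ δ U h)
    {c : Set (StageIn C ν Φ lam Ω)} (hc : IsChain (fun p q => p = q ∨ p.Lt q) c)
    (hne : c.Nonempty) : ∃ q, ∀ p ∈ c, p = q ∨ p.Lt q := by
  classical
  -- A last stage bounds the chain. Otherwise the supremum of the lengths is a limit, and the union
  -- of the models is a stage of that length.
  by_cases hmax : ∃ m ∈ c, ∀ p ∈ c, p = m ∨ p.Lt m
  · obtain ⟨m, -, hm⟩ := hmax
    exact ⟨m, hm⟩
  push Not at hmax
  have hlt : ∀ p ∈ c, ∃ q ∈ c, p.Lt q := by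
    intro p hp
    obtain ⟨q, hq, hne, hnl⟩ := hmax p hp
    rcases hc hp hq (Ne.symm hne) with (h | h) | (h | h)
    · exact (hne h.symm).elim
    · exact ⟨q, hq, h⟩
    · exact (hne h).elim
    · exact (hnl h).elim
  have hmon : ∀ p ∈ c, ∀ q ∈ c, p.i = q.i → p = q := by
    intro p hp q hq hi
    by_contra hpq
    rcases hc hp hq hpq with (h | h) | (h | h)
    · exact hpq h
    · exact h.1.ne hi
    · exact hpq h.symm
    · exact h.1.ne hi.symm
  have hlti : ∀ p ∈ c, ∀ q ∈ c, p.i < q.i → p.Lt q := by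
    intro p hp q hq hi
    rcases hc hp hq (fun h => hi.ne (congrArg StageIn.i h)) with (h | h) | (h | h)
    · exact (hi.ne (congrArg StageIn.i h)).elim
    · exact h
    · exact (hi.ne (congrArg StageIn.i h.symm)).elim
    · exact (h.1.not_gt hi).elim
  have hbdd : BddAbove (StageIn.i '' c) := ⟨lam.ord, by rintro _ ⟨p, -, rfl⟩; exact p.le⟩
  set δ := sSup (StageIn.i '' c) with hδ
  have hle : ∀ p ∈ c, p.i < δ := by
    intro p hp
    obtain ⟨q, hq, hpq⟩ := hlt p hp
    exact hpq.1.trans_le (le_csSup hbdd ⟨q, hq, rfl⟩)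
  have hcof : ∀ a < δ, ∃ p ∈ c, a < p.i := by
    intro a ha
    obtain ⟨_, ⟨p, hp, rfl⟩, h⟩ := exists_lt_of_lt_csSup (hne.image _) ha
    exact ⟨p, hp, h⟩
  have hδlam : δ ≤ lam.ord := csSup_le (hne.image _) (by rintro _ ⟨p, -, rfl⟩; exact p.le)
  have hδlim : Order.IsSuccLimit δ := by
    obtain ⟨p, hp⟩ := hne
    refine ⟨fun h => (h (hle p hp).le).not_gt (hle p hp), Order.isSuccPrelimit_of_succ_lt ?_⟩
    intro a ha
    obtain ⟨q, hq, h⟩ := hcof a ha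
    exact (Order.succ_le_of_lt h).trans_lt (hle q hq)
  -- Comparison of lengths. It is total, and on the chain it agrees with the order of the stages,
  -- because two stages of equal length coincide.
  let po : Preorder c :=
    { le := fun p q => p.1.i ≤ q.1.i
      le_refl := fun p => le_rfl
      le_trans := fun p q r h h' => le_trans h h' }
  have htot : ∀ p q : c, p ≤ q ∨ q ≤ p := fun p q => le_total p.1.i q.1.i
  have hdir : IsDirectedOrder c := ⟨fun p q => (htot p q).elim (fun h => ⟨q, h, le_rfl⟩)
    fun h => ⟨p, le_rfl, h⟩⟩
  have hcne : Nonempty c := hne.to_subtype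
  have hg : ∀ p q : c, p ≤ q → ∃ g : p.1.P ↪[L] q.1.P,
      StageLE C p.1.i p.1.h q.1.h g ∧ ∀ x, q.1.e (g x) = p.1.e x := by
    intro p q hpq
    rcases (show p.1.i ≤ q.1.i from hpq).lt_or_eq with h | h
    · exact (hlti p.1 p.2 q.1 q.2 h).2
    · obtain rfl : p = q := Subtype.ext (hmon p.1 p.2 q.1 q.2 h)
      exact ⟨Embedding.refl L _, ⟨isKEmb_refl p.1.P.mem, fun k x _ => rfl⟩, fun x => rfl⟩
  obtain ⟨U, e, G, he, hG, heG, hsurj⟩ := exists_union_model (fun p : c => p.1.P)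
    (fun p => p.1.e) (fun p => p.1.inj) htot fun p q hpq => by
      obtain ⟨g, hg1, hg2⟩ := hg p q hpq
      exact ⟨g, hg1.1, hg2⟩
  have hUne : Nonempty U := by
    have p := Classical.choice hcne
    have : Infinite p.1.P := Cardinal.infinite_iff.2 (by
      rw [p.1.stage.card]; exact hC.aleph0_le _)
    exact ⟨G p (Classical.arbitrary _)⟩
  have hglue : ∀ k, ∃ φ : A k → U, ∀ (p : c) x, x ∈ C k p.1.i → φ x = G p (p.1.h k x) := by
    intro k
    have hcomp : ∀ p q : c, p ≤ q → ∀ x ∈ C k p.1.i, G p (p.1.h k x) = G q (q.1.h k x) := by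
      intro p q hpq x hx
      obtain ⟨g, hg1, hg2⟩ := hg p q hpq
      rw [← hg1.2 k x hx]
      apply he
      rw [heG, heG, hg2]
    obtain ⟨φ, hφ⟩ := exists_glue (fun p : c => (C k p.1.i : Set (A k)))
      (fun p x => G p (p.1.h k x)) fun p q x hp hq => (htot p q).elim
        (fun h => hcomp p q h x hp) fun h => (hcomp q p h x hq).symm
    exact ⟨φ, fun p x hx => hφ p x hx⟩
  choose h hh using hglue
  have hcofle : ∀ k, ∀ x ∈ C k δ, ∃ p : c, x ∈ C k p.1.i := by
    intro k x hx
    obtain ⟨j, hj, hx⟩ := hC.limit k δ hδlim x hx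
    obtain ⟨p, hp, hjp⟩ := hcof j hj
    exact ⟨⟨p, hp⟩, hC.mono k hjp.le hx⟩
  have hemb : ∀ k, K.KEmbOn (C k δ) (h k) := by
    intro k
    let D : Set Ordinal.{u} := StageIn.i '' c
    have : Nonempty D := (hne.image _).to_subtype
    refine kEmbOn_of_chain (hC.strong k δ) (ι := D) (C := fun i => C k i.1)
      (fun i j hij => hC.mono k hij) (fun x hx => ?_) (fun i => ?_) (fun i => ?_)
    · obtain ⟨p, hp⟩ := hcofle k x hx
      exact ⟨⟨p.1.i, p.1, p.2, rfl⟩, hp⟩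
    · obtain ⟨_, p, hp, rfl⟩ := i
      exact hC.mono k (hle p hp).le
    · obtain ⟨_, p, hp, rfl⟩ := i
      exact ((p.stage.emb k).comp_emb (hG ⟨p, hp⟩)).congr fun x hx => hh k ⟨p, hp⟩ x hx
  have hcard : #U = ν δ := by
    refine le_antisymm ?_ ?_
    -- The union has at most `δ.card ≤ ν δ` members, each of cardinality at most `ν δ`.
    · let V : Ordinal.{u} → Set U := fun j => {y | ∃ p : c, p.1.i = j ∧ y ∈ Set.range (G p)}
      have hV : Set.univ ⊆ ⋃ j ∈ Set.Iio δ, V j := by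
        intro y _
        obtain ⟨p, x, hx⟩ := hsurj y
        exact Set.mem_iUnion₂.2 ⟨p.1.i, hle p.1 p.2, p, rfl, x, hx⟩
      rw [← Cardinal.mk_univ]
      refine (Cardinal.mk_le_mk_of_subset hV).trans
        (mk_iUnion_Iio_le (hC.aleph0_le δ) (hC.ord_card_le δ hδlam) fun j hj => ?_)
      by_cases hp : ∃ p : c, p.1.i = j
      · obtain ⟨p, rfl⟩ := hp
        have : V p.1.i ⊆ Set.range (G p) := by
          rintro y ⟨q, hq, hy⟩
          obtain rfl : q = p := Subtype.ext (hmon _ q.2 _ p.2 hq)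
          exact hy
        refine (Cardinal.mk_le_mk_of_subset this).trans (Cardinal.mk_range_le.trans ?_)
        have k := Classical.arbitrary J
        rw [p.1.stage.card, ← hC.card k, ← hC.card k]
        exact Cardinal.mk_le_mk_of_subset (hC.mono k hj.le)
      · have : V j = ∅ := by
          ext y
          simp only [Set.mem_empty_iff_false, iff_false]
          rintro ⟨p, hpj, -⟩
          exact hp ⟨p, hpj⟩
        rw [this]
        simp
    · have k := Classical.arbitrary J
      rw [← hC.card k, ← (hemb k).mk_img]
      exact Cardinal.mk_subtype_le _
  have hstageLE : ∀ p : c, StageLE C p.1.i p.1.h h (G p) := fun p =>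
    ⟨hG p, fun k x hx => (hh k p x hx).symm⟩
  have hΦ : Φ δ U h := hlimit δ hδlam hδlim U h hcard hemb fun a ha => by
    obtain ⟨p, hp, hap⟩ := hcof a ha
    exact ⟨p.i, hap.le, hle p hp, p.P, p.h, G ⟨p, hp⟩, p.stage, hstageLE ⟨p, hp⟩⟩
  exact ⟨⟨δ, hδlam, U, h, ⟨hcard, hemb, hΦ⟩, e, he⟩, fun p hp =>
    Or.inr ⟨hle p hp, G ⟨p, hp⟩, hstageLE ⟨p, hp⟩, heG ⟨p, hp⟩⟩⟩

/-- Transfinite construction of a stage of length `lam.ord`. -/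
theorem exists_stage [Nonempty J] (hlam : ℵ₀ ≤ lam) (hC : IsTower C ν lam)
    (hzero : ∃ P h, IsStage C ν Φ 0 P h)
    (hsucc : ∀ i < lam.ord, ∀ (P : K.Model) (h : ∀ k, A k → P), IsStage C ν Φ i P h →
      ∃ (P' : K.Model) (h' : ∀ k, A k → P') (g : P ↪[L] P'), IsStage C ν Φ (i + 1) P' h' ∧
        StageLE C i h h' g)
    (hlimit : ∀ δ ≤ lam.ord, Order.IsSuccLimit δ → ∀ (U : K.Model) (h : ∀ k, A k → U), #U = ν δ →
      (∀ k, K.KEmbOn (C k δ) (h k)) →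
      (∀ i < δ, ∃ j, i ≤ j ∧ j < δ ∧ ∃ (P : K.Model) (h' : ∀ k, A k → P) (g : P ↪[L] U),
        IsStage C ν Φ j P h' ∧ StageLE C j h' h g) → Φ δ U h) :
    ∃ P h, IsStage C ν Φ lam.ord P h := by
  have hΩ : #lam.out = lam := Cardinal.mk_out lam
  have hlim : Order.IsSuccLimit lam.ord := Cardinal.isSuccLimit_ord hlam
  obtain ⟨P₀, h₀, hP₀⟩ := hzero
  have hP₀c : #P₀ ≤ #lam.out := by
    rw [hΩ, hP₀.card]
    exact (hC.card_lt 0 hlim.bot_lt).le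
  obtain ⟨e₀⟩ := hP₀c
  let p₀ : StageIn C ν Φ lam lam.out := ⟨0, zero_le, P₀, h₀, hP₀, e₀, e₀.injective⟩
  -- Because all models are embedded in the one set `lam.out`, the maps between the stages of a
  -- chain commute. Chains therefore have unions, and Zorn's lemma replaces a recursion with
  -- choices.
  obtain ⟨m, hm⟩ := exists_maximal_of_chains_bounded
    (r := fun p q : StageIn C ν Φ lam lam.out => p = q ∨ p.Lt q)
    (fun c hc => by
      rcases c.eq_empty_or_nonempty with rfl | hne
      · exact ⟨p₀, fun p hp => hp.elim⟩
      · exact StageIn.exists_bound hC hlimit hc hne)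
    (by
      rintro p q r (rfl | hpq) (rfl | hqr)
      · exact Or.inl rfl
      · exact Or.inr hqr
      · exact Or.inr hpq
      · exact Or.inr (hpq.trans hC hqr))
  rcases m.le.lt_or_eq with hlt | heq
  · exfalso
    obtain ⟨P', h', g, hst, hg⟩ := hsucc m.i hlt m.P m.h m.stage
    have hlt' := hlim.add_one_lt hlt
    -- There is room in `lam.out`, since a stage before `lam.ord` has fewer than `lam` elements.
    obtain ⟨e', he', hee⟩ := exists_extension_injective g.injective m.inj (by rw [hΩ]; exact hlam)
      (by rw [hΩ, m.stage.card]; exact hC.card_lt _ hlt)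
      (by rw [hΩ, hst.card]; exact (hC.card_lt _ hlt').le)
    have hltm : m.i < m.i + 1 := Order.lt_add_one_iff.2 le_rfl
    rcases hm ⟨m.i + 1, hlt'.le, P', h', hst, e', he'⟩ (Or.inr ⟨hltm, g, hg, hee⟩) with h | h
    · exact hltm.ne' (congrArg StageIn.i h)
    · exact h.1.not_gt hltm
  · exact ⟨m.P, m.h, heq ▸ m.stage⟩

end Construction

end AEC

/-! ### The goodness properties in terms of partial maps. -/

namespace AEC

open FirstOrder.Language

variable {L : FirstOrder.Language.{u, u}} {K : AEC L} {N P Q : K.Model} {T E : L.Substructure N}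
  {φ : N → P} {μ : Cardinal.{u}}

theorem nonempty_of_card (hμ : K.LS ≤ μ) (h : #P = μ) : Nonempty P := by
  have : Infinite P := Cardinal.infinite_iff.2 (h ▸ K.aleph0_le_LS.trans hμ)
  infer_instance

theorem exists_kEmbOn [Nonempty P] {f : T ↪[L] P} (hf : K.IsKEmb f) :
    ∃ χ : N → P, K.KEmbOn T χ ∧ (∀ x : T, χ x = f x) ∧ img χ T = f.toHom.range := by
  obtain ⟨χ, hχ⟩ := exists_glue (fun _ : Unit => (T : Set N)) (fun _ x => f x)
    fun _ _ _ _ _ => rfl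
  have h : ∀ x : T, f x = χ x := fun x => (hχ () x x.2).symm
  exact ⟨χ, ⟨f, hf, h⟩, fun x => (h x).symm, KEmbOn.img_eq_range h⟩

theorem AP.exists_kEmbOn (hAP : K.AP μ) (hμ : K.LS ≤ μ) (hT : K.Strong T) (hTc : #T = μ)
    (hE : K.Strong E) (hEc : #E = μ) (hTE : T ≤ E) (hP : #P = μ) (hφ : K.KEmbOn T φ) :
    ∃ (Q : K.Model) (p : P ↪[L] Q) (k : N → Q), #Q = μ ∧ K.IsKEmb p ∧ K.KEmbOn E k ∧
      ∀ x ∈ T, p (φ x) = k x := by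
  obtain ⟨e, he, he'⟩ := hφ
  obtain ⟨Q, p, k₀, hQ, hp, hk₀, hpk⟩ := hAP (N.sub T hT) P (N.sub E hE) hTc hP hEc e
    (Substructure.inclusion hTE) he (isKEmb_inclusion hTE hT hE)
  have := nonempty_of_card hμ hQ
  obtain ⟨k, hk, hkk, -⟩ := AEC.exists_kEmbOn (N := N) (T := E) hk₀
  refine ⟨Q, p, k, hQ, hp, hk, fun x hx => ?_⟩
  have h1 := hpk ⟨x, hx⟩
  rw [he'] at h1
  exact h1.trans (hkk ⟨x, hTE hx⟩).symm

/-- Weak uniqueness asks for isomorphisms between faces as submodels of the last models, whereas `φ`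
is a map of the ambient models. `F` is the restriction of `φ` in the required form. -/
theorem exists_equiv_comap {T' E' : L.Substructure P} (hφ : K.KEmbOn T φ) (hTE : T ≤ E)
    (hT' : T' = img φ T) (hTE' : T' ≤ E') :
    ∃ F : (T.comap E.subtype.toHom) ≃[L] (T'.comap E'.subtype.toHom),
      ∀ x, ((F x : E') : P) = φ (x : E) := by
  obtain ⟨e, he, he'⟩ := hφ
  rw [KEmbOn.img_eq_range he'] at hT'
  let ι : (T.comap E.subtype.toHom) ↪[L] T :=
    Embedding.codRestrict T (E.subtype.comp (T.comap E.subtype.toHom).subtype) fun x => x.2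
  have hmem : ∀ x, (e.comp ι) x ∈ E' := fun x => hTE' (by rw [hT']; exact ⟨_, rfl⟩)
  let f : (T.comap E.subtype.toHom) ↪[L] E' := (e.comp ι).codRestrict E' hmem
  have hf : ∀ x, (f x : P) = φ (x : E) := fun x => he' _
  have hr : T'.comap E'.subtype.toHom = f.toHom.range := by
    ext y
    constructor
    · intro hy
      have hy' : (y : P) ∈ T' := hy
      rw [hT'] at hy'
      obtain ⟨x, hx⟩ := hy'
      refine ⟨⟨⟨x, hTE x.2⟩, x.2⟩, Subtype.ext ?_⟩
      exact hx
    · rintro ⟨x, rfl⟩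
      change (f x : P) ∈ T'
      rw [hf, hT', ← he' ⟨x.1.1, x.2⟩]
      exact ⟨_, rfl⟩
  rw [hr]
  exact ⟨f.equivRange, hf⟩

end AEC

namespace WeakForking

open FirstOrder.Language

variable {L : FirstOrder.Language.{u, u}} {K : AEC L} {W : WeakForking K} {N P Q : K.Model}
  {μ : Cardinal.{u}} {n : ℕ} {φ : N → P}

/-- Weak uniqueness for systems inside models, and a map of the boundaries. -/
theorem HasWeakUniqueness.exists_kEmbOn (h : W.HasWeakUniqueness μ n) (hμ : K.LS ≤ μ)
    {S : Finset ℕ → L.Substructure N} {S' : Finset ℕ → L.Substructure P}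
    (HS : W.StableIn μ (Finset.range n) N S) (HS' : W.StableIn μ (Finset.range n) P S')
    (hφ : ∀ s, s ⊂ Finset.range n → K.KEmbOn (S s) φ)
    (himg : ∀ s, s ⊂ Finset.range n → S' s = img φ (S s)) :
    ∃ (M : K.Model) (g : N → M) (g' : P → M), #M = μ ∧ K.KEmbOn (S (Finset.range n)) g ∧
      K.KEmbOn (S' (Finset.range n)) g' ∧
      ∀ s, s ⊂ Finset.range n → ∀ x ∈ S s, g x = g' (φ x) := by
  choose F hF using fun s (hs : s ⊂ Finset.range n) => exists_equiv_comap (hφ s hs)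
    (HS.mono hs.subset subset_rfl) (himg s hs) (HS'.mono hs.subset subset_rfl)
  obtain ⟨M, g, g', hM, hg, hg', hgg⟩ := h _ _ _ _ HS.isStable_comap HS'.isStable_comap F (by
    intro s t hs ht hst x y hxy
    apply Subtype.ext
    rw [hF, hF, hxy])
  have := nonempty_of_card hμ hM
  obtain ⟨k, hk, hkk, -⟩ := AEC.exists_kEmbOn hg
  obtain ⟨k', hk', hkk', -⟩ := AEC.exists_kEmbOn hg'
  refine ⟨M, k, k', hM, hk, hk', fun s hs x hx => ?_⟩
  have hx' := HS.mono hs.subset subset_rfl hx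
  have h1 := hgg s hs ⟨⟨x, hx'⟩, hx⟩
  refine (hkk ⟨x, hx'⟩).trans (h1.trans ?_)
  rw [← hkk', hF]

/-- A maximal proper face of a stable system may be replaced by a smaller model. -/
theorem StableWrt.update_range {T : Finset ℕ → L.Substructure P}
    (H : W.StableIn μ (Finset.range (n + 1)) P T) {T₀ : L.Substructure P} (hT₀ : K.Strong T₀)
    (hc : #T₀ = μ) (hle : T₀ ≤ T (Finset.range n)) (hge : ∀ s, s ⊂ Finset.range n → T s ≤ T₀) :
    W.StableIn μ (Finset.range (n + 1)) P (Function.update T (Finset.range n) T₀) := by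
  have hn : Finset.range n ⊂ Finset.range (n + 1) := by
    rw [Finset.range_add_one]
    exact Finset.ssubset_insert Finset.notMem_range_self
  have hself : Function.update T (Finset.range n) T₀ (Finset.range n) = T₀ :=
    Function.update_self _ _ _
  have hother : ∀ w, w ≠ Finset.range n → Function.update T (Finset.range n) T₀ w = T w :=
    fun w hw => Function.update_of_ne hw _ _
  have hcases : ∀ w, w ⊆ Finset.range (n + 1) → Finset.range n ⊆ w →
      w = Finset.range n ∨ w = Finset.range (n + 1) := by
    intro w hw hnw
    by_cases hnw' : n ∈ w
    · right
      refine subset_antisymm hw ?_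
      rw [Finset.range_add_one]
      exact Finset.insert_subset hnw' hnw
    · left
      refine subset_antisymm ?_ hnw
      rwa [Finset.range_add_one, Finset.subset_insert_iff_of_notMem hnw'] at hw
  -- `range n` occurs in no boundary of a proper face, so the replacement leaves all bases
  -- unchanged.
  have hss : ∀ t w, t ⊂ Finset.range (n + 1) → w ⊂ t → w ≠ Finset.range n := by
    rintro t w ht hw rfl
    rcases hcases t ht.subset hw.subset with rfl | rfl
    · exact hw.ne rfl
    · exact ht.ne rfl
  have hleT : ∀ w, Function.update T (Finset.range n) T₀ w ≤ T w := by
    intro w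
    by_cases hw : w = Finset.range n
    · subst hw; rwa [hself]
    · rw [hother w hw]
  -- If `w` does not contain `range n`, the face at `range n ∩ w` lies in `T₀` by `hge`. Shrinking
  -- `T (range n)` to `T₀` then does not change its intersection with `T w`.
  have hinter : ∀ w, w ⊆ Finset.range (n + 1) → w ≠ Finset.range n →
      Function.update T (Finset.range n) T₀ (Finset.range n ∩ w) = T₀ ⊓ T w := by
    intro w hw hwn
    by_cases hnw : Finset.range n ⊆ w
    · rw [Finset.inter_eq_left.2 hnw, hself]
      exact (inf_eq_left.2 (hle.trans (H.mono hnw hw))).symm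
    · have hlt : Finset.range n ∩ w ⊂ Finset.range n :=
        Finset.ssubset_iff_subset_ne.2 ⟨Finset.inter_subset_left, fun h => hnw
          (Finset.inter_eq_left.1 h)⟩
      rw [hother _ hlt.ne]
      refine le_antisymm (le_inf (hge _ hlt) (H.mono Finset.inter_subset_right hw)) ?_
      rw [H.inter hn.subset hw]
      exact inf_le_inf_right _ hle
  have hbase : ∀ t, t ⊂ Finset.range (n + 1) → t.Nonempty →
      K.IsAmalgBase μ P t.ssubsets (Function.update T (Finset.range n) T₀) := fun t ht hne =>
    (isAmalgBase_congr fun w hw => hother w (hss t w ht (Finset.mem_ssubsets.1 hw))).2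
      (H.base t ht hne)
  refine ⟨⟨H.sys.nonempty, H.sys.down, fun w hw => ?_, fun w hw v hv hwv => ?_,
    fun w hw v hv => ?_, fun w hw => ?_⟩, hbase, fun t ht hne => ?_⟩
  · by_cases h : w = Finset.range n
    · subst h; rwa [hself]
    · rw [hother w h]; exact H.sys.strong w hw
  · by_cases h : v = Finset.range n
    · subst h
      rw [hself]
      rcases eq_or_ssubset_of_subset hwv with rfl | hlt
      · rw [hself]
      · rw [hother w hlt.ne]
        exact hge w hlt
    · rw [hother v h]
      exact (hleT w).trans (H.sys.mono w hw v hv hwv)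
  · by_cases h : w = Finset.range n
    · subst h
      by_cases h' : v = Finset.range n
      · subst h'
        rw [Finset.inter_self, inf_idem]
      · rw [hinter v (Finset.mem_powerset.1 hv) h', hself, hother v h']
    · by_cases h' : v = Finset.range n
      · subst h'
        rw [Finset.inter_comm, hinter w (Finset.mem_powerset.1 hw) h, hself, hother w h, inf_comm]
      · have h1 : w ∩ v ≠ Finset.range n := by
          intro heq
          have h2 : Finset.range n ⊆ w := heq ▸ Finset.inter_subset_left
          have h3 : Finset.range n ⊆ v := heq ▸ Finset.inter_subset_right
          have h4 := (hcases w (Finset.mem_powerset.1 hw) h2).resolve_left h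
          have h5 := (hcases v (Finset.mem_powerset.1 hv) h3).resolve_left h'
          rw [h4, h5, Finset.inter_self] at heq
          exact hn.ne heq.symm
        rw [hother _ h1, hother w h, hother v h']
        exact H.sys.inter w hw v hv
  · by_cases h : w = Finset.range n
    · subst h; rwa [hself]
    · rw [hother w h]; exact H.sys.card w hw
  · have hb : bdry (Function.update T (Finset.range n) T₀) t = bdry T t := by
      ext x
      simp only [mem_bdry]
      exact exists_congr fun w => and_congr_right fun hw => by rw [hother w (hss t w ht hw)]
    rw [hb]
    refine (H.indep t ht hne).mono (H.base t ht hne).ab_bdry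
      (fun x hx => Or.inl (hleT t hx)) ?_
    rintro x ⟨w, hw, htw, hx⟩
    exact Or.inl ⟨w, hw, htw, hleT w hx⟩

/-- Amalgamation over the boundary of a stable system, when the maximal face of the one system is
larger than that of the other. -/
theorem HasWeakUniqueness.exists_absorb (h : W.HasWeakUniqueness μ (n + 1)) (hμ : K.LS ≤ μ)
    {D : Finset ℕ → L.Substructure N} {T : Finset ℕ → L.Substructure P}
    (HD : W.StableIn μ (Finset.range (n + 1)) N D) (HT : W.IsStable μ (Finset.range (n + 1)) P T)
    (hφ : ∀ t, t ⊂ Finset.range (n + 1) → K.KEmbOn (D t) φ)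
    (himg : ∀ t, t ⊂ Finset.range (n + 1) → t ≠ Finset.range n → T t = img φ (D t))
    (hsub : img φ (D (Finset.range n)) ≤ T (Finset.range n)) :
    ∃ (M : K.Model) (k : N → M) (g : P ↪[L] M), #M = μ ∧ K.IsKEmb g ∧
      K.KEmbOn (D (Finset.range (n + 1))) k ∧
      ∀ t, t ⊂ Finset.range (n + 1) → ∀ x ∈ D t, k x = g (φ x) := by
  have hn : Finset.range n ⊂ Finset.range (n + 1) := by
    rw [Finset.range_add_one]
    exact Finset.ssubset_insert Finset.notMem_range_self
  obtain ⟨HT', htop⟩ := isStable_iff.1 HT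
  -- `T (range n)` is cut down to the image of `D (range n)`. Now `φ` maps the faces of `D` onto
  -- those of the new system, and weak uniqueness applies.
  have HU := HT'.update_range (hφ _ hn).strong_img
    ((hφ _ hn).mk_img.trans (HD.card hn.subset)) hsub fun s hs => by
      rw [himg s (hs.trans hn) hs.ne]
      exact Substructure.closure_mono (Set.image_mono (HD.mono hs.subset hn.subset))
  obtain ⟨M, k, g', hM, hk, hg', hkg⟩ := h.exists_kEmbOn hμ HD HU hφ fun t ht => by
    by_cases htn : t = Finset.range n
    · subst htn
      rw [Function.update_self]
    · rw [Function.update_of_ne htn]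
      exact himg t ht htn
  rw [Function.update_of_ne hn.ne', htop] at hg'
  obtain ⟨g, hg, hgg⟩ := hg'.exists_embedding
  exact ⟨M, k, g, hM, hg, hk, fun t ht x hx => (hkg t ht x hx).trans (hgg _).symm⟩

/-- Existence for a system of dimension `n + 1` whose face `range n` is `P` and whose other faces
come from `N`. -/
theorem HasExistence.exists_step (h : W.HasExistence μ (n + 1)) (hμ : K.LS ≤ μ)
    {E : L.Substructure N} (hE : K.Strong E) {p : P ↪[L] Q} (hp : K.IsKEmb p) {k : N → Q}
    (hk : K.KEmbOn E k) {D : Finset ℕ → L.Substructure N}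
    (hDE : ∀ w, w ⊂ Finset.range (n + 1) → w ≠ Finset.range n → D w ≤ E)
    (hDs : ∀ w, w ⊂ Finset.range (n + 1) → w ≠ Finset.range n → K.Strong (D w))
    (hinter : ∀ w, w ⊂ Finset.range (n + 1) → w ≠ Finset.range n →
      ∀ v, v ⊂ Finset.range (n + 1) → v ≠ Finset.range n → D (w ∩ v) = D w ⊓ D v)
    (HD : ∀ u, u ⊂ Finset.range n → W.StableIn μ (insert n u) N D)
    {S : Finset ℕ → L.Substructure P} (HP : W.IsStable μ (Finset.range n) P S)
    (hS : ∀ s, s ⊂ Finset.range n → (S s).map p.toHom = img k (D s)) :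
    ∃ (P' : K.Model) (T : Finset ℕ → L.Substructure P') (g : P ↪[L] P') (φ : N → P'),
      W.IsStable μ (Finset.range (n + 1)) P' T ∧ K.IsKEmb g ∧
      g.toHom.range = T (Finset.range n) ∧
      (∀ w, w ⊂ Finset.range (n + 1) → w ≠ Finset.range n →
        K.KEmbOn (D w) φ ∧ T w = img φ (D w)) ∧
      ∀ u, u ⊂ Finset.range n → ∀ x ∈ D u, ∀ y, p y = k x → φ x = g y := by
  classical
  have hn : Finset.range n ⊂ Finset.range (n + 1) := by
    rw [Finset.range_add_one]
    exact Finset.ssubset_insert Finset.notMem_range_self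
  have hcases : ∀ w, w ⊂ Finset.range (n + 1) → Finset.range n ⊆ w → w = Finset.range n := by
    intro w hw hnw
    by_contra hne
    have h1 := Finset.card_lt_card hw
    have h2 := Finset.card_lt_card (Finset.ssubset_iff_subset_ne.2 ⟨hnw, Ne.symm hne⟩)
    simp only [Finset.card_range] at h1 h2
    omega
  obtain ⟨HP', htop⟩ := isStable_iff.1 HP
  -- `Q` holds all the models at once but need not contain a stable `𝒫(n + 1)`-system. Existence
  -- only asks the proper faces to be stable: those through `n` are images of faces of `D`, and the
  -- others are images of faces of `S`.
  let F : Finset ℕ → L.Substructure Q := fun w =>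
    if w = Finset.range n then p.toHom.range else img k (D w)
  have hFn : F (Finset.range n) = p.toHom.range := if_pos rfl
  have hFo : ∀ w, w ≠ Finset.range n → F w = img k (D w) := fun w hw => if_neg hw
  have hF : ∀ t, t ⊂ Finset.range (n + 1) → W.StableIn μ t Q F := by
    intro t ht
    by_cases hnt : n ∈ t
    · have hut : t.erase n ⊂ Finset.range n := by
        refine Finset.ssubset_iff_subset_ne.2 ⟨?_, fun heq => ht.ne ?_⟩
        · have := ht.subset
          rwa [Finset.range_add_one, Finset.subset_insert_iff] at this
        · rw [Finset.range_add_one, ← heq, Finset.insert_erase hnt]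
      have hwn : ∀ w, w ⊆ t → w ≠ Finset.range n := by
        rintro w hw rfl
        have h1 := hcases t ht hw
        rw [h1] at hnt
        exact Finset.notMem_range_self hnt
      have h1 := HD _ hut
      rw [Finset.insert_erase hnt] at h1
      exact (stableWrt_img_iff hE hk (fun w hw => hDE w (lt_of_le_of_lt hw ht) (hwn w hw))
        fun w hw => hFo w (hwn w hw)).2 h1
    · have htn : t ⊆ Finset.range n := by
        have := ht.subset
        rwa [Finset.range_add_one, Finset.subset_insert_iff_of_notMem hnt] at this
      refine StableWrt.sub (s := Finset.range n) ?_ htn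
      refine (stableWrt_map_iff hp fun w hw => ?_).2 HP'
      rcases eq_or_ssubset_of_subset hw with rfl | hlt
      · rw [hFn, htop, Hom.range_eq_map]
      · rw [hFo w hlt.ne, hS w hlt]
  obtain ⟨P', T, f, HT, hf, hr, hc⟩ := h.exists_of_family hF
  have hP' : #P' = μ := mk_eq_of_top HT.cube.1 HT.cube.2
  have hne := nonempty_of_card hμ hP'
  choose χ hχ hχf hχr using fun w (hw : w ⊂ Finset.range (n + 1)) =>
    AEC.exists_kEmbOn (hf w hw)
  have hχc : ∀ w v (hw : w ⊂ Finset.range (n + 1)) (hv : v ⊂ Finset.range (n + 1)), w ⊆ v →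
      ∀ x ∈ F w, χ w hw x = χ v hv x := by
    intro w v hw hv hwv x hx
    have hx' : x ∈ F v := (hF v hv).mono hwv subset_rfl hx
    exact (hχf w hw ⟨x, hx⟩).trans ((hc w v hw hv hwv ⟨x, hx⟩ ⟨x, hx'⟩ rfl).trans
      (hχf v hv ⟨x, hx'⟩).symm)
  have hkD : ∀ w, w ⊂ Finset.range (n + 1) → w ≠ Finset.range n → K.KEmbOn (D w) k :=
    fun w hw hwn => hk.mono hE (hDs w hw hwn) (hDE w hw hwn)
  have hkF : ∀ w, w ⊂ Finset.range (n + 1) → w ≠ Finset.range n → ∀ x ∈ D w, k x ∈ F w := by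
    intro w hw hwn x hx
    rw [hFo w hwn]
    exact (hkD w hw hwn).mem_img.2 ⟨x, hx, rfl⟩
  obtain ⟨φ, hφ⟩ := exists_glue
    (fun w : {w : Finset ℕ // w ⊂ Finset.range (n + 1) ∧ w ≠ Finset.range n} => (D w.1 : Set N))
    (fun w x => χ w.1 w.2.1 (k x)) (by
      rintro ⟨w, hw, hwn⟩ ⟨v, hv, hvn⟩ x hxw hxv
      have hx : x ∈ D (w ∩ v) := by
        rw [hinter w hw hwn v hv hvn]
        exact ⟨hxw, hxv⟩
      have hwv : w ∩ v ⊂ Finset.range (n + 1) := lt_of_le_of_lt Finset.inter_subset_left hw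
      have hwvn : w ∩ v ≠ Finset.range n := fun heq =>
        hwn (hcases w hw (heq ▸ Finset.inter_subset_left))
      have hkx := hkF _ hwv hwvn x hx
      exact (hχc _ _ hwv hw Finset.inter_subset_left _ hkx).symm.trans
        (hχc _ _ hwv hv Finset.inter_subset_right _ hkx))
  have hpF : ∀ y, p y ∈ F (Finset.range n) := fun y => by
    rw [hFn]
    exact ⟨y, rfl⟩
  obtain ⟨g, hg, hgχ⟩ := (KEmbOn.comp (hχ _ hn) ((hF _ hn).strong subset_rfl)
    (kEmbOn_of_isKEmb hp (K.strong_top P.mem)) fun y _ => hpF y).exists_embedding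
  refine ⟨P', T, g, φ, HT, hg, ?_, fun w hw hwn => ⟨?_, ?_⟩, fun u hu x hx y hxy => ?_⟩
  · rw [← hr _ hn, ← hχr _ hn]
    ext y
    rw [(hχ _ hn).mem_img]
    constructor
    · rintro ⟨x, rfl⟩
      exact ⟨p x, hpF x, (hgχ x).symm⟩
    · rintro ⟨z, hz, rfl⟩
      rw [hFn] at hz
      obtain ⟨x, rfl⟩ := hz
      exact ⟨x, hgχ x⟩
  · exact ((hχ w hw).comp ((hF w hw).strong subset_rfl) (hkD w hw hwn) (hkF w hw hwn)).congr
      fun x hx => hφ ⟨w, hw, hwn⟩ x hx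
  · rw [← hr w hw, ← hχr w hw, img_congr (ψ := fun x => χ w hw (k x)) fun x hx => hφ ⟨w, hw, hwn⟩ x hx, hFo w hwn,
      img_img (hkD w hw hwn) le_rfl]
  · have hun := hu.trans hn
    rw [hgχ, hxy]
    exact (hφ ⟨u, hun, hu.ne⟩ x hx).trans (hχc u _ hun hn hu.subset _ (hkF u hun hu.ne x hx))

end WeakForking

/-! ### Amalgamation over the boundary: the successor step. -/

namespace WeakForking

open FirstOrder.Language

variable {L : FirstOrder.Language.{u, u}} {K : AEC L} {W : WeakForking K} {N N' P : K.Model}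
  {μ lam : Cardinal.{u}} {n : ℕ}

theorem range_ssubset_range_add_one (n : ℕ) : Finset.range n ⊂ Finset.range (n + 1) := by
  rw [Finset.range_add_one]
  exact Finset.ssubset_insert Finset.notMem_range_self

theorem eq_range_of_ssubset_range_add_one {w : Finset ℕ} (hw : w ⊂ Finset.range (n + 1))
    (hnw : Finset.range n ⊆ w) : w = Finset.range n := by
  by_contra hne
  have h1 := Finset.card_lt_card hw
  have h2 := Finset.card_lt_card (Finset.ssubset_iff_subset_ne.2 ⟨hnw, Ne.symm hne⟩)
  simp only [Finset.card_range] at h1 h2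
  omega

theorem inter_range_ssubset {w : Finset ℕ} (hw : w ⊂ Finset.range (n + 1))
    (hwn : w ≠ Finset.range n) : w ∩ Finset.range n ⊂ Finset.range n :=
  Finset.ssubset_iff_subset_ne.2 ⟨Finset.inter_subset_right, fun h =>
    hwn (eq_range_of_ssubset_range_add_one hw (Finset.inter_eq_right.1 h))⟩

theorem insert_ssubset_range {u : Finset ℕ} (hu : u ⊂ Finset.range n) :
    insert n u ⊂ Finset.range (n + 1) := by
  rw [Finset.range_add_one]
  refine Finset.ssubset_iff_subset_ne.2 ⟨Finset.insert_subset_insert _ hu.subset, fun h => hu.ne ?_⟩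
  have h1 : n ∉ u := fun h => Finset.notMem_range_self (hu.subset h)
  rw [← Finset.erase_insert h1, h, Finset.erase_insert Finset.notMem_range_self]

theorem insert_ne_range {u : Finset ℕ} : insert n u ≠ Finset.range n := fun h =>
  Finset.notMem_range_self (h ▸ Finset.mem_insert_self n u)

/-- The last model of a stable system may be changed. -/
theorem StableWrt.change_top {s : Finset ℕ} {S S' : Finset ℕ → L.Substructure P}
    (H : W.StableIn μ s P S) (hother : ∀ w, w ⊂ s → S' w = S w) (hs : K.Strong (S' s))
    (hc : #(S' s) = μ) (hle : ∀ w, w ⊂ s → S w ≤ S' s) : W.StableIn μ s P S' := by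
  have hbase : ∀ t, t ⊂ s → t.Nonempty → K.IsAmalgBase μ P t.ssubsets S' := fun t ht hne =>
    (isAmalgBase_congr fun w hw => hother w ((Finset.mem_ssubsets.1 hw).trans ht)).2
      (H.base t ht hne)
  have hcases : ∀ w ∈ s.powerset, w = s ∨ w ⊂ s := fun w hw =>
    eq_or_ssubset_of_subset (Finset.mem_powerset.1 hw)
  have hle' : ∀ w ∈ s.powerset, S' w ≤ S' s := by
    intro w hw
    rcases hcases w hw with rfl | h
    · exact le_rfl
    · rw [hother w h]; exact hle w h
  refine ⟨⟨H.sys.nonempty, H.sys.down, fun w hw => ?_, fun w hw v hv hwv => ?_,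
    fun w hw v hv => ?_, fun w hw => ?_⟩, hbase, fun t ht hne => ?_⟩
  · rcases hcases w hw with rfl | h
    · exact hs
    · rw [hother w h]; exact H.strong h.subset
  · rcases hcases v hv with rfl | h
    · exact hle' w hw
    · rw [hother v h, hother w (lt_of_le_of_lt hwv h)]
      exact H.mono hwv h.subset
  · rcases hcases w hw with rfl | h
    · rw [Finset.inter_eq_right.2 (Finset.mem_powerset.1 hv), inf_eq_right.2 (hle' v hv)]
    · rcases hcases v hv with rfl | h'
      · rw [Finset.inter_eq_left.2 (Finset.mem_powerset.1 hw), inf_eq_left.2 (hle' w hw)]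
      · rw [hother w h, hother v h', hother _ (lt_of_le_of_lt Finset.inter_subset_left h)]
        exact H.inter h.subset h'.subset
  · rcases hcases w hw with rfl | h
    · exact hc
    · rw [hother w h]; exact H.card h.subset
  · have hb : bdry S' t = bdry S t := by
      ext x
      simp only [mem_bdry]
      exact exists_congr fun w => and_congr_right fun hw => by rw [hother w (hw.trans ht)]
    rw [hb, hother t ht]
    refine (H.indep t ht hne).mono_right (H.base t ht hne).ab_bdry ?_
    rintro x ⟨w, hw, htw, hx⟩
    exact Or.inl ⟨w, hw, htw, by rwa [hother w hw] at hx⟩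

theorem mk_top (P : K.Model) : #(⊤ : L.Substructure P) = #P :=
  Cardinal.mk_congr (Substructure.topEquiv (L := L) (M := P)).toEquiv

/-- The last model of a stable system may be enlarged. -/
theorem StableWrt.update_top {s : Finset ℕ} {S : Finset ℕ → L.Substructure P}
    (H : W.StableIn μ s P S) (hP : #P = μ) : W.IsStable μ s P (Function.update S s ⊤) := by
  have hself : Function.update S s ⊤ s = ⊤ := Function.update_self _ _ _
  refine isStable_iff.2 ⟨H.change_top (fun w hw => Function.update_of_ne hw.ne _ _) ?_ ?_ ?_, hself⟩
  · rw [hself]; exact K.strong_top P.mem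
  · rw [hself, mk_top, hP]
  · rw [hself]; exact fun _ _ => le_top

/-- A variant of `HasWeakUniqueness.exists_absorb`, where the map of the maximal face is given
separately. -/
theorem HasWeakUniqueness.exists_absorb_of_maps (h : W.HasWeakUniqueness μ (n + 1))
    (hμ : K.LS ≤ μ) {P' : K.Model} {T : Finset ℕ → L.Substructure P'}
    (HT : W.IsStable μ (Finset.range (n + 1)) P' T) {g : P ↪[L] P'} (hg : K.IsKEmb g)
    (hgr : g.toHom.range = T (Finset.range n)) {D : Finset ℕ → L.Substructure N}
    (HD : W.StableIn μ (Finset.range (n + 1)) N D) {θ : N → P'} {h₀ : N → P}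
    (hθ : ∀ w, w ⊂ Finset.range (n + 1) → w ≠ Finset.range n →
      K.KEmbOn (D w) θ ∧ T w = img θ (D w))
    (hh₀ : K.KEmbOn (D (Finset.range n)) h₀)
    (hagree : ∀ u, u ⊂ Finset.range n → ∀ x ∈ D u, θ x = g (h₀ x)) :
    ∃ (M : K.Model) (k : N → M) (f : P' ↪[L] M), #M = μ ∧ K.IsKEmb f ∧
      K.KEmbOn (D (Finset.range (n + 1))) k ∧
      (∀ w, w ⊂ Finset.range (n + 1) → w ≠ Finset.range n → ∀ x ∈ D w, k x = f (θ x)) ∧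
      ∀ x ∈ D (Finset.range n), k x = f (g (h₀ x)) := by
  classical
  have hn := range_ssubset_range_add_one n
  -- The two maps agree on each `D (w ∩ range n)`, so together they define one map of the boundary
  -- of `D`.
  let φ : N → P' := fun x => if x ∈ D (Finset.range n) then g (h₀ x) else θ x
  have hφn : ∀ x ∈ D (Finset.range n), φ x = g (h₀ x) := fun x hx => if_pos hx
  have hφo : ∀ w, w ⊂ Finset.range (n + 1) → w ≠ Finset.range n → ∀ x ∈ D w, φ x = θ x := by
    intro w hw hwn x hx
    by_cases hxn : x ∈ D (Finset.range n)
    · have hx' : x ∈ D (w ∩ Finset.range n) := by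
        rw [HD.inter hw.subset hn.subset]
        exact ⟨hx, hxn⟩
      rw [hφn x hxn, hagree _ (inter_range_ssubset hw hwn) x hx']
    · exact if_neg hxn
  have hφK : ∀ w, w ⊂ Finset.range (n + 1) → K.KEmbOn (D w) φ := by
    intro w hw
    by_cases hwn : w = Finset.range n
    · subst hwn
      exact (hh₀.comp_emb hg).congr hφn
    · exact (hθ w hw hwn).1.congr (hφo w hw hwn)
  obtain ⟨M, k, f, hM, hf, hk, hkf⟩ := h.exists_absorb hμ HD HT hφK
    (fun w hw hwn => by rw [(hθ w hw hwn).2, img_congr (hφo w hw hwn)])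
    (by
      intro y hy
      obtain ⟨x, hx, rfl⟩ := (hφK _ hn).mem_img.1 hy
      rw [hφn x hx, ← hgr]
      exact ⟨_, rfl⟩)
  exact ⟨M, k, f, hM, hf, hk, fun w hw hwn x hx => by rw [hkf w hw x hx, hφo w hw hwn x hx],
    fun x hx => by rw [hkf _ hn x hx, hφn x hx]⟩

section Double

variable {S : Finset ℕ → L.Substructure N} {S' : Finset ℕ → L.Substructure N'}
  {X Y : Set N} {X' Y' : Set N'} {r : Finset ℕ → ℕ}

theorem res_le_closure (s : Finset ℕ) : res S X s ≤ Substructure.closure L X := inf_le_left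

theorem res_of_top {s : Finset ℕ} (htop : S s = ⊤) : res S X s = Substructure.closure L X := by
  rw [res, htop, inf_top_eq]

theorem doubleRes_range : doubleRes S X Y n (Finset.range n) = res S X (Finset.range n) :=
  doubleRes_of_notMem Finset.notMem_range_self

theorem doubleRes_range_add_one :
    doubleRes S X Y n (Finset.range (n + 1)) = res S Y (Finset.range n) := by
  rw [Finset.range_add_one, doubleRes_of_mem (Finset.mem_insert_self _ _),
    Finset.erase_insert Finset.notMem_range_self]

theorem doubleRes_insert {u : Finset ℕ} (hu : u ⊂ Finset.range n) :
    doubleRes S X Y n (insert n u) = res S Y u := by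
  rw [doubleRes_of_mem (Finset.mem_insert_self _ _),
    Finset.erase_insert fun h => Finset.notMem_range_self (hu.subset h)]

theorem doubleRes_of_ssubset {u : Finset ℕ} (hu : u ⊂ Finset.range n) :
    doubleRes S X Y n u = res S X u :=
  doubleRes_of_notMem fun h => Finset.notMem_range_self (hu.subset h)

/-- A proper face of `range (n + 1)` other than `range n`. -/
theorem face_cases {w : Finset ℕ} (hw : w ⊂ Finset.range (n + 1)) (hwn : w ≠ Finset.range n) :
    w ⊂ Finset.range n ∨ ∃ u, u ⊂ Finset.range n ∧ w = insert n u := by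
  by_cases hnw : n ∈ w
  · right
    refine ⟨w.erase n, Finset.ssubset_iff_subset_ne.2 ⟨?_, fun heq => hw.ne ?_⟩,
      (Finset.insert_erase hnw).symm⟩
    · have := hw.subset
      rwa [Finset.range_add_one, Finset.subset_insert_iff] at this
    · rw [Finset.range_add_one, ← heq, Finset.insert_erase hnw]
  · left
    refine Finset.ssubset_iff_subset_ne.2 ⟨?_, hwn⟩
    have := hw.subset
    rwa [Finset.range_add_one, Finset.subset_insert_iff_of_notMem hnw] at this

/-- The successor step for the amalgamation of two stable systems over their boundaries. -/
theorem GoodAt.exists_amalgam_succ (hgood : W.GoodAt μ) (hr : IsRank r)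
    (HS : W.StableWrt (fun t w => r w < r t) lam (Finset.range n) N S)
    (htop : S (Finset.range n) = ⊤)
    (HS' : W.StableWrt (fun t w => r w < r t) lam (Finset.range n) N' S')
    (htop' : S' (Finset.range n) = ⊤)
    (hX : W.Adapted (Finset.range n) N S X) (hY : W.Adapted (Finset.range n) N S Y) (hXY : X ⊆ Y)
    (hXc : #X = μ) (hYc : #Y = μ)
    (hX' : W.Adapted (Finset.range n) N' S' X') (hY' : W.Adapted (Finset.range n) N' S' Y')
    (hXY' : X' ⊆ Y') (hXc' : #X' = μ) (hYc' : #Y' = μ) {φ : N → N'} {ψ : N' → N}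
    (hψ : ∀ s, s ⊂ Finset.range n → K.KEmbOn (S' s) ψ)
    (hψφ : ∀ s, s ⊂ Finset.range n → ∀ x ∈ S s, ψ (φ x) = x)
    (hXX' : ∀ s, s ⊂ Finset.range n → (res S' X' s : Set N') = φ '' res S X s)
    (hYY' : ∀ s, s ⊂ Finset.range n → (res S' Y' s : Set N') = φ '' res S Y s)
    (hP : #P = μ) {h : N → P} {h' : N' → P} (hh : K.KEmbOn (Substructure.closure L X) h)
    (hh' : K.KEmbOn (Substructure.closure L X') h')
    (hagree : ∀ s, s ⊂ Finset.range n → ∀ x ∈ res S X s, h x = h' (φ x)) :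
    ∃ (M : K.Model) (k : N → M) (k' : N' → M) (g : P ↪[L] M), #M = μ ∧ K.IsKEmb g ∧
      K.KEmbOn (Substructure.closure L Y) k ∧ K.KEmbOn (Substructure.closure L Y') k' ∧
      (∀ x ∈ Substructure.closure L X, g (h x) = k x) ∧
      (∀ x ∈ Substructure.closure L X', g (h' x) = k' x) ∧
      ∀ s, s ⊂ Finset.range n → ∀ x ∈ res S Y s, k x = k' (φ x) := by
  have hn := range_ssubset_range_add_one n
  have hEX : K.Strong (Substructure.closure L X) := by
    rw [← res_of_top htop]; exact hX.strong _ subset_rfl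
  have hEY : K.Strong (Substructure.closure L Y) := by
    rw [← res_of_top htop]; exact hY.strong _ subset_rfl
  have hEXc : #(Substructure.closure L X) = μ := by
    rw [← res_of_top htop, hX.card _ subset_rfl, hXc]
  have hEYc : #(Substructure.closure L Y) = μ := by
    rw [← res_of_top htop, hY.card _ subset_rfl, hYc]
  have hDD : ∀ t, t ⊆ Finset.range n → W.StableIn μ (insert n t) N (doubleRes S X Y n) :=
    fun t ht => stableIn_doubleRes hX hY hXY hXc hYc hgood hr HS Finset.notMem_range_self ht
  have HD : W.StableIn μ (Finset.range (n + 1)) N (doubleRes S X Y n) := by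
    rw [Finset.range_add_one]; exact hDD _ subset_rfl
  have HD' : W.StableIn μ (Finset.range (n + 1)) N' (doubleRes S' X' Y' n) := by
    rw [Finset.range_add_one]
    exact stableIn_doubleRes hX' hY' hXY' hXc' hYc' hgood hr HS' Finset.notMem_range_self
      subset_rfl
  have hDle : ∀ w, doubleRes S X Y n w ≤ Substructure.closure L Y := by
    intro w
    by_cases hw : n ∈ w
    · rw [doubleRes_of_mem hw]; exact inf_le_left
    · rw [doubleRes_of_notMem hw]
      exact inf_le_left.trans (Substructure.closure_mono hXY)
  -- `Q` contains `P` and a copy of the model on `Y` over the one on `X`, in no particular position.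
  -- It serves only to hold the family of faces to which existence is applied.
  obtain ⟨Q, p, k₀, hQ, hp, hk₀, hpk⟩ := AP.exists_kEmbOn hgood.AP hgood.le hEX hEXc hEY hEYc
    (Substructure.closure_mono hXY) hP hh
  have HSX : W.StableIn μ (Finset.range n) N (res S X) := by
    have := hX.stableIn_res (hXc ▸ hgood) hr HS subset_rfl
    rwa [hXc] at this
  have HP : W.IsStable μ (Finset.range n) P
      (Function.update (fun w => img h (res S X w)) (Finset.range n) ⊤) :=
    ((stableWrt_img_iff hEX hh (fun w _ => inf_le_left) fun w _ => rfl).2 HSX).update_top hP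
  -- A stable cube with `P` at `range n`, and with the traces of the boundary of `S` on `X` and on
  -- `Y` at the other faces. Up to `φ` these traces belong to both systems.
  obtain ⟨P', T, g₀, θ, HT, hg₀, hg₀r, hθ, hθg⟩ :=
    (hgood.existence (n := n + 1) (by omega)).exists_step hgood.le hEY hp hk₀
      (D := doubleRes S X Y n) (fun w _ _ => hDle w) (fun w hw _ => HD.strong hw.subset)
      (fun w hw _ v hv _ => HD.inter hw.subset hv.subset) (fun u hu => hDD u hu.subset) HP
      (fun s hs => by
        rw [Function.update_of_ne hs.ne, ← img_emb, img_img hh (res_le_closure s),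
          doubleRes_of_ssubset hs]
        exact img_congr fun x hx => hpk x hx.1)
  have hθh : ∀ u, u ⊂ Finset.range n → ∀ x ∈ doubleRes S X Y n u, θ x = g₀ (h x) := by
    intro u hu x hx
    refine hθg u hu x hx (h x) (hpk x ?_)
    rw [doubleRes_of_ssubset hu] at hx
    exact hx.1
  have hP' : #P' = μ := mk_eq_of_top HT.cube.1 HT.cube.2
  have hwu := hgood.weakUniqueness (n := n + 1) (by omega)
  -- The cube of traces in `N` has the faces of `T`, except that at `range n` it has a submodel of
  -- `P` instead of `P`. It is absorbed into an extension of `P'`.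
  obtain ⟨M₁, k₁, f₁, hM₁, hf₁, hk₁, hkθ₁, hkh₁⟩ := hwu.exists_absorb_of_maps hgood.le HT hg₀ hg₀r
    HD hθ (by rwa [doubleRes_range, res_of_top htop]) hθh
  have hψD : ∀ w, w ⊂ Finset.range (n + 1) → w ≠ Finset.range n →
      (doubleRes S' X' Y' n w : Set N') = φ '' doubleRes S X Y n w ∧
      ∃ s, s ⊂ Finset.range n ∧ doubleRes S' X' Y' n w ≤ S' s ∧ doubleRes S X Y n w ≤ S s := by
    intro w hw hwn
    rcases face_cases hw hwn with hu | ⟨u, hu, rfl⟩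
    · rw [doubleRes_of_ssubset hu, doubleRes_of_ssubset hu]
      exact ⟨hXX' w hu, w, hu, res_le _, res_le _⟩
    · rw [doubleRes_insert hu, doubleRes_insert hu]
      exact ⟨hYY' u hu, u, hu, res_le _, res_le _⟩
  have hψK : ∀ w, w ⊂ Finset.range (n + 1) → w ≠ Finset.range n →
      K.KEmbOn (doubleRes S' X' Y' n w) ψ ∧
      img ψ (doubleRes S' X' Y' n w) = doubleRes S X Y n w ∧
      ∀ y ∈ doubleRes S' X' Y' n w, ψ y ∈ doubleRes S X Y n w := by
    intro w hw hwn
    obtain ⟨himg, s, hs, hle', hle⟩ := hψD w hw hwn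
    have hK := (hψ s hs).mono (HS'.strong hs.subset) (HD'.strong hw.subset) hle'
    have hcoe : (img ψ (doubleRes S' X' Y' n w) : Set N) = doubleRes S X Y n w := by
      rw [hK.coe_img, himg, Set.image_image]
      refine (Set.image_congr fun x hx => hψφ s hs x (hle hx)).trans (Set.image_id' _)
    refine ⟨hK, SetLike.coe_injective hcoe, fun y hy => ?_⟩
    rw [← SetLike.mem_coe, ← hcoe, hK.coe_img]
    exact ⟨y, hy, rfl⟩
  -- The same for `N'`, whose boundary reaches `P'` through `ψ`.
  obtain ⟨M₂, k₂, f₂, hM₂, hf₂, hk₂, hkθ₂, hkh₂⟩ := hwu.exists_absorb_of_maps hgood.le HT hg₀ hg₀r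
    HD' (θ := fun y => θ (ψ y)) (h₀ := h') (fun w hw hwn => by
      obtain ⟨hK, himg, hmem⟩ := hψK w hw hwn
      refine ⟨(hθ w hw hwn).1.comp (HD.strong hw.subset) hK hmem, ?_⟩
      rw [(hθ w hw hwn).2, ← img_img hK le_rfl, himg])
    (by rwa [doubleRes_range, res_of_top htop']) (fun u hu y hy => by
      rw [doubleRes_of_ssubset hu, ← SetLike.mem_coe, hXX' u hu] at hy
      obtain ⟨x, hx, rfl⟩ := hy
      rw [hψφ u hu x hx.2, hθh u hu x (by rw [doubleRes_of_ssubset hu]; exact hx),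
        hagree u hu x hx])
  -- Both boundaries are already identified inside `P'`, so every amalgam of `M₁` and `M₂` over `P'`
  -- respects the identification.
  obtain ⟨M, a₁, a₂, hM, ha₁, ha₂, haa⟩ := hgood.AP P' M₁ M₂ hP' hM₁ hM₂ f₁ f₂ hf₁ hf₂
  rw [doubleRes_range_add_one, res_of_top htop] at hk₁
  rw [doubleRes_range_add_one, res_of_top htop'] at hk₂
  rw [doubleRes_range, res_of_top htop] at hkh₁
  rw [doubleRes_range, res_of_top htop'] at hkh₂
  refine ⟨M, fun x => a₁ (k₁ x), fun y => a₂ (k₂ y), a₁.comp (f₁.comp g₀), hM,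
    ha₁.comp (hf₁.comp hg₀), hk₁.comp_emb ha₁, hk₂.comp_emb ha₂, fun x hx => ?_, fun x hx => ?_,
    fun s hs x hx => ?_⟩
  · exact congrArg a₁ (hkh₁ x hx).symm
  · exact (haa _).trans (congrArg a₂ (hkh₂ x hx).symm)
  · have hx₁ : x ∈ doubleRes S X Y n (insert n s) := by rwa [doubleRes_insert hs]
    have hx₂ : φ x ∈ doubleRes S' X' Y' n (insert n s) := by
      rw [doubleRes_insert hs, ← SetLike.mem_coe, hYY' s hs]
      exact ⟨x, hx, rfl⟩
    change a₁ (k₁ x) = a₂ (k₂ (φ x))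
    rw [hkθ₁ _ (insert_ssubset_range hs) insert_ne_range x hx₁,
      hkθ₂ _ (insert_ssubset_range hs) insert_ne_range _ hx₂, hψφ s hs x hx.2, haa]

end Double

end WeakForking

/-! ### Simultaneous filtrations; weak uniqueness in `lam`. -/

theorem mk_preimage_inl_add {α β : Type u} (X : Set (α ⊕ β)) :
    #X = #(Sum.inl ⁻¹' X : Set α) + #(Sum.inr ⁻¹' X : Set β) := by
  have h : X = Sum.inl '' (Sum.inl ⁻¹' X) ∪ Sum.inr '' (Sum.inr ⁻¹' X) := by
    ext (x | x) <;> simp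
  conv_lhs => rw [h]
  rw [Cardinal.mk_union_of_disjoint, Cardinal.mk_image_eq Sum.inl_injective,
    Cardinal.mk_image_eq Sum.inr_injective]
  rw [Set.disjoint_left]
  rintro _ ⟨x, -, rfl⟩ ⟨y, -, h⟩
  cases h

namespace WeakForking

open FirstOrder.Language

variable {L : FirstOrder.Language.{u, u}} {K : AEC L} {W : WeakForking K} {N N' : K.Model}
  {lam : Cardinal.{u}} {n : ℕ} {S : Finset ℕ → L.Substructure N}
  {S' : Finset ℕ → L.Substructure N'} {φ : N → N'} {ψ : N' → N}

/-- A map of the boundary of one system onto the boundary of another has an inverse. -/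
theorem exists_common_inverse [Nonempty N] (HS : K.IsSystem lam N (Finset.range n).powerset S)
    (HS' : K.IsSystem lam N' (Finset.range n).powerset S')
    (hφ : ∀ s, s ⊂ Finset.range n → K.KEmbOn (S s) φ)
    (himg : ∀ s, s ⊂ Finset.range n → S' s = img φ (S s)) :
    ∃ ψ : N' → N, ∀ s, s ⊂ Finset.range n → K.KEmbOn (S' s) ψ ∧ ∀ x ∈ S s, ψ (φ x) = x := by
  have hpow : ∀ s, s ⊂ Finset.range n → s ∈ (Finset.range n).powerset := fun s hs =>
    Finset.mem_powerset.2 hs.subset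
  let U : Set N := {x | ∃ s, s ⊂ Finset.range n ∧ x ∈ S s}
  -- `φ` is injective on each face. For points of two faces with the same image, the intersection
  -- condition for `S'` brings both points into the face `s ∩ t`.
  have hinj : Set.InjOn φ U := by
    rintro x ⟨s, hs, hx⟩ y ⟨t, ht, hy⟩ hxy
    have h1 : φ x ∈ S' (s ∩ t) := by
      rw [HS'.inter s (hpow s hs) t (hpow t ht), himg s hs, himg t ht]
      exact ⟨(hφ s hs).mem_img.2 ⟨x, hx, rfl⟩, (hφ t ht).mem_img.2 ⟨y, hy, hxy.symm⟩⟩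
    have hst : s ∩ t ⊂ Finset.range n := lt_of_le_of_lt Finset.inter_subset_left hs
    rw [himg _ hst] at h1
    obtain ⟨z, hz, hzx⟩ := (hφ _ hst).mem_img.1 h1
    have hzs := HS.mono _ (hpow _ hst) s (hpow s hs) Finset.inter_subset_left hz
    have hzt := HS.mono _ (hpow _ hst) t (hpow t ht) Finset.inter_subset_right hz
    rw [← (hφ s hs).injOn hzs hx hzx, (hφ t ht).injOn hzt hy (hzx.trans hxy)]
  have hinv : ∀ s, s ⊂ Finset.range n → ∀ x ∈ S s, Function.invFunOn φ U (φ x) = x :=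
    fun s hs x hx => hinj.leftInvOn_invFunOn ⟨s, hs, hx⟩
  refine ⟨Function.invFunOn φ U, fun s hs => ⟨?_, hinv s hs⟩⟩
  obtain ⟨χ, hχ, hχφ⟩ := (hφ s hs).exists_inverse (HS.strong s (hpow s hs))
  rw [himg s hs]
  refine hχ.congr fun y hy => ?_
  obtain ⟨x, hx, rfl⟩ := (hφ s hs).mem_img.1 hy
  rw [hinv s hs x hx, hχφ x hx]

/-- Sets adapted to two systems with isomorphic boundaries. -/
theorem exists_setClub_pair (hκ : W.κ ≤ K.LS) (hS : IsCube K lam (Finset.range n) N S)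
    (hS' : IsCube K lam (Finset.range n) N' S')
    (hφ : ∀ s, s ⊂ Finset.range n → K.KEmbOn (S s) φ)
    (himg : ∀ s, s ⊂ Finset.range n → S' s = img φ (S s))
    (hψφ : ∀ s, s ⊂ Finset.range n → ∀ x ∈ S s, ψ (φ x) = x) :
    ∃ C : Set (Set (N ⊕ N')), SetClub K.LS C ∧ ∀ X ∈ C, ℵ₀ ≤ #X →
      W.Adapted (Finset.range n) N S (Sum.inl ⁻¹' X) ∧
      W.Adapted (Finset.range n) N' S' (Sum.inr ⁻¹' X) ∧
      #(Sum.inl ⁻¹' X : Set N) = #X ∧ #(Sum.inr ⁻¹' X : Set N') = #X ∧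
      ∀ s, s ⊂ Finset.range n →
        (res S' (Sum.inr ⁻¹' X) s : Set N') = φ '' res S (Sum.inl ⁻¹' X) s := by
  have hLS := K.aleph0_le_LS
  obtain ⟨C₁, hC₁, hC₁'⟩ := exists_setClub_adapted hκ hS.1 hS.2
  obtain ⟨C₂, hC₂, hC₂'⟩ := exists_setClub_adapted hκ hS'.1 hS'.2
  obtain ⟨b⟩ := Cardinal.eq.1 ((mk_eq_of_top hS.1 hS.2).trans (mk_eq_of_top hS'.1 hS'.2).symm)
  -- Closure under `φ` and `ψ` makes the two halves of `X` correspond on the boundaries; closure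
  -- under the bijection `b` and its inverse gives them equal cardinality.
  let F₁ : N ⊕ N' → N ⊕ N' := Sum.elim (fun x => Sum.inr (φ x)) Sum.inr
  let F₂ : N ⊕ N' → N ⊕ N' := Sum.elim Sum.inl (fun y => Sum.inl (ψ y))
  let F₃ : N ⊕ N' → N ⊕ N' := Sum.elim (fun x => Sum.inr (b x)) (fun y => Sum.inl (b.symm y))
  refine ⟨_, (hC₁.comap Sum.inl_injective hLS).inter hLS ((hC₂.comap Sum.inr_injective hLS).inter
    hLS ((SetClub.closed_unary hLS F₁).inter hLS ((SetClub.closed_unary hLS F₂).inter hLS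
      (SetClub.closed_unary hLS F₃)))), ?_⟩
  rintro X ⟨h1, h2, h3, h4, h5⟩ hX
  have ha := hC₁' _ h1
  have ha' := hC₂' _ h2
  have hcard : #(Sum.inl ⁻¹' X : Set N) = #(Sum.inr ⁻¹' X : Set N') := by
    refine Cardinal.mk_congr ⟨fun x => ⟨b x, h5 _ x.2⟩, fun y => ⟨b.symm y, h5 _ y.2⟩,
      fun x => ?_, fun y => ?_⟩
    · exact Subtype.ext (b.symm_apply_apply x)
    · exact Subtype.ext (b.apply_symm_apply y)
  have hsum : #(Sum.inl ⁻¹' X : Set N) = #X := by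
    have h6 := mk_preimage_inl_add X
    rw [← hcard] at h6
    rw [h6] at hX ⊢
    rw [Cardinal.add_eq_self]
    by_contra hlt
    exact (Cardinal.add_lt_aleph0 (not_le.1 hlt) (not_le.1 hlt)).not_ge hX
  refine ⟨ha, ha', hsum, hcard ▸ hsum, fun s hs => ?_⟩
  ext y
  rw [SetLike.mem_coe, ha'.mem_res]
  constructor
  · rintro ⟨hy, hys⟩
    rw [himg s hs] at hys
    obtain ⟨x, hx, rfl⟩ := (hφ s hs).mem_img.1 hys
    refine ⟨x, ha.mem_res.2 ⟨?_, hx⟩, rfl⟩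
    have h6 := h4 _ hy
    change Sum.inl (ψ (φ x)) ∈ X at h6
    rwa [hψφ s hs x hx] at h6
  · rintro ⟨x, hx, rfl⟩
    have hx' := ha.mem_res.1 hx
    refine ⟨h3 _ hx'.1, ?_⟩
    rw [himg s hs]
    exact (hφ s hs).mem_img.2 ⟨x, hx'.2, rfl⟩

/-- Two models, as a family. -/
def pairModel (N N' : K.Model) : Bool → K.Model
  | true => N
  | false => N'

/-- Two maps, as a family. -/
def pairMap {P : K.Model} (h : N → P) (h' : N' → P) : ∀ k, pairModel N N' k → P
  | true => h
  | false => h'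

/-- Two chains of substructures, as a family. -/
def pairChain (C : Ordinal.{u} → L.Substructure N) (C' : Ordinal.{u} → L.Substructure N') :
    ∀ k, Ordinal.{u} → L.Substructure (pairModel N N' k)
  | true => C
  | false => C'

/-- Two stable systems with isomorphic boundaries are amalgamated over their boundaries,
with the identifications given by `R`, if this is possible for small subsystems. -/
theorem GoodBelow.exists_amalgam (hgood : W.GoodBelow lam) (hlam : K.LS < lam) (hκ : W.κ ≤ K.LS)
    (HS : W.IsStable lam (Finset.range n) N S) (HS' : W.IsStable lam (Finset.range n) N' S')
    (hφ : ∀ s, s ⊂ Finset.range n → K.KEmbOn (S s) φ)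
    (himg : ∀ s, s ⊂ Finset.range n → S' s = img φ (S s))
    (R : N → N' → Prop) {A : Set N} {A' : Set N'} (hA : #A ≤ K.LS) (hA' : #A' ≤ K.LS)
    (hR : ∀ x y, R x y → x ∈ A ∧ y ∈ A')
    (hzero : ∀ (E : L.Substructure N) (E' : L.Substructure N'), K.Strong E → K.Strong E' →
      #E = K.LS → #E' = K.LS → A ⊆ E → A' ⊆ E' →
      W.StableIn K.LS (Finset.range n) N (fun w => E ⊓ S w) →
      W.StableIn K.LS (Finset.range n) N' (fun w => E' ⊓ S' w) →
      (∀ s, s ⊂ Finset.range n → E' ⊓ S' s = img φ (E ⊓ S s)) →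
      ∃ (P : K.Model) (h : N → P) (h' : N' → P), #P = K.LS ∧ K.KEmbOn E h ∧ K.KEmbOn E' h' ∧
        (∀ s, s ⊂ Finset.range n → ∀ x ∈ E ⊓ S s, h x = h' (φ x)) ∧
        ∀ x y, R x y → h x = h' y) :
    ∃ (M : K.Model) (g : N ↪[L] M) (g' : N' ↪[L] M), #M = lam ∧ K.IsKEmb g ∧ K.IsKEmb g' ∧
      (∀ s, s ⊂ Finset.range n → ∀ x ∈ S s, g x = g' (φ x)) ∧ ∀ x y, R x y → g x = g' y := by
  have hLS := K.aleph0_le_LS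
  have hlam0 : ℵ₀ ≤ lam := hLS.trans hlam.le
  have hN := mk_eq_of_top HS.cube.1 HS.cube.2
  have hN' := mk_eq_of_top HS'.cube.1 HS'.cube.2
  have := nonempty_of_card hlam.le hN
  obtain ⟨ψ, hψ⟩ := exists_common_inverse HS.cube.1 HS'.cube.1 hφ himg
  obtain ⟨r, hr⟩ := exists_isRank
  have H := (isStable_iff.1 HS).1.weaken (ρ' := fun t w => r w < r t)
    fun t w _ _ h => hr.not_subset h
  have H' := (isStable_iff.1 HS').1.weaken (ρ' := fun t w => r w < r t)
    fun t w _ _ h => hr.not_subset h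
  obtain ⟨C, hC, hCX⟩ := exists_setClub_pair hκ HS.cube HS'.cube hφ himg fun s hs => (hψ s hs).2
  -- One filtration of the disjoint sum resolves both models. The points to be identified belong to
  -- its first set, so the identifications made at stage `0` persist.
  obtain ⟨X, hX₀, hX⟩ := hC.exists_filtration hLS hlam
    (by rw [Cardinal.mk_sum, Cardinal.lift_id, Cardinal.lift_id, hN, hN',
      Cardinal.add_eq_self hlam0])
    (Sum.inl '' A ∪ Sum.inr '' A') (by
      refine (Cardinal.mk_union_le _ _).trans ?_
      rw [Cardinal.mk_image_eq Sum.inl_injective, Cardinal.mk_image_eq Sum.inr_injective,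
        ← Cardinal.add_eq_self hLS]
      exact add_le_add hA hA')
  have hlim : Order.IsSuccLimit lam.ord := Cardinal.isSuccLimit_ord hlam0
  let Y : Ordinal.{u} → Set N := fun i => Sum.inl ⁻¹' X i
  let Y' : Ordinal.{u} → Set N' := fun i => Sum.inr ⁻¹' X i
  have hprop : ∀ i, W.Adapted (Finset.range n) N S (Y i) ∧
      W.Adapted (Finset.range n) N' S' (Y' i) ∧ #(Y i) = #(X i) ∧ #(Y' i) = #(X i) ∧
      ∀ s, s ⊂ Finset.range n → (res S' (Y' i) s : Set N') = φ '' res S (Y i) s :=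
    fun i => hCX _ (hX.mem i) (hLS.trans (hX.le_card i))
  have hYm : Monotone Y := fun i j hij => Set.preimage_mono (hX.mono hij)
  have hYm' : Monotone Y' := fun i j hij => Set.preimage_mono (hX.mono hij)
  have hres : ∀ i, res S (Y i) (Finset.range n) = Substructure.closure L (Y i) := fun i =>
    res_of_top HS.cube.2
  have hres' : ∀ i, res S' (Y' i) (Finset.range n) = Substructure.closure L (Y' i) := fun i =>
    res_of_top HS'.cube.2
  have hstr : ∀ i, K.Strong (Substructure.closure L (Y i)) := fun i => by
    rw [← hres i]; exact (hprop i).1.strong _ subset_rfl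
  have hstr' : ∀ i, K.Strong (Substructure.closure L (Y' i)) := fun i => by
    rw [← hres' i]; exact (hprop i).2.1.strong _ subset_rfl
  have hcard : ∀ i, #(Substructure.closure L (Y i)) = #(X i) := fun i => by
    rw [← hres i, (hprop i).1.card _ subset_rfl]; exact (hprop i).2.2.1
  have hcard' : ∀ i, #(Substructure.closure L (Y' i)) = #(X i) := fun i => by
    rw [← hres' i, (hprop i).2.1.card _ subset_rfl]; exact (hprop i).2.2.2.1
  have hmemY : ∀ i x, x ∈ Substructure.closure L (Y i) ↔ x ∈ Y i := fun i x => by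
    rw [← SetLike.mem_coe, (hprop i).1.coe]
  have hmemY' : ∀ i x, x ∈ Substructure.closure L (Y' i) ↔ x ∈ Y' i := fun i x => by
    rw [← SetLike.mem_coe, (hprop i).2.1.coe]
  have hYlim : ∀ δ, Order.IsSuccLimit δ → ∀ x ∈ Y δ, ∃ j < δ, x ∈ Y j := by
    intro δ hδ x hx
    have h1 : Sum.inl x ∈ X δ := hx
    rw [hX.limit δ hδ] at h1
    obtain ⟨j, hj, h1⟩ := Set.mem_iUnion₂.1 h1
    exact ⟨j, hj, h1⟩
  have hYlim' : ∀ δ, Order.IsSuccLimit δ → ∀ x ∈ Y' δ, ∃ j < δ, x ∈ Y' j := by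
    intro δ hδ x hx
    have h1 : Sum.inr x ∈ X δ := hx
    rw [hX.limit δ hδ] at h1
    obtain ⟨j, hj, h1⟩ := Set.mem_iUnion₂.1 h1
    exact ⟨j, hj, h1⟩
  let D := pairChain (fun i => Substructure.closure L (Y i)) (fun i => Substructure.closure L (Y' i))
  let Φ : ∀ (_ : Ordinal.{u}) (P : K.Model), (∀ k, pairModel N N' k → P) → Prop := fun i P h =>
    (∀ s, s ⊂ Finset.range n → ∀ x ∈ res S (Y i) s, h true x = h false (φ x)) ∧
      ∀ x y, R x y → h true x = h false y
  have htower : IsTower D (fun i => #(X i)) lam := by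
    refine ⟨?_, ?_, ?_, ?_, hX.card_lt, hX.ord_card_le, fun i => hLS.trans (hX.le_card i)⟩
    · rintro (_ | _) i j hij
      · exact Substructure.closure_mono (hYm' hij)
      · exact Substructure.closure_mono (hYm hij)
    · rintro (_ | _) i
      · exact hstr' i
      · exact hstr i
    · rintro (_ | _) δ hδ x hx
      · obtain ⟨j, hj, h1⟩ := hYlim' δ hδ x ((hmemY' δ x).1 hx)
        exact ⟨j, hj, (hmemY' j x).2 h1⟩
      · obtain ⟨j, hj, h1⟩ := hYlim δ hδ x ((hmemY δ x).1 hx)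
        exact ⟨j, hj, (hmemY j x).2 h1⟩
    · rintro (_ | _) i
      · exact hcard' i
      · exact hcard i
  have hstage : ∀ i (P : K.Model) (h : N → P) (h' : N' → P), #P = #(X i) →
      K.KEmbOn (Substructure.closure L (Y i)) h → K.KEmbOn (Substructure.closure L (Y' i)) h' →
      (∀ s, s ⊂ Finset.range n → ∀ x ∈ res S (Y i) s, h x = h' (φ x)) →
      (∀ x y, R x y → h x = h' y) →
      IsStage D (fun i => #(X i)) Φ i P (pairMap h h') := by
    intro i P h h' hP hh hh' hag hRag
    refine ⟨hP, ?_, hag, hRag⟩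
    rintro (_ | _)
    · exact hh'
    · exact hh
  have hA₀ : ∀ i, ∀ x ∈ A, x ∈ Substructure.closure L (Y i) := fun i x hx =>
    (hmemY i x).2 (hX.mono (zero_le (a := i)) (hX₀ (Or.inl ⟨x, hx, rfl⟩)))
  have hA₀' : ∀ i, ∀ x ∈ A', x ∈ Substructure.closure L (Y' i) := fun i x hx =>
    (hmemY' i x).2 (hX.mono (zero_le (a := i)) (hX₀ (Or.inr ⟨x, hx, rfl⟩)))
  have hgoodX : ∀ i < lam.ord, W.GoodAt #(X i) := fun i hi =>
    hgood _ (hX.le_card i) (hX.card_lt i hi)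
  have himgres : ∀ i s, s ⊂ Finset.range n → res S' (Y' i) s = img φ (res S (Y i) s) := by
    intro i s hs
    apply SetLike.coe_injective
    rw [(hprop i).2.2.2.2 s hs, (hφ s hs).coe_img_of_le (res_le s)]
  obtain ⟨M, h, hM⟩ := exists_stage (Φ := Φ) hlam0 htower (by
      have h0 := hlim.bot_lt
      have hst : W.StableIn K.LS (Finset.range n) N (res S (Y 0)) := by
        have h1 := (hprop 0).1.stableIn_res ((hprop 0).2.2.1 ▸ hgoodX 0 h0) hr H subset_rfl
        rwa [(hprop 0).2.2.1, hX.card_zero] at h1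
      have hst' : W.StableIn K.LS (Finset.range n) N' (res S' (Y' 0)) := by
        have h1 := (hprop 0).2.1.stableIn_res ((hprop 0).2.2.2.1 ▸ hgoodX 0 h0) hr H' subset_rfl
        rwa [(hprop 0).2.2.2.1, hX.card_zero] at h1
      obtain ⟨P, h, h', hP, hh, hh', hag, hRag⟩ := hzero _ _ (hstr 0) (hstr' 0)
        ((hcard 0).trans hX.card_zero) ((hcard' 0).trans hX.card_zero) (hA₀ 0) (hA₀' 0) hst hst'
        (himgres 0)
      exact ⟨P, _, hstage 0 P h h' (hP.trans hX.card_zero.symm) hh hh' hag hRag⟩)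
    (by
      intro i hi P h hP
      have hsucc := hX.card_succ i
      obtain ⟨M, k, k', g, hM, hg, hk, hk', hgk, hgk', hag⟩ :=
        (hgoodX i hi).exists_amalgam_succ hr H HS.cube.2 H' HS'.cube.2 (hprop i).1
          (hprop (i + 1)).1 (hYm le_self_add) (hprop i).2.2.1
          ((hprop (i + 1)).2.2.1.trans hsucc) (hprop i).2.1 (hprop (i + 1)).2.1
          (hYm' le_self_add) (hprop i).2.2.2.1 ((hprop (i + 1)).2.2.2.1.trans hsucc)
          (fun s hs => (hψ s hs).1) (fun s hs => (hψ s hs).2) (hprop i).2.2.2.2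
          (hprop (i + 1)).2.2.2.2 hP.card (hP.emb true) (hP.emb false) hP.prop.1
      refine ⟨M, pairMap k k', g, hstage _ _ _ _ (hM.trans hsucc.symm) hk hk' hag ?_, hg, ?_⟩
      · intro x y hxy
        obtain ⟨hx, hy⟩ := hR x y hxy
        rw [← hgk x (hA₀ i x hx), ← hgk' y (hA₀' i y hy), hP.prop.2 x y hxy]
      · rintro (_ | _) x hx
        · exact hgk' x hx
        · exact hgk x hx)
    (by
      intro δ _ hδ U h hU hh hcof
      refine ⟨fun s hs x hx => ?_, fun x y hxy => ?_⟩
      · obtain ⟨hxδ, hxs⟩ := (hprop δ).1.mem_res.1 hx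
        obtain ⟨i, hi, hxi⟩ := hYlim δ hδ x hxδ
        obtain ⟨j, hij, hj, P, h', g, hP, hg⟩ := hcof i hi
        have hxj : x ∈ res S (Y j) s := (hprop j).1.mem_res.2 ⟨hYm hij hxi, hxs⟩
        have hyj : φ x ∈ res S' (Y' j) s := by
          rw [himgres j s hs, ← SetLike.mem_coe, (hφ s hs).coe_img_of_le (res_le s)]
          exact ⟨x, hxj, rfl⟩
        rw [← hg.2 true x (res_le_closure s hxj), ← hg.2 false (φ x) (res_le_closure s hyj),
          hP.prop.1 s hs x hxj]
      · obtain ⟨j, -, hj, P, h', g, hP, hg⟩ := hcof 0 hδ.bot_lt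
        obtain ⟨hx, hy⟩ := hR x y hxy
        rw [← hg.2 true x (hA₀ j x hx), ← hg.2 false y (hA₀' j y hy), hP.prop.2 x y hxy])
  have htop : Substructure.closure L (Y lam.ord) = ⊤ := by
    refine eq_top_iff.2 fun x _ => (hmemY _ x).2 ?_
    change Sum.inl x ∈ X lam.ord
    rw [hX.top]
    trivial
  have htop' : Substructure.closure L (Y' lam.ord) = ⊤ := by
    refine eq_top_iff.2 fun x _ => (hmemY' _ x).2 ?_
    change Sum.inr x ∈ X lam.ord
    rw [hX.top]
    trivial
  have h1 : K.KEmbOn (Substructure.closure L (Y lam.ord)) (h true) := hM.emb true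
  have h2 : K.KEmbOn (Substructure.closure L (Y' lam.ord)) (h false) := hM.emb false
  rw [htop] at h1
  rw [htop'] at h2
  obtain ⟨g, hg, hgh⟩ := h1.exists_embedding
  obtain ⟨g', hg', hgh'⟩ := h2.exists_embedding
  refine ⟨M, g, g', ?_, hg, hg', fun s hs x hx => ?_, fun x y hxy => ?_⟩
  · rw [hM.card, hX.top, Cardinal.mk_univ, Cardinal.mk_sum, Cardinal.lift_id, Cardinal.lift_id, hN,
      hN', Cardinal.add_eq_self hlam0]
  · rw [hgh, hgh']
    refine hM.prop.1 s hs x ?_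
    rw [res, htop, top_inf_eq]
    exact hx
  · rw [hgh, hgh']
    exact hM.prop.2 x y hxy

/-- The step-by-step amalgamation with the empty relation `R`. Its first stage is weak uniqueness in
`LS(K)`. -/
theorem GoodBelow.hasWeakUniqueness (hgood : W.GoodBelow lam) (hlam : K.LS < lam)
    (hκ : W.κ ≤ K.LS) (hn : 1 ≤ n) : W.HasWeakUniqueness lam n := by
  intro N N' S S' HS HS' f hf
  have hN' := nonempty_of_card hlam.le (mk_eq_of_top HS'.cube.1 HS'.cube.2)
  have hpow : ∀ s, s ⊂ Finset.range n → s ∈ (Finset.range n).powerset := fun s hs =>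
    Finset.mem_powerset.2 hs.subset
  obtain ⟨φ, hφf⟩ := exists_glue
    (fun s : {s : Finset ℕ // s ⊂ Finset.range n} => (S s.1 : Set N))
    (fun s x => (f s.1 s.2 x : N')) (by
      rintro ⟨s, hs⟩ ⟨t, ht⟩ x hxs hxt
      have hst : s ∩ t ⊂ Finset.range n := lt_of_le_of_lt Finset.inter_subset_left hs
      have hx : x ∈ S (s ∩ t) := by
        rw [HS.cube.1.inter s (hpow s hs) t (hpow t ht)]
        exact ⟨hxs, hxt⟩
      exact (hf _ _ hst hs Finset.inter_subset_left ⟨x, hx⟩ ⟨x, hxs⟩ rfl).symm.trans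
        (hf _ _ hst ht Finset.inter_subset_right ⟨x, hx⟩ ⟨x, hxt⟩ rfl))
  have hφ : ∀ s, s ⊂ Finset.range n → K.KEmbOn (S s) φ := fun s hs =>
    ⟨(S' s).subtype.comp (f s hs).toEmbedding,
      (isKEmb_subtype (HS'.cube.1.strong s (hpow s hs))).comp
        (isKEmb_equiv _ (K.mem_of_strong _ (HS.cube.1.strong s (hpow s hs))).1),
      fun x => (hφf ⟨s, hs⟩ x x.2).symm⟩
  have himg : ∀ s, s ⊂ Finset.range n → S' s = img φ (S s) := by
    intro s hs
    ext y
    rw [(hφ s hs).mem_img]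
    constructor
    · intro hy
      obtain ⟨x, hx⟩ := (f s hs).surjective ⟨y, hy⟩
      refine ⟨x, x.2, (hφf ⟨s, hs⟩ x x.2).trans ?_⟩
      exact congrArg Subtype.val hx
    · rintro ⟨x, hx, rfl⟩
      rw [hφf ⟨s, hs⟩ x hx]
      exact (f s hs ⟨x, hx⟩).2
  have hgLS := hgood K.LS le_rfl hlam
  obtain ⟨M, g, g', hM, hg, hg', hgg, -⟩ := hgood.exists_amalgam hlam hκ HS HS' hφ himg
    (fun _ _ => False) (A := ∅) (A' := ∅) (by simp) (by simp) (fun _ _ h => h.elim) (by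
      intro E E' hE hE' _ _ _ _ H H' himgE
      obtain ⟨P, h, h', hP, hh, hh', hag⟩ := (hgLS.weakUniqueness hn).exists_kEmbOn le_rfl H H'
        (fun s hs => (hφ s hs).mono (HS.cube.1.strong s (hpow s hs)) (H.strong hs.subset)
          inf_le_right) himgE
      rw [HS.cube.2, inf_top_eq] at hh
      rw [HS'.cube.2, inf_top_eq] at hh'
      exact ⟨P, h, h', hP, hh, hh', hag, fun _ _ h => h.elim⟩)
  exact ⟨M, g, g', hM, hg, hg', fun s hs x =>
    (hgg s hs x x.2).trans (congrArg g' (hφf ⟨s, hs⟩ x x.2))⟩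

end WeakForking

/-! ### Boundaries of stable systems are bases in `lam`. -/

namespace AEC

open FirstOrder.Language

variable {L : FirstOrder.Language.{u, u}} {K : AEC L} {N M : K.Model} {I : Finset (Finset ℕ)}
  {S S' : Finset ℕ → L.Substructure N} {μ : Cardinal.{u}}

theorem isPlacement_val (hS : ∀ s ∈ I, K.Strong (S s)) :
    K.IsPlacement I S N (Subtype.val : unionOf I S → N) :=
  ⟨Subtype.val_injective, fun _ _ => Iff.rfl, fun _ _ _ => Iff.rfl,
    fun s hs => ⟨(S s).subtype, isKEmb_subtype (hS s hs), fun _ => rfl⟩⟩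

theorem IsPlacement.codRestrict {j : unionOf I S → M} (h : K.IsPlacement I S M j)
    {E : L.Substructure M} (hE : K.Strong E) (hj : ∀ a, j a ∈ E) :
    K.IsPlacement I S (M.sub E hE) (fun a => (⟨j a, hj a⟩ : E)) := by
  refine ⟨fun a b hab => h.inj (congrArg Subtype.val hab), fun R x => h.rel R x,
    fun f x y => (Subtype.ext_iff).trans (h.func f x y), fun s hs => ?_⟩
  obtain ⟨e, he, he'⟩ := h.strong s hs
  have hmem : ∀ x, e x ∈ E := fun x => by rw [he']; exact hj _
  exact ⟨e.codRestrict E hmem, he.codRestrict hE hmem, fun x => Subtype.ext (he' x)⟩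

theorem IsPlacement.restrict {φ : N → M} (h : K.IsPlacement I S M (fun a => φ a))
    (hS : ∀ s ∈ I, K.Strong (S s)) (hS' : ∀ s ∈ I, K.Strong (S' s)) (hle : ∀ s ∈ I, S' s ≤ S s) :
    K.IsPlacement I S' M (fun a => φ a) := by
  have hU : ∀ x ∈ unionOf I S', x ∈ unionOf I S := fun x ⟨s, hs, hx⟩ => ⟨s, hs, hle s hs hx⟩
  refine ⟨fun a b hab => Subtype.ext (Subtype.mk.inj
      (@h.inj ⟨a, hU a a.2⟩ ⟨b, hU b b.2⟩ hab)),
    fun R x => h.rel R fun i => ⟨x i, hU _ (x i).2⟩,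
    fun f x y => h.func f (fun i => ⟨x i, hU _ (x i).2⟩) ⟨y, hU y y.2⟩, fun s hs => ?_⟩
  obtain ⟨e, he, he'⟩ := h.strong s hs
  exact ⟨e.comp (Substructure.inclusion (hle s hs)),
    he.comp (isKEmb_inclusion (hle s hs) (hS' s hs) (hS s hs)), fun x => he' _⟩

theorem IsPlacement.kEmbOn {φ : N → M} (h : K.IsPlacement I S M (fun a => φ a)) {s : Finset ℕ}
    (hs : s ∈ I) : K.KEmbOn (S s) φ := by
  obtain ⟨e, he, he'⟩ := h.strong s hs
  exact ⟨e, he, he'⟩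

theorem IsAmalgBase.exists_kEmbOn (h : K.IsAmalgBase μ N I S) {φ : N → M}
    (hφ : K.IsPlacement I S M (fun a => φ a)) {E : L.Substructure N} {E' : L.Substructure M}
    (hE : K.Strong E) (hEc : #E = μ) (hSE : ∀ s ∈ I, S s ≤ E) (hE' : K.Strong E') (hEc' : #E' = μ)
    (hφE : ∀ s ∈ I, ∀ x ∈ S s, φ x ∈ E') :
    ∃ (Q : K.Model) (γ : N → Q) (γ' : M → Q), #Q = μ ∧ K.KEmbOn E γ ∧ K.KEmbOn E' γ' ∧
      ∀ s ∈ I, ∀ x ∈ S s, γ x = γ' (φ x) := by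
  have hUE : ∀ a : unionOf I S, (a : N) ∈ E := fun ⟨x, s, hs, hx⟩ => hSE s hs hx
  have hUE' : ∀ a : unionOf I S, φ a ∈ E' := fun ⟨x, s, hs, hx⟩ => hφE s hs x hx
  obtain ⟨Q, g₁, g₂, hQ, hg₁, hg₂, hgg⟩ := h.2.2 (N.sub E hE) (M.sub E' hE') hEc hEc' _ _
    ((isPlacement_val h.2.1.strong).codRestrict hE hUE) (hφ.codRestrict hE' hUE')
  have := nonempty_of_card h.1 hQ
  obtain ⟨γ, hγ, hγg, -⟩ := AEC.exists_kEmbOn (N := N) (T := E) hg₁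
  obtain ⟨γ', hγ', hγg', -⟩ := AEC.exists_kEmbOn (N := M) (T := E') hg₂
  refine ⟨Q, γ, γ', hQ, hγ, hγ', fun s hs x hx => ?_⟩
  exact (hγg ⟨x, hSE s hs hx⟩).trans ((hgg ⟨x, s, hs, hx⟩).trans
    (hγg' ⟨φ x, hφE s hs x hx⟩).symm)

end AEC

namespace WeakForking

open FirstOrder.Language

variable {L : FirstOrder.Language.{u, u}} {K : AEC L} {W : WeakForking K} {N M : K.Model}
  {lam : Cardinal.{u}} {n : ℕ} {S : Finset ℕ → L.Substructure N}

/-- The trace of a stable system on an adapted set stays stable in each model that contains the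
boundary of the system. -/
theorem Adapted.exists_stableIn_of_placement {X : Set N} (hX : W.Adapted (Finset.range n) N S X)
    (hgood : W.GoodAt #X) {r : Finset ℕ → ℕ} (hr : IsRank r)
    (H : W.StableWrt (fun t w => r w < r t) lam (Finset.range n) N S) (hn : 1 ≤ n) {φ : N → M}
    (hφ : K.IsPlacement (Finset.range n).ssubsets S M (fun a => φ a)) :
    ∃ T : Finset ℕ → L.Substructure M, W.StableIn #X (Finset.range n) M T ∧
      ∀ w, w ⊂ Finset.range n → T w = img φ (res S X w) := by
  have hne : (Finset.range n).Nonempty := Finset.nonempty_range_iff.2 (by omega)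
  have hbase := hX.isAmalgBase_res hgood hr H subset_rfl hne
  have hst := hX.stableIn_res hgood hr H subset_rfl
  have hsub : ∀ w ∈ (Finset.range n).ssubsets, w ⊂ Finset.range n := fun w hw =>
    Finset.mem_ssubsets.1 hw
  have hφ' : K.IsPlacement (Finset.range n).ssubsets (res S X) M (fun a => φ a) :=
    hφ.restrict (fun w hw => H.strong (hsub w hw).subset) hbase.2.1.strong fun w _ => res_le w
  -- A small strong submodel of `M` around the image of the traced boundary. It becomes the last
  -- model of the new system.
  obtain ⟨E, hE, hAE, hEc⟩ := exists_strong M.mem (φ '' bdry (res S X) (Finset.range n))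
  have hAE' : ∀ w ∈ (Finset.range n).ssubsets, ∀ x ∈ res S X w, φ x ∈ E := fun w hw x hx =>
    hAE ⟨x, ⟨w, hw, hx⟩, rfl⟩
  have hXinf : ℵ₀ ≤ #X := K.aleph0_le_LS.trans hgood.le
  have hEcard : #E = #X := by
    refine le_antisymm (hEc.trans ?_) ?_
    · rw [← Cardinal.add_eq_self hXinf]
      refine add_le_add (Cardinal.mk_image_le.trans (Cardinal.mk_le_mk_of_subset ?_)) hgood.le
      rintro x ⟨w, -, hx⟩
      exact (hX.mem_res.1 hx).1
    · have he : ∅ ∈ (Finset.range n).ssubsets := Finset.mem_ssubsets.2 (Finset.empty_ssubset.2 hne)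
      rw [← hX.card ∅ (by simp), ← (hφ'.kEmbOn he).mk_img]
      refine Cardinal.mk_le_mk_of_subset ?_
      intro y hy
      obtain ⟨x, hx, rfl⟩ := (hφ'.kEmbOn he).mem_img.1 hy
      exact hAE' ∅ he x hx
  -- The traced boundary is a base, so `E` and the trace of `N` embed in one model `Q` over it.
  -- There the stable system can exchange its last model for `E`.
  obtain ⟨Q, γ, γ', hQ, hγ, hγ', hγγ⟩ := hbase.exists_kEmbOn hφ' (hX.strong _ subset_rfl)
    (hX.card _ subset_rfl) (fun w hw => hst.mono (hsub w hw).subset subset_rfl) hE hEcard hAE'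
  refine ⟨Function.update (fun w => img φ (res S X w)) (Finset.range n) E, ?_,
    fun w hw => Function.update_of_ne hw.ne _ _⟩
  have hle : ∀ w, w ⊆ Finset.range n →
      Function.update (fun w => img φ (res S X w)) (Finset.range n) E w ≤ E := by
    intro w hw
    rcases eq_or_ssubset_of_subset hw with rfl | hlt
    · rw [Function.update_self]
    · rw [Function.update_of_ne hlt.ne]
      intro y hy
      have hw' := Finset.mem_ssubsets.2 hlt
      obtain ⟨x, hx, rfl⟩ := (hφ'.kEmbOn hw').mem_img.1 hy
      exact hAE' w hw' x hx
  refine (stableWrt_img_iff hE hγ' hle fun w _ => rfl).1 ?_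
  have h1 : W.StableIn #X (Finset.range n) Q (fun w => img γ (res S X w)) :=
    (stableWrt_img_iff (hX.strong _ subset_rfl) hγ (fun w hw => hst.mono hw subset_rfl)
      fun w _ => rfl).2 hst
  have hother : ∀ w, w ⊂ Finset.range n →
      img γ' (Function.update (fun w => img φ (res S X w)) (Finset.range n) E w) =
        img γ (res S X w) := by
    intro w hw
    have hw' := Finset.mem_ssubsets.2 hw
    rw [Function.update_of_ne hw.ne, img_img (hφ'.kEmbOn hw') le_rfl]
    exact (img_congr fun x hx => hγγ w hw' x hx).symm
  refine h1.change_top hother ?_ ?_ fun w hw => ?_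
  · rw [Function.update_self]; exact hγ'.strong_img
  · rw [Function.update_self, hγ'.mk_img, hEcard]
  · rw [← hother w hw, Function.update_self]
    exact Substructure.closure_mono (Set.image_mono (hle w hw.subset))

/-- A stable system stays stable in each model that contains its boundary. -/
theorem GoodBelow.isStable_of_placement (hgood : W.GoodBelow lam) (hlam : K.LS < lam)
    (hκ : W.κ ≤ K.LS) (hn : 1 ≤ n) (HS : W.IsStable lam (Finset.range n) N S) (hM : #M = lam)
    {φ : N → M} (hφ : K.IsPlacement (Finset.range n).ssubsets S M (fun a => φ a)) :
    W.IsStable lam (Finset.range n) M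
      (Function.update (fun w => img φ (S w)) (Finset.range n) ⊤) := by
  have hself : Function.update (fun w => img φ (S w)) (Finset.range n) ⊤ (Finset.range n) = ⊤ :=
    Function.update_self _ _ _
  have hother : ∀ w, w ⊂ Finset.range n →
      Function.update (fun w => img φ (S w)) (Finset.range n) ⊤ w = img φ (S w) :=
    fun w hw => Function.update_of_ne hw.ne _ _
  have hK : ∀ w, w ⊂ Finset.range n → K.KEmbOn (S w) φ := fun w hw =>
    hφ.kEmbOn (Finset.mem_ssubsets.2 hw)
  have hinj : ∀ w v, w ⊂ Finset.range n → v ⊂ Finset.range n → ∀ x ∈ S w, ∀ y ∈ S v,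
      φ x = φ y → x = y := fun w v hw hv x hx y hy hxy =>
    congrArg Subtype.val (@IsPlacement.inj _ _ _ _ _ _ _ hφ
      ⟨x, w, Finset.mem_ssubsets.2 hw, hx⟩ ⟨y, v, Finset.mem_ssubsets.2 hv, hy⟩ hxy)
  obtain ⟨Hs, htop⟩ := isStable_iff.1 HS
  obtain ⟨r, hr⟩ := exists_isRank
  have H := Hs.weaken (ρ' := fun t w => r w < r t) fun t w _ _ h => hr.not_subset h
  obtain ⟨C, hC, hCad⟩ := exists_setClub_adapted hκ Hs.sys htop
  obtain ⟨X, -, hX⟩ := hC.exists_filtration K.aleph0_le_LS hlam (mk_eq_of_top Hs.sys htop) ∅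
    (by simp)
  have hlim : Order.IsSuccLimit lam.ord :=
    Cardinal.isSuccLimit_ord (K.aleph0_le_LS.trans hlam.le)
  have hne : Nonempty (Set.Iio lam.ord) := ⟨⟨0, hlim.bot_lt⟩⟩
  have hg : ∀ i : Set.Iio lam.ord, W.GoodAt #(X i) := fun i =>
    hgood _ (hX.le_card _) (hX.card_lt _ i.2)
  -- It is not yet known that the boundary of `S` is a base, but the boundaries of its small traces
  -- are. The traces are therefore stable in `M`, and the stability of their union is recovered from
  -- them.
  choose T hT hTimg using fun i : Set.Iio lam.ord =>
    (hCad _ (hX.mem i)).exists_stableIn_of_placement (hg i) hr H hn hφ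
  have hcases : ∀ w ∈ (Finset.range n).powerset, w = Finset.range n ∨ w ⊂ Finset.range n :=
    fun w hw => eq_or_ssubset_of_subset (Finset.mem_powerset.1 hw)
  have hTmem : ∀ i w, w ⊂ Finset.range n → ∀ y, y ∈ T i w ↔ ∃ x ∈ res S (X i) w, φ x = y := by
    intro i w hw y
    rw [hTimg i w hw, ← SetLike.mem_coe, (hK w hw).coe_img_of_le (res_le w)]
    rfl
  refine isStable_iff.2 ⟨stableIn_of_chain (ι := Set.Iio lam.ord) (T := T)
    (ν := fun i => #(X i)) ?_ (fun t ht hne => ?_) hT (fun w hw i j hij => ?_)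
    (fun i w hw => ?_) (fun w hw y hy => ?_) (fun t ht hne i j hij => ?_), hself⟩
  · refine ⟨Hs.sys.nonempty, Hs.sys.down, fun w hw => ?_, fun w hw v hv hwv => ?_,
      fun w hw v hv => ?_, fun w hw => ?_⟩
    · rcases hcases w hw with rfl | h
      · rw [hself]; exact K.strong_top M.mem
      · rw [hother w h]; exact (hK w h).strong_img
    · rcases hcases v hv with rfl | h
      · rw [hself]; exact le_top
      · rw [hother v h, hother w (lt_of_le_of_lt hwv h)]
        exact Substructure.closure_mono (Set.image_mono (Hs.mono hwv h.subset))
    · rcases hcases w hw with rfl | h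
      · rw [Finset.inter_eq_right.2 (Finset.mem_powerset.1 hv), hself, top_inf_eq]
      · rcases hcases v hv with rfl | h'
        · rw [Finset.inter_eq_left.2 (Finset.mem_powerset.1 hw), hself, inf_top_eq]
        · have h'' := lt_of_le_of_lt (Finset.inter_subset_left (s₂ := v)) h
          rw [hother w h, hother v h', hother _ h'']
          ext y
          rw [Substructure.mem_inf, (hK _ h'').mem_img, (hK _ h).mem_img, (hK _ h').mem_img]
          constructor
          · rintro ⟨x, hx, rfl⟩
            rw [Hs.inter h.subset h'.subset] at hx
            exact ⟨⟨x, hx.1, rfl⟩, ⟨x, hx.2, rfl⟩⟩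
          · rintro ⟨⟨x, hx, rfl⟩, ⟨z, hz, hzx⟩⟩
            obtain rfl := hinj v w h' h z hz x hx hzx
            refine ⟨z, ?_, rfl⟩
            rw [Hs.inter h.subset h'.subset]
            exact ⟨hx, hz⟩
    · rcases hcases w hw with rfl | h
      · rw [hself, mk_top, hM]
      · rw [hother w h, (hK w h).mk_img, Hs.card h.subset]
  · have hsub : ∀ w ∈ t.ssubsets, w ⊂ t := fun w hw => Finset.mem_ssubsets.1 hw
    exact (isAmalgBase_img_iff (Hs.strong ht.subset) (hK t ht)
      (fun w hw => Hs.mono (hsub w hw).subset ht.subset)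
      fun w hw => hother w ((hsub w hw).trans ht)).2 (Hs.base t ht hne)
  · change T i w ≤ T j w
    rw [hTimg i w hw, hTimg j w hw]
    exact Substructure.closure_mono (Set.image_mono (res_mono (hX.mono hij) w))
  · rw [hTimg i w hw, hother w hw]
    exact Substructure.closure_mono (Set.image_mono (res_le w))
  · rw [hother w hw] at hy
    obtain ⟨x, hx, rfl⟩ := (hK w hw).mem_img.1 hy
    have hx' : x ∈ X lam.ord := by rw [hX.top]; trivial
    rw [hX.limit _ hlim] at hx'
    obtain ⟨j, hj, hxj⟩ := Set.mem_iUnion₂.1 hx'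
    exact ⟨⟨j, hj⟩, (hTmem ⟨j, hj⟩ w hw _).2
      ⟨x, (hCad _ (hX.mem j)).mem_res.2 ⟨hxj, hx⟩, rfl⟩⟩
  · have hsub : ∀ w ∈ t.ssubsets, w ⊂ t := fun w hw => Finset.mem_ssubsets.1 hw
    have hb := (hCad _ (hX.mem i)).isAmalgBase_res (hg i) hr H ht.subset hne
    have hle : ∀ k : Set.Iio lam.ord, ∀ w ∈ t.ssubsets, res S (X k) w ≤ S t := fun k w hw =>
      (res_le w).trans (Hs.mono (hsub w hw).subset ht.subset)
    -- The independence along the chain takes place inside `S t`, where `φ` is a `K`-embedding, and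
    -- so passes to `M`.
    have h1 : W.Indep N (res S (X i) t) (unionOf t.ssubsets (res S (X i)))
        (bdry (res S (X j)) t) :=
      ((hCad _ (hX.mem i)).indep_bdry t ht.subset (hg i) hb).mono_right hb.ab_bdry
        ((Adapted.bdry_res_subset t).trans Set.subset_union_left)
    have h2 := (indep_img_iff (Hs.strong ht.subset) (hK t ht) hb (hle i) (A := res S (X i) t)
      (B := bdry (res S (X j)) t) (res_le t) (fun x ⟨w, hw, hx⟩ => hle j w hw hx)).2 h1
    have hbd : ∀ k : Set.Iio lam.ord, bdry (T k) t = φ '' bdry (res S (X k)) t := fun k =>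
      unionOf_img (hK t ht) (hle k) fun w hw => hTimg k w ((hsub w hw).trans ht)
    rw [hbd i, hbd j, hTimg i t ht, (hK t ht).coe_img_of_le (res_le t)]
    exact h2

/-- Each placement of the boundary of `S` in a model extends to a stable system with that last
model. Two placements thus give stable systems with isomorphic boundaries, and weak uniqueness
amalgamates them. Existence in `lam`, which depends on this lemma, is not used. -/
theorem GoodBelow.isAmalgBase (hgood : W.GoodBelow lam) (hlam : K.LS < lam) (hκ : W.κ ≤ K.LS)
    (hn : 1 ≤ n) (HS : W.IsStable lam (Finset.range n) N S) :
    K.IsAmalgBase lam N (Finset.range n).ssubsets S := by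
  classical
  have hne : (Finset.range n).Nonempty := Finset.nonempty_range_iff.2 (by omega)
  have hNne := nonempty_of_card hlam.le (mk_eq_of_top HS.cube.1 HS.cube.2)
  refine ⟨hlam.le, HS.cube.1.ssubsets subset_rfl hne, fun M₁ M₂ hM₁ hM₂ j₁ j₂ hj₁ hj₂ => ?_⟩
  have hext : ∀ (M : K.Model) (j : unionOf (Finset.range n).ssubsets S → M), #M = lam →
      ∃ φ : N → M, ∀ a : unionOf (Finset.range n).ssubsets S, φ a = j a := by
    intro M j hM
    have := nonempty_of_card hlam.le hM
    obtain ⟨φ, hφ⟩ := exists_glue (fun _ : Unit => unionOf (Finset.range n).ssubsets S)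
      (fun _ => j) fun _ _ _ _ _ => rfl
    exact ⟨φ, fun a => hφ () a.1 a.2⟩
  obtain ⟨φ₁, hφ₁⟩ := hext M₁ j₁ hM₁
  obtain ⟨φ₂, hφ₂⟩ := hext M₂ j₂ hM₂
  have hp₁ : K.IsPlacement (Finset.range n).ssubsets S M₁ (fun a => φ₁ a) := by
    rw [show (fun a : unionOf (Finset.range n).ssubsets S => φ₁ a) = j₁ from funext hφ₁]
    exact hj₁
  have hp₂ : K.IsPlacement (Finset.range n).ssubsets S M₂ (fun a => φ₂ a) := by
    rw [show (fun a : unionOf (Finset.range n).ssubsets S => φ₂ a) = j₂ from funext hφ₂]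
    exact hj₂
  have H₁ := hgood.isStable_of_placement hlam hκ hn HS hM₁ hp₁
  have H₂ := hgood.isStable_of_placement hlam hκ hn HS hM₂ hp₂
  have hK₁ : ∀ w, w ⊂ Finset.range n → K.KEmbOn (S w) φ₁ := fun w hw =>
    hp₁.kEmbOn (Finset.mem_ssubsets.2 hw)
  have hK₂ : ∀ w, w ⊂ Finset.range n → K.KEmbOn (S w) φ₂ := fun w hw =>
    hp₂.kEmbOn (Finset.mem_ssubsets.2 hw)
  have ho : ∀ {M : K.Model} (φ : N → M) w, w ⊂ Finset.range n →
      Function.update (fun w => img φ (S w)) (Finset.range n) ⊤ w = img φ (S w) :=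
    fun φ w hw => Function.update_of_ne hw.ne _ _
  obtain ⟨ψ, hψ⟩ := exists_common_inverse HS.cube.1 H₁.cube.1 hK₁ (ho φ₁)
  have hψK : ∀ w, w ⊂ Finset.range n → K.KEmbOn (img φ₁ (S w)) ψ := fun w hw => by
    have := (hψ w hw).1
    rwa [ho φ₁ w hw] at this
  have hψS : ∀ w, w ⊂ Finset.range n → ∀ y ∈ img φ₁ (S w), ψ y ∈ S w := by
    intro w hw y hy
    obtain ⟨x, hx, rfl⟩ := (hK₁ w hw).mem_img.1 hy
    rwa [(hψ w hw).2 x hx]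
  have hS : ∀ w, w ⊂ Finset.range n → K.Strong (S w) := fun w hw =>
    HS.cube.1.strong w (Finset.mem_powerset.2 hw.subset)
  obtain ⟨M, g, g', hM, hg, hg', hgg⟩ :=
    (hgood.hasWeakUniqueness hlam hκ hn).exists_kEmbOn (φ := fun y => φ₂ (ψ y)) hlam.le
      (isStable_iff.1 H₁).1 (isStable_iff.1 H₂).1
      (fun w hw => by
        rw [ho φ₁ w hw]
        exact (hK₂ w hw).comp (hS w hw) (hψK w hw) (hψS w hw))
      (fun w hw => by
        rw [ho φ₁ w hw, ho φ₂ w hw, img_img (hK₁ w hw) le_rfl]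
        exact (img_congr fun x hx => congrArg φ₂ ((hψ w hw).2 x hx)).symm)
  rw [Function.update_self] at hg hg'
  obtain ⟨f, hf, hfg⟩ := hg.exists_embedding
  obtain ⟨f', hf', hfg'⟩ := hg'.exists_embedding
  refine ⟨M, f, f', hM, hf, hf', fun a => ?_⟩
  obtain ⟨x, w, hw, hx⟩ := a
  have hw' := Finset.mem_ssubsets.1 hw
  rw [← hφ₁, ← hφ₂, hfg, hfg', hgg w hw' (φ₁ x) (by
    rw [ho φ₁ w hw']
    exact (hK₁ w hw').mem_img.2 ⟨x, hx, rfl⟩), (hψ w hw').2 x hx]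

theorem GoodBelow.boundaries (hgood : W.GoodBelow lam) (hlam : K.LS < lam) (hκ : W.κ ≤ K.LS) :
    W.BoundariesAmalgamate lam := by
  refine boundariesAmalgamate_of_range fun n N S hn H => ?_
  exact (isAmalgBase_map_iff (isKEmb_subtype (H.strong subset_rfl)) fun w hw =>
    (map_subtype_comap (H.mono (Finset.mem_ssubsets.1 hw).subset subset_rfl)).symm).2
    (hgood.isAmalgBase hlam hκ hn H.isStable_comap)

end WeakForking

/-! ### Open systems, adapted families and cocones. -/

namespace WeakForking

open FirstOrder.Language

variable {L : FirstOrder.Language.{u, u}} {K : AEC L} {W : WeakForking K} {P : K.Model}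
  {μ lam : Cardinal.{u}} {n : ℕ}

/-- The models of a stable `𝒫(n + 1)`-system that contain the last vertex form a stable system. -/
theorem GoodAt.stableIn_topFace (hgood : W.GoodAt μ) {T : Finset ℕ → L.Substructure P}
    (H : W.StableIn μ (Finset.range (n + 1)) P T) {t : Finset ℕ} (ht : t ⊆ Finset.range n) :
    W.StableIn μ t P (fun w => T (insert n w)) := by
  have hins : ∀ w, w ⊆ Finset.range n → insert n w ⊆ Finset.range (n + 1) := fun w hw => by
    rw [Finset.range_add_one]
    exact Finset.insert_subset_insert _ hw
  induction t using Finset.strongInduction with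
  | H t ih =>
    have hsub : ∀ w ∈ t.powerset, insert n w ⊆ Finset.range (n + 1) := fun w hw =>
      hins w ((Finset.mem_powerset.1 hw).trans ht)
    have hbase : ∀ q, q ⊂ t → q.Nonempty →
        K.IsAmalgBase μ P q.ssubsets (fun w => T (insert n w)) := fun q hq hne =>
      hgood.boundaries P q _ hne (ih q hq (hq.subset.trans ht))
    refine ⟨⟨⟨∅, by simp⟩,
      fun _ ha _ hb => Finset.mem_powerset.2 (hb.trans (Finset.mem_powerset.1 ha)),
      fun w hw => H.strong (hsub w hw),
      fun w hw v hv hwv => H.mono (Finset.insert_subset_insert _ hwv) (hsub v hv),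
      fun w hw v hv => ?_, fun w hw => H.card (hsub w hw)⟩, hbase, fun q hq hne => ?_⟩
    · rw [Finset.insert_inter_distrib]
      exact H.inter (hsub w hw) (hsub v hv)
    · have hqn : q ⊂ Finset.range n := hq.trans_subset ht
      have hnq : n ∉ q := fun h => Finset.notMem_range_self (hqn.subset h)
      have hq1 : q ⊂ Finset.range (n + 1) := hqn.trans (range_ssubset_range_add_one n)
      have hiq : insert n q ⊂ Finset.range (n + 1) := insert_ssubset_range hqn
      have hab := (hbase q hq hne).ab_bdry
      have habq := (H.base q hq1 hne).ab_bdry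
      have habi := (H.base _ hiq ⟨n, Finset.mem_insert_self _ _⟩).ab_bdry
      set B : Set P := {x | ∃ w, w ⊂ t ∧ ¬ q ⊆ w ∧ x ∈ T (insert n w)}
      have hnot : ∀ w, ¬ q ⊆ w → ¬ q ⊆ insert n w := fun w hw h =>
        hw fun i hi => (Finset.mem_insert.1 (h hi)).resolve_left fun h' => hnq (h' ▸ hi)
      have hbdry : bdry T (insert n q) = bdry (fun w => T (insert n w)) q ∪ (T q : Set P) := by
        ext x
        rw [Set.mem_union, mem_bdry, mem_bdry]
        constructor
        · rintro ⟨w, hw, hx⟩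
          by_cases hnw : n ∈ w
          · refine Or.inl ⟨w.erase n, Finset.ssubset_iff_subset_ne.2
              ⟨Finset.subset_insert_iff.1 hw.subset, fun h => hw.ne ?_⟩, ?_⟩
            · rw [← h, Finset.insert_erase hnw]
            · rwa [Finset.insert_erase hnw]
          · exact Or.inr (H.mono ((Finset.subset_insert_iff_of_notMem hnw).1 hw.subset)
              hq1.subset hx)
        · rintro (⟨w, hw, hx⟩ | hx)
          · refine ⟨insert n w, Finset.ssubset_iff_subset_ne.2
              ⟨Finset.insert_subset_insert _ hw.subset, fun h => hw.ne ?_⟩, hx⟩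
            rw [← Finset.erase_insert (fun h => hnq (hw.subset h)), h, Finset.erase_insert hnq]
          · exact ⟨q, Finset.ssubset_insert hnq, hx⟩
      have h1 : W.Indep P (T q) (bdry (fun w => T (insert n w)) q) B := by
        refine ((H.indep q hq1 hne).base_mono habq hab ?_ ?_).mono_right hab ?_
        · intro x hx
          obtain ⟨w, hw, hx⟩ := mem_bdry.1 hx
          exact mem_bdry.2 ⟨w, hw, H.mono (Finset.subset_insert _ _)
            (hins w (hw.trans hqn).subset) hx⟩
        · intro x hx
          obtain ⟨w, hw, hx⟩ := mem_bdry.1 hx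
          exact Or.inl ⟨insert n w, insert_ssubset_range (hw.trans hqn), hnot w hw.not_subset, hx⟩
        · rintro x ⟨w, hw, hqw, hx⟩
          exact Or.inl ⟨insert n w, insert_ssubset_range (hw.trans_subset ht), hnot w hqw, hx⟩
      have h2 : W.Indep P (T (insert n q)) (bdry T (insert n q)) B := by
        refine (H.indep _ hiq ⟨n, Finset.mem_insert_self _ _⟩).mono_right habi ?_
        rintro x ⟨w, hw, hqw, hx⟩
        exact Or.inl ⟨insert n w, insert_ssubset_range (hw.trans_subset ht),
          fun h => hnot w hqw ((Finset.subset_insert _ _).trans h), hx⟩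
      -- The boundary `bdry T (insert n q)` is the boundary within the top face, enlarged by `T q`.
      -- By `h1` the set `B` is independent from `T q`, and by `h2` from `T (insert n q)` over the
      -- enlarged boundary; transitivity joins the two.
      refine (((h1.symm hab).mono_right hab ?_).trans hab habi ?_ (h2.symm habi)).symm hab
      · rw [hbdry, Set.union_comm]
      · rw [hbdry]
        exact Set.subset_union_left

variable {R : OpenSystem K lam n}

theorem OpenSystem.face_self (s : {s : Finset ℕ // s ⊂ Finset.range n}) : R.face s s.1 = ⊤ := by
  rw [OpenSystem.face, dif_pos subset_rfl]
  exact eq_top_iff.2 fun x _ => ⟨x, R.refl s x⟩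

theorem OpenSystem.mem_face {w s : {s : Finset ℕ // s ⊂ Finset.range n}} (h : w ≤ s) {y : R.M s} :
    y ∈ R.face s w.1 ↔ ∃ x, R.e h x = y := by
  rw [OpenSystem.face, dif_pos (show w.1 ⊆ s.1 from h)]
  rfl

/-- A family of sets adapted to the faces of an open system. -/
structure OpenAdapted (W : WeakForking K) (R : OpenSystem K lam n) (μ : Cardinal.{u})
    (Y : ∀ s, Set (R.M s)) : Prop where
  adapted : ∀ s, W.Adapted s.1 (R.M s) (R.face s) (Y s)
  card : ∀ s, #(Y s) = μ
  mem_iff : ∀ {s t} (h : s ≤ t) (x : R.M s), R.e h x ∈ Y t ↔ x ∈ Y s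

/-- Compatible `K`-embeddings of the submodels `Y s` of an open system in `P`. -/
structure Cocone (R : OpenSystem K lam n) (Y : ∀ s, Set (R.M s)) (P : K.Model)
    (h : ∀ s, R.M s → P) : Prop where
  emb : ∀ s, K.KEmbOn (Substructure.closure L (Y s)) (h s)
  compat : ∀ {s t} (hst : s ≤ t), ∀ x ∈ Y s, h t (R.e hst x) = h s x

/-- A cocone whose image is a stable system. -/
structure StableCocone (W : WeakForking K) (R : OpenSystem K lam n) (μ : Cardinal.{u})
    (Y : ∀ s, Set (R.M s)) (P : K.Model) (h : ∀ s, R.M s → P) : Prop extends Cocone R Y P h where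
  stable : ∃ S, W.IsStable μ (Finset.range n) P S ∧
    ∀ s, S s.1 = img (h s) (Substructure.closure L (Y s))

namespace OpenAdapted

variable {Y Z : ∀ s, Set (R.M s)}

theorem mem_closure (hY : W.OpenAdapted R μ Y) (s) {x : R.M s} :
    x ∈ Substructure.closure L (Y s) ↔ x ∈ Y s := by
  rw [← SetLike.mem_coe, (hY.adapted s).coe]

theorem res_self (s) : res (R.face s) (Y s) s.1 = Substructure.closure L (Y s) :=
  res_of_top (OpenSystem.face_self s)

theorem strong (hY : W.OpenAdapted R μ Y) (s) : K.Strong (Substructure.closure L (Y s)) := by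
  rw [← res_self]
  exact (hY.adapted s).strong _ subset_rfl

theorem card_closure (hY : W.OpenAdapted R μ Y) (s) : #(Substructure.closure L (Y s)) = μ := by
  rw [← res_self, (hY.adapted s).card _ subset_rfl, hY.card]

theorem mem_res (hY : W.OpenAdapted R μ Y) {w s} (h : w ≤ s) {y : R.M s} :
    y ∈ res (R.face s) (Y s) w.1 ↔ ∃ x ∈ Y w, R.e h x = y := by
  rw [(hY.adapted s).mem_res, OpenSystem.mem_face h]
  constructor
  · rintro ⟨hy, x, rfl⟩
    exact ⟨x, (hY.mem_iff h x).1 hy, rfl⟩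
  · rintro ⟨x, hx, rfl⟩
    exact ⟨(hY.mem_iff h x).2 hx, x, rfl⟩

end OpenAdapted

section

variable {Y Z : ∀ s, Set (R.M s)} {h : ∀ s, R.M s → P}

/-- The image of a face is the same whether it is computed in `R.M w` or in `R.M s`. The images of
the `Y s` therefore form a single family in `P`. -/
theorem Cocone.img_res (hc : Cocone R Z P h) (hY : W.OpenAdapted R μ Y)
    (hYZ : ∀ s, Y s ⊆ Z s) {w s} (hws : w ≤ s) :
    img (h s) (res (R.face s) (Y s) w.1) = img (h w) (Substructure.closure L (Y w)) := by
  have h1 : (h s '' (res (R.face s) (Y s) w.1 : Set (R.M s))) =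
      h w '' (Substructure.closure L (Y w) : Set (R.M w)) := by
    ext y
    constructor
    · rintro ⟨x, hx, rfl⟩
      obtain ⟨z, hz, rfl⟩ := (hY.mem_res hws).1 hx
      exact ⟨z, (hY.mem_closure w).2 hz, (hc.compat hws z (hYZ w hz)).symm⟩
    · rintro ⟨z, hz, rfl⟩
      have hz' := (hY.mem_closure w).1 hz
      exact ⟨R.e hws z, (hY.mem_res hws).2 ⟨z, hz', rfl⟩, hc.compat hws z (hYZ w hz')⟩
  rw [img, img, h1]

theorem Cocone.mem_img (hc : Cocone R Z P h) (hY : W.OpenAdapted R μ Y) (hYZ : ∀ s, Y s ⊆ Z s)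
    {s} {y : P} : y ∈ img (h s) (Substructure.closure L (Y s)) ↔ ∃ x ∈ Y s, h s x = y := by
  rw [← SetLike.mem_coe, (hc.emb s).coe_img_of_le (Substructure.closure_mono (hYZ s)),
    (hY.adapted s).coe]
  rfl

end

section Restrict

variable {Y : ∀ s, Set (R.M s)}

/-- The open system of the submodels `Y s`. -/
noncomputable def OpenAdapted.restrict (hY : W.OpenAdapted R μ Y) : OpenSystem K μ n where
  M s := (R.M s).sub (Substructure.closure L (Y s)) (hY.strong s)
  e {s t} h := ((R.e h).comp (Substructure.closure L (Y s)).subtype).codRestrict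
    (Substructure.closure L (Y t)) fun x =>
      (hY.mem_closure t).2 ((hY.mem_iff h x).2 ((hY.mem_closure s).1 x.2))
  isKEmb {s t} h := ((R.isKEmb h).domRestrict (hY.strong s)).codRestrict (hY.strong t) _
  refl s x := Subtype.ext (R.refl s x)
  comp h h' x := Subtype.ext (R.comp h h' x)
  inter {q r s t} hq hr hs hqrs := by
    have hi := R.inter hq hr hs hqrs
    have hx : ∀ (v : {s : Finset ℕ // s ⊂ Finset.range n}) (hv : v ≤ t)
        (y : Substructure.closure L (Y t)),
        y ∈ Set.range (((R.e hv).comp (Substructure.closure L (Y v)).subtype).codRestrict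
          (Substructure.closure L (Y t)) fun x =>
            (hY.mem_closure t).2 ((hY.mem_iff hv x).2 ((hY.mem_closure v).1 x.2))) ↔
        y.1 ∈ Set.range (R.e hv) := by
      intro v hv y
      constructor
      · rintro ⟨x, rfl⟩
        exact ⟨x, rfl⟩
      · rintro ⟨x, hx⟩
        refine ⟨⟨x, (hY.mem_closure v).2 ((hY.mem_iff hv x).1 ?_)⟩, Subtype.ext hx⟩
        rw [hx]
        exact (hY.mem_closure t).1 y.2
    ext y
    rw [Set.mem_inter_iff]
    exact (hx q hq y).trans ((by rw [hi]; rfl :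
      y.1 ∈ Set.range (R.e hq) ↔ y.1 ∈ Set.range (R.e hr) ∧ y.1 ∈ Set.range (R.e hs)).trans
        (and_congr (hx r hr y) (hx s hs y)).symm)
  card s := hY.card_closure s

variable {r : Finset ℕ → ℕ}

theorem OpenAdapted.isStable_face_restrict (hY : W.OpenAdapted R μ Y) (hgood : W.GoodAt μ)
    (hR : ∀ s, W.IsStable lam s.1 (R.M s) (R.face s)) (s) :
    W.IsStable μ s.1 (hY.restrict.M s) (hY.restrict.face s) := by
  obtain ⟨r, hr⟩ := exists_isRank
  have H := (isStable_iff.1 (hR s)).1.weaken (ρ' := fun t w => r w < r t)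
    fun t w _ _ h => hr.not_subset h
  have hst := (hY.adapted s).stableIn_res ((hY.card s).symm ▸ hgood) hr H subset_rfl
  rw [hY.card s] at hst
  refine isStable_iff.2 ⟨?_, OpenSystem.face_self s⟩
  refine (stableWrt_map_iff (isKEmb_subtype (hY.strong s)) fun w hw => ?_).1 hst
  have hws : (⟨w, lt_of_le_of_lt hw s.2⟩ : {s : Finset ℕ // s ⊂ Finset.range n}) ≤ s := hw
  ext y
  rw [hY.mem_res hws]
  constructor
  · rintro ⟨x, hx, rfl⟩
    refine ⟨⟨R.e hws x, (hY.mem_closure s).2 ((hY.mem_iff hws x).2 hx)⟩, ?_, rfl⟩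
    exact (OpenSystem.mem_face (R := hY.restrict) hws).2 ⟨⟨x, (hY.mem_closure _).2 hx⟩, rfl⟩
  · rintro ⟨y, hy, rfl⟩
    obtain ⟨x, rfl⟩ := (OpenSystem.mem_face (R := hY.restrict) hws).1 hy
    exact ⟨x.1, (hY.mem_closure _).1 x.2, rfl⟩

/-- Existence, for the submodels `Y s` of an open system. -/
theorem OpenAdapted.exists_stableCocone (hY : W.OpenAdapted R μ Y) (hgood : W.GoodAt μ)
    (hR : ∀ s, W.IsStable lam s.1 (R.M s) (R.face s)) (hn : 1 ≤ n) :
    ∃ (P : K.Model) (h : ∀ s, R.M s → P), #P = μ ∧ W.StableCocone R μ Y P h := by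
  obtain ⟨P, S, f, HS, hf, hr, hc⟩ := hgood.existence hn hY.restrict
    (hY.isStable_face_restrict hgood hR)
  have hP := mk_eq_of_top HS.cube.1 HS.cube.2
  have := nonempty_of_card hgood.le hP
  choose h hh hhf hhr using fun s => AEC.exists_kEmbOn (N := R.M s)
    (T := Substructure.closure L (Y s)) (hf s)
  refine ⟨P, h, hP, ⟨hh, fun {s t} hst x hx => ?_⟩, S, HS, fun s => by rw [hhr, ← hr]; rfl⟩
  have hx' := (hY.mem_closure s).2 hx
  exact (hhf t ⟨R.e hst x, (hY.mem_closure t).2 ((hY.mem_iff hst x).2 hx)⟩).trans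
    ((hc hst ⟨x, hx'⟩).trans (hhf s ⟨x, hx'⟩).symm)

end Restrict

end WeakForking

/-! ### Image systems; the successor step for existence. -/

namespace WeakForking

open FirstOrder.Language

variable {L : FirstOrder.Language.{u, u}} {K : AEC L} {W : WeakForking K} {P : K.Model}
  {μ μ' lam : Cardinal.{u}} {n : ℕ} {R : OpenSystem K lam n} {Y Y' Z : ∀ s, Set (R.M s)}
  {h : ∀ s, R.M s → P}

open Classical in
/-- The images of the submodels `Y s` in `P`. -/
noncomputable def imageSystem (Y : ∀ s, Set (R.M s)) (h : ∀ s, R.M s → P) (w : Finset ℕ) :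
    L.Substructure P :=
  if hw : w ⊂ Finset.range n then img (h ⟨w, hw⟩) (Substructure.closure L (Y ⟨w, hw⟩)) else ⊤

theorem imageSystem_coe (s : {s : Finset ℕ // s ⊂ Finset.range n}) :
    imageSystem Y h s.1 = img (h s) (Substructure.closure L (Y s)) := dif_pos s.2

theorem imageSystem_range : imageSystem Y h (Finset.range n) = ⊤ := dif_neg (lt_irrefl _)

theorem imageSystem_mono (hYZ : ∀ s, Y s ⊆ Z s) (w : Finset ℕ) :
    imageSystem Y h w ≤ imageSystem Z h w := by
  by_cases hw : w ⊂ Finset.range n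
  · rw [imageSystem, imageSystem, dif_pos hw, dif_pos hw]
    exact Substructure.closure_mono (Set.image_mono (Substructure.closure_mono (hYZ _)))
  · rw [imageSystem, imageSystem, dif_neg hw, dif_neg hw]

/-- The system in the definition is only asserted to exist, but `h` determines its proper faces and
its last model is all of `P`. -/
theorem StableCocone.isStable (hc : W.StableCocone R μ Z P h) :
    W.IsStable μ (Finset.range n) P (imageSystem Z h) := by
  obtain ⟨S, HS, hS⟩ := hc.stable
  obtain ⟨H, htop⟩ := isStable_iff.1 HS
  refine isStable_iff.2 ⟨(stableWrt_congr fun w hw => ?_).2 H, imageSystem_range⟩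
  rcases eq_or_ssubset_of_subset hw with rfl | hlt
  · rw [imageSystem_range, htop]
  · exact (imageSystem_coe (Y := Z) (h := h) ⟨w, hlt⟩).trans (hS ⟨w, hlt⟩).symm

namespace Cocone

theorem imageSystem_eq (hc : Cocone R Z P h) (hY : W.OpenAdapted R μ Y) (hYZ : ∀ s, Y s ⊆ Z s)
    {t : {s : Finset ℕ // s ⊂ Finset.range n}} {w : Finset ℕ} (hw : w ⊆ t.1) :
    imageSystem Y h w = img (h t) (res (R.face t) (Y t) w) :=
  (imageSystem_coe ⟨w, lt_of_le_of_lt hw t.2⟩).trans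
    (hc.img_res hY hYZ (w := ⟨w, lt_of_le_of_lt hw t.2⟩) (s := t) hw).symm

theorem mem_imageSystem (hc : Cocone R Z P h) (hY : W.OpenAdapted R μ Y) (hYZ : ∀ s, Y s ⊆ Z s)
    {w : Finset ℕ} (hw : w ⊂ Finset.range n) {y : P} :
    y ∈ imageSystem Y h w ↔ ∃ x ∈ Y ⟨w, hw⟩, h ⟨w, hw⟩ x = y := by
  rw [imageSystem_coe ⟨w, hw⟩]
  exact hc.mem_img hY hYZ

theorem strong_imageSystem (hc : Cocone R Z P h) (hY : W.OpenAdapted R μ Y)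
    (hZ : W.OpenAdapted R μ' Z) (hYZ : ∀ s, Y s ⊆ Z s) {w : Finset ℕ} (hw : w ⊂ Finset.range n) :
    K.Strong (imageSystem Y h w) := by
  rw [imageSystem_coe ⟨w, hw⟩]
  exact ((hc.emb _).mono (hZ.strong _) (hY.strong _)
    (Substructure.closure_mono (hYZ _))).strong_img

theorem card_imageSystem (hc : Cocone R Z P h) (hY : W.OpenAdapted R μ Y)
    (hYZ : ∀ s, Y s ⊆ Z s) {w : Finset ℕ} (hw : w ⊂ Finset.range n) :
    #(imageSystem Y h w) = μ := by
  rw [imageSystem_coe ⟨w, hw⟩, (hc.emb _).mk_img_of_le (Substructure.closure_mono (hYZ _)),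
    hY.card_closure]

theorem imageSystem_le (hc : Cocone R Z P h) (hY : W.OpenAdapted R μ Y) (hYZ : ∀ s, Y s ⊆ Z s)
    {w v : Finset ℕ} (hwv : w ⊆ v) (hv : v ⊆ Finset.range n) :
    imageSystem Y h w ≤ imageSystem Y h v := by
  rcases eq_or_ssubset_of_subset hv with rfl | hv
  · rw [imageSystem_range]; exact le_top
  · intro y hy
    obtain ⟨x, hx, rfl⟩ := (hc.mem_imageSystem hY hYZ (lt_of_le_of_lt hwv hv)).1 hy
    have hle : (⟨w, lt_of_le_of_lt hwv hv⟩ : {s : Finset ℕ // s ⊂ Finset.range n}) ≤ ⟨v, hv⟩ := hwv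
    exact (hc.mem_imageSystem hY hYZ hv).2
      ⟨R.e hle x, (hY.mem_iff hle x).2 hx, hc.compat hle x (hYZ _ hx)⟩

/-- A point in both sets comes from `Z` at `w ∩ v`. By injectivity of the map at `v` and by
`mem_iff` it already comes from `Y` there. This gives the intersection condition for `Y`, and for
faces of `Y` with faces of `Z`. -/
theorem imageSystem_inf_le (hc : Cocone R Z P h) (hY : W.OpenAdapted R μ Y)
    (hZ : W.OpenAdapted R μ' Z) (hYZ : ∀ s, Y s ⊆ Z s)
    (HZ : K.IsSystem μ' P (Finset.range n).powerset (imageSystem Z h)) {w v : Finset ℕ}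
    (hw : w ⊂ Finset.range n) (hv : v ⊂ Finset.range n) :
    imageSystem Z h w ⊓ imageSystem Y h v ≤ imageSystem Y h (w ∩ v) := by
  rintro y ⟨hyw, hyv⟩
  have hwv : w ∩ v ⊂ Finset.range n := lt_of_le_of_lt Finset.inter_subset_left hw
  have hyZ : y ∈ imageSystem Z h (w ∩ v) := by
    rw [HZ.inter w (Finset.mem_powerset.2 hw.subset) v (Finset.mem_powerset.2 hv.subset)]
    exact ⟨hyw, imageSystem_mono hYZ v hyv⟩
  obtain ⟨x, hx, rfl⟩ := (hc.mem_imageSystem hY hYZ hv).1 hyv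
  obtain ⟨z, hz, hzx⟩ := (hc.mem_imageSystem hZ (fun _ => subset_rfl) hwv).1 hyZ
  have hle : (⟨w ∩ v, hwv⟩ : {s : Finset ℕ // s ⊂ Finset.range n}) ≤ ⟨v, hv⟩ :=
    Finset.inter_subset_right
  have hez : R.e hle z = x := by
    refine (hc.emb ⟨v, hv⟩).injOn ((hZ.mem_closure _).2 ((hZ.mem_iff hle z).2 hz))
      ((hZ.mem_closure _).2 (hYZ _ hx)) ?_
    rw [hc.compat hle z hz, hzx]
  exact (hc.mem_imageSystem hY hYZ hwv).2 ⟨z, (hY.mem_iff hle z).1 (hez ▸ hx), hzx⟩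

theorem isAmalgBase_imageSystem (hc : Cocone R Z P h) (hY : W.OpenAdapted R μ Y)
    (hZ : W.OpenAdapted R μ' Z) (hYZ : ∀ s, Y s ⊆ Z s)
    (t : {s : Finset ℕ // s ⊂ Finset.range n})
    (hb : K.IsAmalgBase μ (R.M t) t.1.ssubsets (res (R.face t) (Y t))) :
    K.IsAmalgBase μ P t.1.ssubsets (imageSystem Y h) :=
  (isAmalgBase_img_iff (hZ.strong t) (hc.emb t)
    (fun w _ => (res_le_closure w).trans (Substructure.closure_mono (hYZ t)))
    fun _ hw => hc.imageSystem_eq hY hYZ (Finset.mem_ssubsets.1 hw).subset).2 hb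

/-- `Adapted.indep_bdry` inside `R.M t`, carried to `P` by `h t`. The family `Z` only provides the
submodel on which `h t` is a `K`-embedding. -/
theorem indep_imageSystem (hc : Cocone R Z P h) (hY : W.OpenAdapted R μ Y)
    (hY' : W.OpenAdapted R μ' Y') (hYY' : ∀ s, Y s ⊆ Y' s) {μ'' : Cardinal.{u}}
    (hZ : W.OpenAdapted R μ'' Z) (hYZ : ∀ s, Y' s ⊆ Z s) (hgood : W.GoodAt μ)
    (t : {s : Finset ℕ // s ⊂ Finset.range n})
    (hb : K.IsAmalgBase μ (R.M t) t.1.ssubsets (res (R.face t) (Y t))) :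
    W.Indep P (imageSystem Y h t.1) (bdry (imageSystem Y h) t.1)
      (bdry (imageSystem Y' h) t.1) := by
  have hYZ' : ∀ s, Y s ⊆ Z s := fun s => (hYY' s).trans (hYZ s)
  have hle : ∀ w, res (R.face t) (Y t) w ≤ Substructure.closure L (Z t) := fun w =>
    (res_le_closure w).trans (Substructure.closure_mono (hYZ' t))
  have hle' : ∀ w, res (R.face t) (Y' t) w ≤ Substructure.closure L (Z t) := fun w =>
    (res_le_closure w).trans (Substructure.closure_mono (hYZ t))
  have hcard := hY.card t
  have h1 : W.Indep (R.M t) (res (R.face t) (Y t) t.1)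
      (unionOf t.1.ssubsets (res (R.face t) (Y t))) (bdry (res (R.face t) (Y' t)) t.1) :=
    ((hY.adapted t).indep_bdry t.1 subset_rfl (hcard.symm ▸ hgood) (hcard.symm ▸ hb)).mono_right
      hb.ab_bdry ((Adapted.bdry_res_subset _).trans Set.subset_union_left)
  have h2 := (indep_img_iff (hZ.strong t) (hc.emb t) hb (fun w _ => hle w)
    (A := res (R.face t) (Y t) t.1) (B := bdry (res (R.face t) (Y' t)) t.1) (hle t.1)
    (fun x ⟨w, _, hx⟩ => hle' w hx)).2 h1
  have hbd : bdry (imageSystem Y h) t.1 = h t '' bdry (res (R.face t) (Y t)) t.1 :=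
    unionOf_img (hc.emb t) (fun w _ => hle w) fun w hw =>
      hc.imageSystem_eq hY hYZ' (Finset.mem_ssubsets.1 hw).subset
  have hbd' : bdry (imageSystem Y' h) t.1 = h t '' bdry (res (R.face t) (Y' t)) t.1 :=
    unionOf_img (hc.emb t) (fun w _ => hle' w) fun w hw =>
      hc.imageSystem_eq hY' hYZ (Finset.mem_ssubsets.1 hw).subset
  rw [hbd, hbd', hc.imageSystem_eq hY hYZ' (t := t) subset_rfl, (hc.emb t).coe_img_of_le (hle _)]
  exact h2

end Cocone

theorem OpenAdapted.isAmalgBase_res (hY : W.OpenAdapted R μ Y) (hgood : W.GoodAt μ)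
    (hR : ∀ s, W.IsStable lam s.1 (R.M s) (R.face s)) (t : {s : Finset ℕ // s ⊂ Finset.range n})
    (hne : t.1.Nonempty) : K.IsAmalgBase μ (R.M t) t.1.ssubsets (res (R.face t) (Y t)) := by
  obtain ⟨r, hr⟩ := exists_isRank
  have H := (isStable_iff.1 (hR t)).1.weaken (ρ' := fun t w => r w < r t)
    fun t w _ _ h => hr.not_subset h
  have := (hY.adapted t).isAmalgBase_res ((hY.card t).symm ▸ hgood) hr H subset_rfl hne
  rwa [hY.card t] at this

/-- The submodels `Y s` of a stable image are stable. -/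
theorem StableCocone.isStable_of_subset (hc : W.StableCocone R μ Z P h) (hgood : W.GoodAt μ)
    (hR : ∀ s, W.IsStable lam s.1 (R.M s) (R.face s)) (hY : W.OpenAdapted R μ Y)
    (hZ : W.OpenAdapted R μ Z) (hYZ : ∀ s, Y s ⊆ Z s) :
    W.IsStable μ (Finset.range n) P (imageSystem Y h) := by
  have hcc := hc.toCocone
  obtain ⟨HZ, -⟩ := isStable_iff.1 hc.isStable
  have hP := mk_eq_of_top hc.isStable.cube.1 hc.isStable.cube.2
  have hbase : ∀ t, t ⊂ Finset.range n → t.Nonempty →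
      K.IsAmalgBase μ P t.ssubsets (imageSystem Y h) := fun t ht hne =>
    hcc.isAmalgBase_imageSystem hY hZ hYZ ⟨t, ht⟩ (hY.isAmalgBase_res hgood hR ⟨t, ht⟩ hne)
  have hcases : ∀ w ∈ (Finset.range n).powerset, w = Finset.range n ∨ w ⊂ Finset.range n :=
    fun w hw => eq_or_ssubset_of_subset (Finset.mem_powerset.1 hw)
  refine isStable_iff.2 ⟨⟨⟨HZ.sys.nonempty, HZ.sys.down, fun w hw => ?_, fun w hw v hv hwv => ?_,
    fun w hw v hv => ?_, fun w hw => ?_⟩, hbase, fun t ht hne => ?_⟩, imageSystem_range⟩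
  · rcases hcases w hw with rfl | hw
    · rw [imageSystem_range]; exact K.strong_top P.mem
    · exact hcc.strong_imageSystem hY hZ hYZ hw
  · exact hcc.imageSystem_le hY hYZ hwv (Finset.mem_powerset.1 hv)
  · rcases hcases w hw with rfl | hw'
    · rw [Finset.inter_eq_right.2 (Finset.mem_powerset.1 hv), imageSystem_range, top_inf_eq]
    · rcases hcases v hv with rfl | hv'
      · rw [Finset.inter_eq_left.2 (Finset.mem_powerset.1 hw), imageSystem_range, inf_top_eq]
      · refine le_antisymm (le_inf (hcc.imageSystem_le hY hYZ Finset.inter_subset_left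
          hw'.subset) (hcc.imageSystem_le hY hYZ Finset.inter_subset_right hv'.subset)) ?_
        exact (inf_le_inf_right _ (imageSystem_mono hYZ w)).trans
          (hcc.imageSystem_inf_le hY hZ hYZ HZ.sys hw' hv')
  · rcases hcases w hw with rfl | hw
    · rw [imageSystem_range, mk_top, hP]
    · exact hcc.card_imageSystem hY hYZ hw
  · have h1 := hcc.indep_imageSystem hY hZ hYZ hZ (fun _ => subset_rfl) hgood ⟨t, ht⟩
      (hY.isAmalgBase_res hgood hR ⟨t, ht⟩ hne)
    have hab := (hbase t ht hne).ab_bdry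
    have habZ := (HZ.base t ht hne).ab_bdry
    -- Transitivity through the boundary for `Z`, over which the larger face is independent by
    -- stability.
    refine (h1.trans hab habZ ?_ ((HZ.indep t ht hne).mono_left habZ fun x hx =>
      Or.inl (imageSystem_mono hYZ t hx))).mono_right hab ?_
    · intro x hx
      obtain ⟨w, hw, hx⟩ := mem_bdry.1 hx
      exact mem_bdry.2 ⟨w, hw, imageSystem_mono hYZ w hx⟩
    · rintro x ⟨w, hw, htw, hx⟩
      exact Or.inl ⟨w, hw, htw, imageSystem_mono hYZ w hx⟩

/-- The successor step for the existence property. -/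
theorem StableCocone.exists_succ (hc : W.StableCocone R μ Y P h) (hgood : W.GoodAt μ)
    (hR : ∀ s, W.IsStable lam s.1 (R.M s) (R.face s)) (hn : 1 ≤ n) (hlam : K.LS ≤ lam)
    (hY : W.OpenAdapted R μ Y) (hZ : W.OpenAdapted R μ Z) (hYZ : ∀ s, Y s ⊆ Z s) :
    ∃ (P' : K.Model) (h' : ∀ s, R.M s → P') (g : P ↪[L] P'), #P' = μ ∧
      W.StableCocone R μ Z P' h' ∧ K.IsKEmb g ∧ ∀ s, ∀ x ∈ Y s, g (h s x) = h' s x := by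
  classical
  -- A stable realization of `Z` by itself. It contains a realization of `Y`, which is stable but so
  -- far unrelated to `P`.
  obtain ⟨N, k, hN, hk⟩ := hZ.exists_stableCocone hgood hR hn
  have hkc := hk.toCocone
  obtain ⟨HZ, -⟩ := isStable_iff.1 hk.isStable
  have H₀ := hk.isStable_of_subset hgood hR hY hZ hYZ
  have hkY : ∀ s, K.KEmbOn (Substructure.closure L (Y s)) (k s) := fun s =>
    (hkc.emb s).mono (hZ.strong s) (hY.strong s) (Substructure.closure_mono (hYZ s))
  have hPc := mk_eq_of_top hc.isStable.cube.1 hc.isStable.cube.2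
  have hPne := nonempty_of_card hgood.le hPc
  have hRne : ∀ s, Nonempty (R.M s) := fun s => nonempty_of_card hlam (R.card s)
  choose κ hκ hκk using fun s => (hkY s).exists_inverse (hY.strong s)
  -- The identification of the copy of `Y` in `N` with its copy in `P`.
  obtain ⟨φ, hφ⟩ := exists_glue
    (fun s : {s : Finset ℕ // s ⊂ Finset.range n} => (imageSystem Y k s.1 : Set N))
    (fun s y => h s (κ s y)) (by
      intro s t y hys hyt
      have hst : s.1 ∩ t.1 ⊂ Finset.range n := lt_of_le_of_lt Finset.inter_subset_left s.2
      have hy : y ∈ imageSystem Y k (s.1 ∩ t.1) :=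
        hkc.imageSystem_inf_le hY hZ hYZ HZ.sys s.2 t.2 ⟨imageSystem_mono hYZ _ hys, hyt⟩
      obtain ⟨x, hx, rfl⟩ := (hkc.mem_imageSystem hY hYZ hst).1 hy
      have haux : ∀ v (hv : (⟨s.1 ∩ t.1, hst⟩ : {s : Finset ℕ // s ⊂ Finset.range n}) ≤ v),
          h v (κ v (k ⟨s.1 ∩ t.1, hst⟩ x)) = h ⟨s.1 ∩ t.1, hst⟩ x := by
        intro v hv
        rw [← hkc.compat hv x (hYZ _ hx), hκk v _ ((hY.mem_closure v).2 ((hY.mem_iff hv x).2 hx)),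
          hc.compat hv x hx]
      exact (haux s Finset.inter_subset_left).trans (haux t Finset.inter_subset_right).symm)
  have hφk : ∀ s, ∀ x ∈ Y s, φ (k s x) = h s x := by
    intro s x hx
    rw [hφ s (k s x) ((hkc.mem_imageSystem hY hYZ s.2).2 ⟨x, hx, rfl⟩)]
    exact congrArg (h s) (hκk s x ((hY.mem_closure s).2 hx))
  have hκmem : ∀ s, ∀ y ∈ imageSystem Y k s.1, κ s y ∈ Substructure.closure L (Y s) := by
    intro s y hy
    obtain ⟨x, hx, rfl⟩ := (hkc.mem_imageSystem hY hYZ s.2).1 hy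
    have hx' := (hY.mem_closure s).2 hx
    rwa [hκk s x hx']
  have hφK : ∀ s, s ⊂ Finset.range n → K.KEmbOn (imageSystem Y k s) φ := by
    intro s hs
    have h1 : K.KEmbOn (imageSystem Y k s) (κ ⟨s, hs⟩) := by
      rw [imageSystem_coe ⟨s, hs⟩]; exact hκ ⟨s, hs⟩
    exact ((hc.emb ⟨s, hs⟩).comp (hY.strong _) h1 (hκmem ⟨s, hs⟩)).congr (hφ ⟨s, hs⟩)
  have hφimg : ∀ s, s ⊂ Finset.range n → imageSystem Y h s = img φ (imageSystem Y k s) := by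
    intro s hs
    rw [imageSystem_coe (h := k) ⟨s, hs⟩, img_img (hkY _) le_rfl, imageSystem_coe ⟨s, hs⟩]
    exact (img_congr fun x hx => hφk ⟨s, hs⟩ x ((hY.mem_closure _).1 hx)).symm
  -- Weak uniqueness in dimension `n`, over the copies of `Y`, puts `N` and `P` into one model.
  obtain ⟨Q, γ, γ', hQ, hγ, hγ', hγγ⟩ := (hgood.weakUniqueness hn).exists_kEmbOn hgood.le
    (isStable_iff.1 H₀).1 (isStable_iff.1 hc.isStable).1 hφK hφimg
  rw [imageSystem_range] at hγ hγ'
  obtain ⟨p, hp, hpγ⟩ := hγ'.exists_embedding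
  let D : Finset ℕ → L.Substructure N := fun w =>
    if n ∈ w then imageSystem Z k (w.erase n) else imageSystem Y k w
  have hDi : ∀ u, u ⊆ Finset.range n → D (insert n u) = imageSystem Z k u := by
    intro u hu
    have h1 : D (insert n u) = imageSystem Z k ((insert n u).erase n) :=
      if_pos (Finset.mem_insert_self _ _)
    rw [h1, Finset.erase_insert fun h => Finset.notMem_range_self (hu h)]
  have hDo : ∀ u, u ⊆ Finset.range n → D u = imageSystem Y k u := fun u hu =>
    if_neg fun h => Finset.notMem_range_self (hu h)
  have hH₀ := (isStable_iff.1 H₀).1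
  -- Existence in dimension `n + 1`, with `P` at `range n`, the images of `Y` at the other faces
  -- without `n`, and those of `Z` at the faces through `n`.
  obtain ⟨P', T, g, θ, HT, hg, -, hθ, hθg⟩ :=
    (hgood.existence (n := n + 1) (by omega)).exists_step hgood.le (K.strong_top N.mem) hp hγ
      (D := D) (fun _ _ _ => le_top)
      (fun w hw hwn => by
        rcases face_cases hw hwn with hw | ⟨u, hu, rfl⟩
        · rw [hDo w hw.subset]; exact hH₀.strong hw.subset
        · rw [hDi u hu.subset]; exact HZ.strong hu.subset)
      (fun w hw hwn v hv hvn => by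
        have hnm : ∀ {u : Finset ℕ}, u ⊂ Finset.range n → n ∉ u := fun hu h =>
          Finset.notMem_range_self (hu.subset h)
        rcases face_cases hw hwn with hw | ⟨u, hu, rfl⟩ <;>
          rcases face_cases hv hvn with hv | ⟨u', hu', rfl⟩
        · rw [hDo w hw.subset, hDo v hv.subset,
            hDo _ (Finset.inter_subset_left.trans hw.subset), hH₀.inter hw.subset hv.subset]
        · rw [Finset.inter_insert_of_notMem (hnm hw), hDo w hw.subset, hDi u' hu'.subset,
            hDo _ (Finset.inter_subset_left.trans hw.subset)]
          refine le_antisymm (le_inf (hH₀.mono Finset.inter_subset_left hw.subset)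
            ((imageSystem_mono hYZ _).trans (HZ.mono Finset.inter_subset_right hu'.subset))) ?_
          rw [inf_comm, Finset.inter_comm]
          exact hkc.imageSystem_inf_le hY hZ hYZ HZ.sys hu' hw
        · rw [Finset.insert_inter_of_notMem (hnm hv), hDo v hv.subset, hDi u hu.subset,
            hDo _ (Finset.inter_subset_left.trans hu.subset)]
          refine le_antisymm (le_inf ((imageSystem_mono hYZ _).trans
            (HZ.mono Finset.inter_subset_left hu.subset))
            (hH₀.mono Finset.inter_subset_right hv.subset)) ?_
          exact hkc.imageSystem_inf_le hY hZ hYZ HZ.sys hu hv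
        · rw [← Finset.insert_inter_distrib, hDi u hu.subset, hDi u' hu'.subset,
            hDi _ (Finset.inter_subset_left.trans hu.subset), HZ.inter hu.subset hu'.subset])
      (fun u hu => by
        obtain ⟨r, hr⟩ := exists_isRank
        have H := (isStable_iff.1 (hR ⟨u, hu⟩)).1.weaken (ρ' := fun t w => r w < r t)
          fun t w _ _ h => hr.not_subset h
        -- The faces below `insert n u` are images of traces taken in the single model at `u`, on
        -- the two adapted sets given by `Y` and `Z`.
        have h1 := stableIn_doubleRes (hY.adapted ⟨u, hu⟩) (hZ.adapted ⟨u, hu⟩) (hYZ _)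
          (hY.card _) (hZ.card _) hgood hr H (a := n)
          (fun h => Finset.notMem_range_self (hu.subset h)) subset_rfl
        refine (stableWrt_img_iff (hZ.strong ⟨u, hu⟩) (hkc.emb ⟨u, hu⟩) (fun w hw => ?_)
          fun w hw => ?_).2 h1
        · by_cases hnw : n ∈ w
          · rw [doubleRes_of_mem hnw]
            exact res_le_closure _
          · rw [doubleRes_of_notMem hnw]
            exact (res_le_closure _).trans (Substructure.closure_mono (hYZ _))
        · by_cases hnw : n ∈ w
          · rw [doubleRes_of_mem hnw, ← hkc.imageSystem_eq hZ (fun _ => subset_rfl)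
              (t := ⟨u, hu⟩) (Finset.subset_insert_iff.1 hw)]
            exact if_pos hnw
          · rw [doubleRes_of_notMem hnw, ← hkc.imageSystem_eq hY hYZ
              (t := ⟨u, hu⟩) ((Finset.subset_insert_iff_of_notMem hnw).1 hw)]
            exact if_neg hnw)
      hc.isStable
      (fun s hs => by
        rw [hDo s hs.subset, hφimg s hs, ← img_emb, img_img (hφK s hs) le_rfl]
        exact img_congr fun y hy => (hpγ _).trans (hγγ s hs y hy).symm)
  have hP' := mk_eq_of_top HT.cube.1 HT.cube.2
  obtain ⟨HT', htop⟩ := isStable_iff.1 HT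
  have hθK : ∀ s : {s : Finset ℕ // s ⊂ Finset.range n},
      K.KEmbOn (imageSystem Z k s.1) θ ∧ T (insert n s.1) = img θ (imageSystem Z k s.1) := by
    intro s
    have h1 := hθ _ (insert_ssubset_range s.2) insert_ne_range
    rwa [hDi s.1 s.2.subset] at h1
  refine ⟨P', fun s x => θ (k s x), g, hP', ⟨⟨fun s => ?_, fun {s t} hst x hx => ?_⟩,
    fun w => T (insert n w), ?_, fun s => ?_⟩, hg, fun s x hx => ?_⟩
  · refine (hθK s).1.comp (HZ.strong s.2.subset) (hkc.emb s) fun x hx => ?_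
    exact (hkc.mem_imageSystem hZ (fun _ => subset_rfl) s.2).2 ⟨x, (hZ.mem_closure s).1 hx, rfl⟩
  · exact congrArg θ (hkc.compat hst x hx)
  -- The new realization of `Z` consists of the faces through `n`.
  · refine isStable_iff.2 ⟨hgood.stableIn_topFace HT' subset_rfl, ?_⟩
    rw [← Finset.range_add_one, htop]
  · change T (insert n s.1) = _
    rw [(hθK s).2, imageSystem_coe, img_img (hkc.emb s) le_rfl]
  · have hy : k s x ∈ imageSystem Y k s.1 := (hkc.mem_imageSystem hY hYZ s.2).2 ⟨x, hx, rfl⟩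
    refine (hθg s.1 s.2 (k s x) (by rwa [hDo s.1 s.2.subset]) (h s x) ?_).symm
    rw [hpγ, hγγ s.1 s.2 _ hy, hφk s x hx]

end WeakForking

/-! ### Limits of cocones; existence in `lam`. -/

namespace WeakForking

open FirstOrder.Language

variable {L : FirstOrder.Language.{u, u}} {K : AEC L} {W : WeakForking K} {P : K.Model}
  {μ lam : Cardinal.{u}} {n : ℕ} {R : OpenSystem K lam n}

/-- A union of a chain of stable cocones is stable. -/
theorem Cocone.stableCocone_of_chain {ι : Type*} [LinearOrder ι] [Nonempty ι]
    {ν : ι → Cardinal.{u}} {Y : ι → ∀ s, Set (R.M s)} {Z : ∀ s, Set (R.M s)} {h : ∀ s, R.M s → P}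
    (hc : Cocone R Z P h) (hZ : W.OpenAdapted R μ Z) (hY : ∀ i, W.OpenAdapted R (ν i) (Y i))
    (hmono : ∀ i j, i ≤ j → ∀ s, Y i s ⊆ Y j s) (hle : ∀ i s, Y i s ⊆ Z s)
    (hex : ∀ s, ∀ x ∈ Z s, ∃ i, x ∈ Y i s) (hP : #P = μ) (hgood : ∀ i, W.GoodAt (ν i))
    (hR : ∀ s, W.IsStable lam s.1 (R.M s) (R.face s))
    (hst : ∀ i, ∃ (Q : K.Model) (h' : ∀ s, R.M s → Q) (g : Q ↪[L] P),
      W.StableCocone R (ν i) (Y i) Q h' ∧ K.IsKEmb g ∧ ∀ s, ∀ x ∈ Y i s, g (h' s x) = h s x)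
    (hb : ∀ t : {s : Finset ℕ // s ⊂ Finset.range n}, t.1.Nonempty →
      K.IsAmalgBase μ (R.M t) t.1.ssubsets (res (R.face t) (Z t))) :
    W.StableCocone R μ Z P h := by
  choose Q h' g hQ hg hgh using hst
  set T : ι → Finset ℕ → L.Substructure P := fun i w =>
    (imageSystem (Y i) (h' i) w).map (g i).toHom with hTdef
  have hT : ∀ i, W.StableIn (ν i) (Finset.range n) P (T i) := fun i =>
    (stableWrt_map_iff (hg i) fun _ _ => rfl).2 (isStable_iff.1 (hQ i).isStable).1
  have hTeq : ∀ i w, w ⊂ Finset.range n → T i w = imageSystem (Y i) h w := by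
    intro i w hw
    have hr : ∀ s, Y i s ⊆ Y i s := fun _ => subset_rfl
    ext y
    rw [hc.mem_imageSystem (hY i) (hle i) hw]
    constructor
    · rintro ⟨z, hz, rfl⟩
      obtain ⟨x, hx, rfl⟩ := ((hQ i).toCocone.mem_imageSystem (hY i) hr hw).1 hz
      exact ⟨x, hx, (hgh i _ x hx).symm⟩
    · rintro ⟨x, hx, rfl⟩
      exact ⟨_, ((hQ i).toCocone.mem_imageSystem (hY i) hr hw).2 ⟨x, hx, rfl⟩, hgh i _ x hx⟩
  have hbdry : ∀ i t, t ⊂ Finset.range n → bdry (T i) t = bdry (imageSystem (Y i) h) t := by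
    intro i t ht
    ext x
    rw [mem_bdry, mem_bdry]
    constructor
    · rintro ⟨w, hw, hx⟩
      exact ⟨w, hw, hTeq i w (hw.trans ht) ▸ hx⟩
    · rintro ⟨w, hw, hx⟩
      exact ⟨w, hw, (hTeq i w (hw.trans ht)).symm ▸ hx⟩
  have hTle : ∀ i w, w ⊂ Finset.range n → T i w ≤ imageSystem Z h w := fun i w hw => by
    rw [hTeq i w hw]; exact imageSystem_mono (hle i) w
  have hTmono : ∀ w, w ⊂ Finset.range n → Monotone fun i => T i w := fun w hw i j hij => by
    change T i w ≤ T j w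
    rw [hTeq i w hw, hTeq j w hw]
    exact imageSystem_mono (hmono i j hij) w
  have hTex : ∀ w, w ⊂ Finset.range n → ∀ x ∈ imageSystem Z h w, ∃ i, x ∈ T i w := by
    intro w hw y hy
    obtain ⟨x, hx, rfl⟩ := (hc.mem_imageSystem hZ (fun _ => subset_rfl) hw).1 hy
    obtain ⟨i, hi⟩ := hex _ x hx
    exact ⟨i, by rw [hTeq i w hw]; exact (hc.mem_imageSystem (hY i) (hle i) hw).2 ⟨x, hi, rfl⟩⟩
  have hcases : ∀ w ∈ (Finset.range n).powerset, w = Finset.range n ∨ w ⊂ Finset.range n :=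
    fun w hw => eq_or_ssubset_of_subset (Finset.mem_powerset.1 hw)
  have hZZ : ∀ s, Z s ⊆ Z s := fun _ => subset_rfl
  have hsys : K.IsSystem μ P (Finset.range n).powerset (imageSystem Z h) := by
    refine ⟨⟨∅, by simp⟩,
      fun _ ha _ hb => Finset.mem_powerset.2 (hb.trans (Finset.mem_powerset.1 ha)),
      fun w hw => ?_, fun w hw v hv hwv => hc.imageSystem_le hZ hZZ hwv (Finset.mem_powerset.1 hv),
      fun w hw v hv => ?_, fun w hw => ?_⟩
    · rcases hcases w hw with rfl | hw
      · rw [imageSystem_range]; exact K.strong_top P.mem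
      · exact hc.strong_imageSystem hZ hZ hZZ hw
    · rcases hcases w hw with rfl | hw'
      · rw [Finset.inter_eq_right.2 (Finset.mem_powerset.1 hv), imageSystem_range, top_inf_eq]
      · rcases hcases v hv with rfl | hv'
        · rw [Finset.inter_eq_left.2 (Finset.mem_powerset.1 hw), imageSystem_range, inf_top_eq]
        · refine le_antisymm (le_inf (hc.imageSystem_le hZ hZZ Finset.inter_subset_left
            hw'.subset) (hc.imageSystem_le hZ hZZ Finset.inter_subset_right hv'.subset)) ?_
          -- The intersection condition is checked at a stage that contains the point in both faces.
          rintro y ⟨hyw, hyv⟩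
          obtain ⟨i, hi⟩ := hTex w hw' y hyw
          obtain ⟨j, hj⟩ := hTex v hv' y hyv
          refine hTle (max i j) _ (lt_of_le_of_lt Finset.inter_subset_left hw') ?_
          rw [(hT (max i j)).inter hw'.subset hv'.subset]
          exact ⟨hTmono w hw' (le_max_left i j) hi, hTmono v hv' (le_max_right i j) hj⟩
    · rcases hcases w hw with rfl | hw
      · rw [imageSystem_range, mk_top, hP]
      · exact hc.card_imageSystem hZ hZZ hw
  refine ⟨hc, imageSystem Z h, isStable_iff.2 ⟨stableIn_of_chain hsys (fun t ht hne => ?_) hT hTmono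
    hTle hTex (fun t ht hne i j hij => ?_), imageSystem_range⟩, fun s => imageSystem_coe s⟩
  · exact hc.isAmalgBase_imageSystem hZ hZ hZZ ⟨t, ht⟩ (hb ⟨t, ht⟩ hne)
  · rw [hTeq i t ht, hbdry i t ht, hbdry j t ht]
    exact hc.indep_imageSystem (hY i) (hY j) (hmono i j hij) hZ (hle j) (hgood i) ⟨t, ht⟩
      ((hY i).isAmalgBase_res (hgood i) hR ⟨t, ht⟩ hne)

/-- Almost all subsets of `lam` induce adapted families for an open system, when its models are
identified with `lam`. -/
theorem exists_setClub_openAdapted (hκ : W.κ ≤ K.LS) (hlam : K.LS ≤ lam)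
    (hR : ∀ s, W.IsStable lam s.1 (R.M s) (R.face s)) (b : ∀ s, R.M s ≃ lam.out) :
    ∃ C : Set (Set lam.out), SetClub K.LS C ∧ ∀ X ∈ C,
      W.OpenAdapted R #X (fun s => b s ⁻¹' X) := by
  have hLS := K.aleph0_le_LS
  have hne : ∀ s, Nonempty (R.M s) := fun s => nonempty_of_card hlam (R.card s)
  choose D hD hDX using fun s => exists_setClub_adapted hκ (hR s).cube.1 (hR s).cube.2
  have : Finite {s : Finset ℕ // s ⊂ Finset.range n} :=
    Set.Finite.subset (Finset.finite_toSet (Finset.range n).powerset)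
      fun s hs => Finset.mem_coe.2 (Finset.mem_powerset.2 (subset_of_ssubset hs))
  let J := {p : {s : Finset ℕ // s ⊂ Finset.range n} × {s : Finset ℕ // s ⊂ Finset.range n} //
    p.1 ≤ p.2}
  -- Closure under the transition maps and under their left inverses gives the two directions of
  -- `mem_iff`.
  refine ⟨_, (SetClub.iInter hLS fun s => (hD s).comap (b s).injective hLS).inter hLS
    ((SetClub.iInter hLS fun p : J => SetClub.closed_unary hLS
      fun x => b p.1.2 (R.e p.2 ((b p.1.1).symm x))).inter hLS
    (SetClub.iInter hLS fun p : J => SetClub.closed_unary hLS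
      fun x => b p.1.1 (Function.invFun (R.e p.2) ((b p.1.2).symm x)))), ?_⟩
  rintro X ⟨h1, h2, h3⟩
  rw [Set.mem_iInter] at h1 h2 h3
  refine ⟨fun s => hDX s _ (h1 s), fun s => ?_, fun {s t} hst x => ⟨fun hx => ?_, fun hx => ?_⟩⟩
  · exact Cardinal.mk_preimage_equiv (b s) X
  · have := h3 ⟨(s, t), hst⟩ _ hx
    simp only [Equiv.symm_apply_apply] at this
    rwa [Function.leftInverse_invFun (R.e hst).injective x] at this
  · have := h2 ⟨(s, t), hst⟩ _ hx
    simp only [Equiv.symm_apply_apply] at this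
    exact this

/-- All models of the open system are filtered simultaneously, through bijections with one set of
cardinality `lam`. Stable realizations of the small parts are then extended along the filtration. -/
theorem GoodBelow.hasExistence (hgood : W.GoodBelow lam) (hlam : K.LS < lam) (hκ : W.κ ≤ K.LS)
    (hn : 1 ≤ n) : W.HasExistence lam n := by
  intro R hR
  have hLS := K.aleph0_le_LS
  have hlam0 : ℵ₀ ≤ lam := hLS.trans hlam.le
  have hlim : Order.IsSuccLimit lam.ord := Cardinal.isSuccLimit_ord hlam0
  have hJ : Nonempty {s : Finset ℕ // s ⊂ Finset.range n} :=
    ⟨⟨∅, Finset.empty_ssubset.2 (Finset.nonempty_range_iff.2 (by omega))⟩⟩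
  have b : ∀ s, R.M s ≃ lam.out := fun s =>
    Classical.choice (Cardinal.eq.1 ((R.card s).trans (Cardinal.mk_out lam).symm))
  obtain ⟨C, hC, hCX⟩ := exists_setClub_openAdapted hκ hlam.le hR b
  obtain ⟨X, -, hX⟩ := hC.exists_filtration hLS hlam (Cardinal.mk_out lam) ∅ (by simp)
  let Y : Ordinal.{u} → ∀ s, Set (R.M s) := fun i s => b s ⁻¹' X i
  have hY : ∀ i, W.OpenAdapted R #(X i) (Y i) := fun i => hCX _ (hX.mem i)
  have hYm : ∀ i j, i ≤ j → ∀ s, Y i s ⊆ Y j s := fun i j hij s =>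
    Set.preimage_mono (hX.mono hij)
  have hYlim : ∀ δ, Order.IsSuccLimit δ → ∀ s, ∀ x ∈ Y δ s, ∃ j < δ, x ∈ Y j s := by
    intro δ hδ s x hx
    have h1 : b s x ∈ X δ := hx
    rw [hX.limit δ hδ] at h1
    obtain ⟨j, hj, h1⟩ := Set.mem_iUnion₂.1 h1
    exact ⟨j, hj, h1⟩
  have hYtop : ∀ s x, x ∈ Y lam.ord s := by
    intro s x
    change b s x ∈ X lam.ord
    rw [hX.top]
    trivial
  have hXtop : #(X lam.ord) = lam := by rw [hX.top, Cardinal.mk_univ, Cardinal.mk_out]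
  have hgoodX : ∀ i < lam.ord, W.GoodAt #(X i) := fun i hi =>
    hgood _ (hX.le_card i) (hX.card_lt i hi)
  -- At `i = lam.ord` the traces are the full faces, and their boundaries are bases by
  -- `GoodBelow.boundaries`. Existence in `lam` depends here on weak uniqueness in `lam`.
  have hbase : ∀ i ≤ lam.ord, ∀ t : {s : Finset ℕ // s ⊂ Finset.range n}, t.1.Nonempty →
      K.IsAmalgBase #(X i) (R.M t) t.1.ssubsets (res (R.face t) (Y i t)) := by
    intro i hi t hne
    rcases hi.eq_or_lt with rfl | hi
    · have hres : ∀ w, res (R.face t) (Y lam.ord t) w = R.face t w := by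
        intro w
        ext x
        rw [((hY lam.ord).adapted t).mem_res]
        exact and_iff_right (hYtop t x)
      rw [funext hres, hXtop]
      exact hgood.boundaries hlam hκ _ _ _ hne (isStable_iff.1 (hR t)).1
    · exact (hY i).isAmalgBase_res (hgoodX i hi) hR t hne
  let D : ∀ s : {s : Finset ℕ // s ⊂ Finset.range n}, Ordinal.{u} → L.Substructure (R.M s) :=
    fun s i => Substructure.closure L (Y i s)
  let Φ : ∀ (_ : Ordinal.{u}) (P : K.Model), (∀ s, R.M s → P) → Prop := fun i P h =>
    W.StableCocone R #(X i) (Y i) P h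
  have htower : IsTower D (fun i => #(X i)) lam := by
    refine ⟨fun s i j hij => Substructure.closure_mono (hYm i j hij s), fun s i => (hY i).strong s,
      fun s δ hδ x hx => ?_, fun s i => (hY i).card_closure s, hX.card_lt, hX.ord_card_le,
      fun i => hLS.trans (hX.le_card i)⟩
    obtain ⟨j, hj, h1⟩ := hYlim δ hδ s x (((hY δ).mem_closure s).1 hx)
    exact ⟨j, hj, ((hY j).mem_closure s).2 h1⟩
  obtain ⟨M, h, hM⟩ := exists_stage (Φ := Φ) hlam0 htower (by
      obtain ⟨P, h, hP, hc⟩ := (hY 0).exists_stableCocone (hgoodX 0 hlim.bot_lt) hR hn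
      exact ⟨P, h, hP, hc.emb, hc⟩)
    (by
      intro i hi P h hP
      have hZ := hY (i + 1)
      rw [hX.card_succ i] at hZ
      obtain ⟨P', h', g, hP', hc, hg, hgh⟩ := StableCocone.exists_succ hP.prop (hgoodX i hi) hR hn
        hlam.le (hY i) hZ (hYm _ _ le_self_add)
      refine ⟨P', h', g, ⟨hP'.trans (hX.card_succ i).symm, hc.emb, ?_⟩, hg, fun s x hx =>
        hgh s x (((hY i).mem_closure s).1 hx)⟩
      change W.StableCocone R #(X (i + 1)) _ _ _
      rw [hX.card_succ i]
      exact hc)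
    (by
      intro δ hδle hδ U h hU hh hcof
      -- The stages that map into `U` are only known to be cofinal below `δ`, which is enough for a
      -- chain with the right union.
      let ι := {j : Ordinal.{u} // j < δ ∧ ∃ (P : K.Model) (h' : ∀ s, R.M s → P) (g : P ↪[L] U),
        IsStage D (fun i => #(X i)) Φ j P h' ∧ StageLE D j h' h g}
      have hex : ∀ s, ∀ x ∈ Y δ s, ∃ j : ι, x ∈ Y j.1 s := by
        intro s x hx
        obtain ⟨i, hi, hxi⟩ := hYlim δ hδ s x hx
        obtain ⟨j, hij, hj, h1⟩ := hcof i hi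
        exact ⟨⟨j, hj, h1⟩, hYm i j hij s hxi⟩
      have hne : Nonempty ι := by
        obtain ⟨j, -, hj, h1⟩ := hcof 0 hδ.bot_lt
        exact ⟨⟨j, hj, h1⟩⟩
      have hc : Cocone R (Y δ) U h := by
        refine ⟨hh, fun {s t} hst x hx => ?_⟩
        obtain ⟨⟨j, hj, P, h', g, hP, hg⟩, hxj⟩ := hex s x hx
        rw [← hg.2 s x (((hY j).mem_closure s).2 hxj),
          ← hg.2 t _ (((hY j).mem_closure t).2 (((hY j).mem_iff hst x).2 hxj)),
          hP.prop.compat hst x hxj]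
      refine hc.stableCocone_of_chain (ι := ι) (hY δ) (fun j => hY j.1)
        (fun i j hij => hYm _ _ hij) (fun j => hYm _ _ j.2.1.le) hex hU
        (fun j => hgoodX j.1 (j.2.1.trans_le hδle)) hR (fun j => ?_) (hbase δ hδle)
      obtain ⟨j, hj, P, h', g, hP, hg⟩ := j
      exact ⟨P, h', g, hP.prop, hg.1, fun s x hx => hg.2 s x (((hY j).mem_closure s).2 hx)⟩)
  have htop : ∀ s, Substructure.closure L (Y lam.ord s) = ⊤ := fun s =>
    eq_top_iff.2 fun x _ => ((hY _).mem_closure s).2 (hYtop s x)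
  have hc : W.StableCocone R #(X lam.ord) (Y lam.ord) M h := hM.prop
  rw [hXtop] at hc
  have hemb : ∀ s, K.KEmbOn (⊤ : L.Substructure (R.M s)) (h s) := fun s => by
    rw [← htop s]; exact hc.emb s
  choose f hf hfh using fun s => (hemb s).exists_embedding
  refine ⟨M, _, f, hc.isStable, hf, fun s => ?_, fun {s t} hst x => ?_⟩
  · rw [imageSystem_coe, htop s]
    ext y
    rw [(hemb s).mem_img]
    constructor
    · rintro ⟨x, rfl⟩
      exact ⟨x, trivial, (hfh s x).symm⟩
    · rintro ⟨x, -, rfl⟩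
      exact ⟨x, hfh s x⟩
  · rw [hfh, hfh]
    exact hc.compat hst x (hYtop s x)

end WeakForking

/-! ### The induction on the cardinal, and tameness. -/

namespace WeakForking

open FirstOrder.Language

variable {L : FirstOrder.Language.{u, u}} {K : AEC L} {W : WeakForking K} {lam : Cardinal.{u}}

/-- Goodness passes from `LS(K)` to all larger cardinals. -/
theorem Excellent.goodAt (hW : W.Excellent) (hκ : W.κ ≤ K.LS) (hlam : K.LS ≤ lam) :
    W.GoodAt lam := by
  induction lam using WellFoundedLT.induction with
  | ind lam ih =>
    rcases hlam.eq_or_lt with rfl | hlt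
    · exact ⟨le_rfl, hW⟩
    · have hgood : W.GoodBelow lam := fun μ hμ hlt => ih μ hlt hμ
      exact ⟨hlam, fun n hn => ⟨hgood.hasSymmetry hlt hκ n, hgood.hasExistence hlt hκ hn,
        hgood.hasWeakUniqueness hlt hκ hn⟩⟩

/-- A submodel of small cardinality that receives two small strong submodels. -/
theorem exists_small_codomain {N₁ N₂ N : K.Model} {g₁ : N₁ ↪[L] N} {g₂ : N₂ ↪[L] N}
    (hg₁ : K.IsKEmb g₁) (hg₂ : K.IsKEmb g₂) {E : L.Substructure N₁} {E' : L.Substructure N₂}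
    (hE : K.Strong E) (hE' : K.Strong E') (hc : #E = K.LS) (hc' : #E' = K.LS) :
    ∃ (P : K.Model) (p : P ↪[L] N) (h : N₁ → P) (h' : N₂ → P), #P = K.LS ∧ K.KEmbOn E h ∧
      K.KEmbOn E' h' ∧ (∀ x ∈ E, p (h x) = g₁ x) ∧ ∀ x ∈ E', p (h' x) = g₂ x := by
  obtain ⟨T, hT, hAT, hTc⟩ := K.exists_strong N.mem (g₁ '' E ∪ g₂ '' E')
  have hi : #(g₁ '' (E : Set N₁)) = K.LS := (Cardinal.mk_image_eq g₁.injective).trans hc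
  have hi' : #(g₂ '' (E' : Set N₂)) = K.LS := (Cardinal.mk_image_eq g₂.injective).trans hc'
  have hLS := Cardinal.add_eq_self K.aleph0_le_LS
  have hTLS : #T = K.LS := by
    refine le_antisymm (hTc.trans ?_) ?_
    · refine (add_le_add_left (Cardinal.mk_union_le _ _) _).trans ?_
      rw [hi, hi', hLS, hLS]
    · rw [← hi]
      exact Cardinal.mk_le_mk_of_subset (Set.subset_union_left.trans hAT)
  have hm : ∀ x : E, g₁.comp E.subtype x ∈ T := fun x => hAT (Or.inl ⟨x, x.2, rfl⟩)
  have hm' : ∀ x : E', g₂.comp E'.subtype x ∈ T := fun x => hAT (Or.inr ⟨x, x.2, rfl⟩)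
  have : Nonempty (N.sub T hT) := nonempty_of_card le_rfl hTLS
  obtain ⟨h, hh, hhg, -⟩ := AEC.exists_kEmbOn (P := N.sub T hT)
    ((hg₁.domRestrict hE).codRestrict hT hm)
  obtain ⟨h', hh', hhg', -⟩ := AEC.exists_kEmbOn (P := N.sub T hT)
    ((hg₂.domRestrict hE').codRestrict hT hm')
  refine ⟨N.sub T hT, T.subtype, h, h', hTLS, hh, hh', fun x hx => ?_, fun x hx => ?_⟩
  · rw [hhg ⟨x, hx⟩]; rfl
  · rw [hhg' ⟨x, hx⟩]; rfl

/-- The pairs formed by `M` with `N₁` and with `N₂` are stable systems of dimension `1` with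
isomorphic boundaries. They are amalgamated step by step, with `R` prescribing that `a₁` and `a₂` be
identified. The first stage meets `M` in a strong submodel of size `LS(K)`, over which the
hypothesis provides an amalgam with this identification. -/
theorem GoodBelow.sameGaloisType (hgood : W.GoodBelow lam) (hlam : K.LS < lam) (hκ : W.κ ≤ K.LS)
    {M N₁ N₂ : K.Model} (hM : #M = lam) (hN₁ : #N₁ = lam) (hN₂ : #N₂ = lam) {e₁ : M ↪[L] N₁}
    {e₂ : M ↪[L] N₂} (he₁ : K.IsKEmb e₁) (he₂ : K.IsKEmb e₂) {a₁ : N₁} {a₂ : N₂}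
    (h : ∀ S : L.Substructure M, K.Strong S → #S ≤ K.LS →
      K.SameGaloisType (e₁.comp S.subtype) (e₂.comp S.subtype) a₁ a₂) :
    K.SameGaloisType e₁ e₂ a₁ a₂ := by
  classical
  have hc₁ : #(e₁.toHom.range) = lam := (Cardinal.mk_congr e₁.equivRange.toEquiv).symm.trans hM
  have hc₂ : #(e₂.toHom.range) = lam := (Cardinal.mk_congr e₂.equivRange.toEquiv).symm.trans hM
  have : Nonempty N₂ := ⟨a₂⟩
  have hw : ∀ w, w ⊂ Finset.range 1 → w = ∅ := fun w hw =>
    Finset.ssubset_singleton_iff.1 hw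
  obtain ⟨φ, hφ, hφe, himg⟩ := AEC.exists_kEmbOn
    (he₂.comp (isKEmb_equiv e₁.equivRange.symm (K.mem_of_strong _ he₁.2).1))
  have hφe' : ∀ x, φ (e₁ x) = e₂ x := by
    intro x
    refine (hφe (e₁.equivRange x)).trans ?_
    simp
  have hrange : e₂.toHom.range = img φ e₁.toHom.range := by
    ext y
    rw [hφ.mem_img]
    constructor
    · rintro ⟨x, rfl⟩
      exact ⟨e₁ x, ⟨x, rfl⟩, hφe' x⟩
    · rintro ⟨_, ⟨x, rfl⟩, rfl⟩
      exact ⟨x, (hφe' x).symm⟩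
  obtain ⟨N, g, g', -, hg, hg', hgg, ha⟩ := hgood.exists_amalgam hlam hκ
    (isStable_range_one he₁.2 hc₁ hN₁) (isStable_range_one he₂.2 hc₂ hN₂) (φ := φ)
    (fun s hs => by rw [if_pos (hw s hs)]; exact hφ)
    (fun s hs => by rw [if_pos (hw s hs), if_pos (hw s hs)]; exact hrange)
    (fun x y => x = a₁ ∧ y = a₂) (A := {a₁}) (A' := {a₂})
    (by simpa using Cardinal.one_le_aleph0.trans K.aleph0_le_LS)
    (by simpa using Cardinal.one_le_aleph0.trans K.aleph0_le_LS)
    (fun _ _ h => h) (by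
      intro E E' hE hE' hEc hEc' hAE hAE' H H' himgE
      have h0 : (∅ : Finset ℕ) ⊂ Finset.range 1 := by simp
      have hst := H.strong (Finset.empty_subset _)
      have hcard := H.card (Finset.empty_subset _)
      have hE0 := himgE ∅ h0
      rw [if_pos rfl] at hst hcard hE0
      rw [if_pos rfl] at hE0
      have hmap : ((E ⊓ e₁.toHom.range).comap e₁.toHom).map e₁.toHom = E ⊓ e₁.toHom.range := by
        ext y
        constructor
        · rintro ⟨x, hx, rfl⟩
          exact hx
        · rintro ⟨hy, x, rfl⟩
          exact ⟨x, ⟨hy, x, rfl⟩, rfl⟩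
      have hS : K.Strong ((E ⊓ e₁.toHom.range).comap e₁.toHom) :=
        he₁.strong_of_map (by rwa [hmap])
      obtain ⟨N, g₁, g₂, hg₁, hg₂, hgg, hga⟩ := h _ hS (by
        rw [← hcard]
        exact Cardinal.mk_le_of_injective (f := fun x => ⟨e₁ x.1, x.2⟩) fun x y hxy =>
          Subtype.ext (e₁.injective (Subtype.mk.inj hxy)))
      -- The model that witnesses equality of types may be of any size, while the first stage must
      -- have cardinality `LS(K)`.
      obtain ⟨P, p, k, k', hP, hk, hk', hpk, hpk'⟩ :=
        exists_small_codomain hg₁ hg₂ hE hE' hEc hEc'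
      refine ⟨P, k, k', hP, hk, hk', fun s hs x hx => p.injective ?_, ?_⟩
      · rw [if_pos (hw s hs)] at hx
        have hx' : φ x ∈ E' ⊓ e₂.toHom.range := by
          rw [hE0, ← SetLike.mem_coe, hφ.coe_img_of_le inf_le_right]
          exact ⟨x, hx, rfl⟩
        rw [hpk x hx.1, hpk' _ hx'.1]
        obtain ⟨hxE, z, rfl⟩ := hx
        have := hgg ⟨z, hxE, z, rfl⟩
        exact this.trans (congrArg g₂ (hφe' z).symm)
      · rintro x y ⟨rfl, rfl⟩
        refine p.injective ?_
        rw [hpk _ (hAE rfl), hpk' _ (hAE' rfl), hga])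
  refine ⟨N, g, g', hg, hg', fun x => ?_, ha _ _ ⟨rfl, rfl⟩⟩
  rw [hgg ∅ (by simp) (e₁ x) (by rw [if_pos rfl]; exact ⟨x, rfl⟩), hφe']

end WeakForking

theorem mainTheorem2 {L : FirstOrder.Language.{u, u}} (K : AEC L) (W : WeakForking K)
    (hκ : W.κ ≤ K.LS) (hW : W.Excellent) :
    (∀ (n : ℕ) (lam : Cardinal.{u}), 1 ≤ n → K.LS ≤ lam → W.IsGood lam n) ∧
      K.Tame K.LS := by
  refine ⟨fun n lam hn hlam => (hW.goodAt hκ hlam).good n hn,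
    fun μ hμ => (hW.goodAt hκ hμ).AP, fun M N₁ N₂ hM h₁ h₂ e₁ e₂ he₁ he₂ a₁ a₂ h => ?_⟩
  exact WeakForking.GoodBelow.sameGaloisType (fun μ hμ _ => hW.goodAt hκ hμ) hM hκ rfl h₁ h₂
    he₁ he₂ h
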